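/- **The game.** There are $n$ processes, all initially good; an adversary who sees the entire history (but not future coin flips) may adaptively corrupt up to $f$ of them, where $n=(4+\epsilon)f$ and $0<\epsilon\le 1/2$. Let $B$ be the current set of bad (corrupted) processes. The processes create blackboards $\mathsf{BB}_1,\mathsf{BB}_2,\dots$, one per *iteration*; $T$ consecutive iterations form an *epoch*, and there are $K_{\max}=\lfloor 2.5f\rfloor$ epochs. Before $\mathsf{BB}_t$ is constructed the adversary commits to a direction $\sigma(t)\in\{-1,1\}$. A blackboard has $n$ columns with $m$ cells each. The adversary schedules the writes one at a time: process $i$ writes to the next empty cell of column $i$ a value in $\{-1,1\}$, which is a fresh fair coin flip if $i$ is good and the adversary's choice if $i$ is bad. The adversary may declare $\mathsf{BB}_t$ complete once at least $n-f$ columns are full. It then determines for each process $p$ a view $\mathsf{BB}^{(p,t)}$ of the history $(\mathsf{BB}_1,\dots,\mathsf{BB}_t)$, in which at most $f$ cells are replaced by blanks, each of them the last cell that some process has written so far. Let $X_i(t)$ and $X_i^{(p)}(t)$ be the sum of column $i$ of $\mathsf{BB}_t$, resp. of $\mathsf{BB}_t$ in a view of $p$, mapped to the nearest point of $[-X_{\max},X_{\max}]$,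 $X_{\max}=\sqrt{cm\ln n}$. In iteration $t$ of epoch $k$, process $p$ outputs $\mathrm{sgn}\big(\sum_i w_{i,k-1}X_i^{(p)}(t)\big)$, where $\mathrm{sgn}(x)=1$ if $x\ge0$ and $-1$ otherwise. *Agreement is reached* (the game ends naturally) if in some iteration $t$ all good processes output $-\sigma(t)$. **The weights.** $w_{i,0}=1$. Let $\alpha_T=m\big(T+\sqrt{T(c\ln n)^3}\big)$, $\beta_T=m\sqrt{T(c\ln n)^3}$ and $w_{\min}=\sqrt{n\ln n}/T$. After epoch $k$, put $w_i=w_{i,k-1}$ and, with sums over the iterations of the epoch, $\mathrm{dev}(i)=\sum_t(w_iX_i(t))^2$ and $\mathrm{corr}(i,j)=\sum_t w_iw_jX_i(t)X_j(t)$; let $\mathrm{dev}^{(p)},\mathrm{corr}^{(p)}$ be the same quantities in the view that $p$ has at the end of the epoch. The excess graph is the complete graph on the processes with self-loops, with capacities $$c_V(i)=w_i,\quad c_E(i,i)=\tfrac{16}{\epsilon f\alpha_T}\max\{0,\mathrm{dev}(i)-w_i^2\alpha_T\},\quad c_E(i,j)=\tfrac{16}{\epsilon f\alpha_T}\cdot2\max\{0,\mathrm{corr}(i,j)-w_iw_j\beta_T\}\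 (i\ne j),$$ and similarly for $p$ with $\mathrm{dev}^{(p)},\mathrm{corr}^{(p)}$. Let $\mu^{(p)}$ be the fractional matching that Rising Tide computes on the excess graph of $p$: starting from $0$ on the edges of positive capacity, all $\mu(i,j)$ increase in lockstep, and $\mu(i,j)$ is frozen as soon as $\mu(i,j)=c_E(i,j)$, $\sum_l\mu(i,l)=c_V(i)$ or $\sum_l\mu(j,l)=c_V(j)$ (self-loops count once). Put $w^{(p)}_{i,k}=w_i-\sum_j\mu^{(p)}(i,j)$, and let $w_{i,k}=w_{i,k}^{(i)}$ if this exceeds $w_{\min}$ and $w_{i,k}=0$ otherwise. **Lemma.** There are absolute constants $\kappa,c_0>0$ such that for every $c\ge c_0$ there are $a_m,a_T>0$ (depending only on $c$) such that for all $b_m\ge a_m$ and $b_T\ge a_T$ there is $N$ with the following property. Let $n\ge N$, $n=(4+\epsilon)f$, $0<\epsilon\le1/2$, $a_m\frac{n}{\epsilon^2}\le m\le b_m\frac{n}{\epsilon^2}$ and $a_T\frac{n^2\ln^3n}{\epsilon^2}\le T\le b_T\frac{n^2\ln^3n}{\epsilon^2}$. Then, against every strategy of the adversary, with probability at least $1-n^{-\kappa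 c}$ both of the following hold. 1. At the end of each epoch in which no process is corrupted and by the end of which agreement has not been reached, $\sum_{\{i,j\}\subseteq B}c_E(i,j)\ge1$ (self-loops included), in the excess graph of the actual blackboards and in the one of every view with at most $f$ blanks as above, in particular of every process's view. 2. If agreement has not been reached after all $K_{\max}$ epochs, then every bad process has weight $w_{i,K_{\max}}=0$. -/

import Mathlib

noncomputable section

open MeasureTheory
open scoped Classical

/-! ## Fractional matchings and the Rising Tide algorithm -/

/-- A complete undirected graph with self-loops and with vertex and edge capacities. -/
structure CapGraph (V : Type) where
  cV : V → ℝ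
  cE : Sym2 V → ℝ

namespace CapGraph

variable {V : Type} [Fintype V]

/-- The saturation level of `i`; the self-loop `s(i, i)` counts once. -/
def load (μ : Sym2 V → ℝ) (i : V) : ℝ := ∑ j, μ s(i, j)

/-- `μ` is a feasible fractional matching of `G`. -/
def Feasible (G : CapGraph V) (μ : Sym2 V → ℝ) : Prop :=
  (∀ e, 0 ≤ μ e ∧ μ e ≤ G.cE e) ∧ ∀ i, load μ i ≤ G.cV i

/-- `μ` increased by `δ` on all edges of the working set `E'`. -/
def raise (μ : Sym2 V → ℝ) (E' : Finset (Sym2 V)) (δ : ℝ) : Sym2 V → ℝ :=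
  fun e => μ e + if e ∈ E' then δ else 0

/-- The edges of `E'` for which neither the edge nor one of its endpoints is saturated. -/
def unsaturated (G : CapGraph V) (μ : Sym2 V → ℝ) (E' : Finset (Sym2 V)) : Finset (Sym2 V) :=
  E'.filter fun e => μ e ≠ G.cE e ∧ ∀ i ∈ e, load μ i ≠ G.cV i

/-- One pass through the loop of Rising Tide: raise all edges of the working set `E'` by the
maximum amount that keeps the matching feasible, then delete the saturated edges from `E'`. -/
def tideStep (G : CapGraph V) (x : (Sym2 V → ℝ) × Finset (Sym2 V)) :
    (Sym2 V → ℝ) × Finset (Sym2 V) :=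
  if x.2 = ∅ then x
  else
    let μ' := raise x.1 x.2 (sSup {δ : ℝ | 0 ≤ δ ∧ G.Feasible (raise x.1 x.2 δ)})
    (μ', G.unsaturated μ' x.2)

/-- The output of Rising Tide. Each pass deletes at least one edge from the working set, and a
pass with an empty working set changes nothing, so as many passes as there are edges suffice. -/
def risingTide (G : CapGraph V) : Sym2 V → ℝ :=
  (G.tideStep^[Fintype.card (Sym2 V)]
    (fun _ => 0, Finset.univ.filter fun e => 0 < G.cE e)).1

end CapGraph

/-! ## The iterated coin-flipping game -/

/-- The parameters: `n` processes, at most `f` corruptions, blackboards with `m` rows, epochs of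
`T` iterations, the resilience parameter `ε` and the constant `c` of the thresholds. -/
structure Params where
  n : ℕ
  f : ℕ
  m : ℕ
  T : ℕ
  ε : ℝ
  c : ℝ

namespace Params

/-- `X_max`, the bound enforced on the sum of a column. -/
def Xmax (P : Params) : ℝ := √(P.c * P.m * Real.log P.n)

/-- The deviation threshold `α_T`. -/
def α (P : Params) : ℝ := P.m * (P.T + √(P.T * (P.c * Real.log P.n) ^ 3))

/-- The correlation threshold `β_T`. -/
def β (P : Params) : ℝ := P.m * √(P.T * (P.c * Real.log P.n) ^ 3)

/-- Weights that are at most `w_min` are rounded down to `0`. -/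
def wmin (P : Params) : ℝ := √(P.n * Real.log P.n) / P.T

/-- The number of epochs, `K_max = 2.5 f` (rounded down). -/
def Kmax (P : Params) : ℕ := 5 * P.f / 2

/-- The total number of iterations, that is, of blackboards. -/
def iterations (P : Params) : ℕ := P.Kmax * P.T

end Params

/-- A coin or direction: `true` stands for `1` and `false` for `-1`. -/
def signVal (b : Bool) : ℝ := if b then 1 else -1

/-- `sgn x` is `1` if `x ≥ 0` and `-1` otherwise. -/
def sgn (x : ℝ) : Bool := decide (0 ≤ x)

/-- The moves of the adversary:
* corrupt process `i`;
* begin the next iteration, committing to the adversarial direction `σ`;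
* schedule the next write of process `i` to its column of the current blackboard (the value `v` is
  used only if `i` is bad; a good process writes a fair coin flip);
* declare the current blackboard complete. For each process `p`, the view that `p` then forms of
  the history of all blackboards misses the last value written by each process in `A p`. -/
inductive Move (n : ℕ) where
  | corrupt (i : Fin n)
  | start (σ : Bool)
  | write (i : Fin n) (v : Bool)
  | complete (A : Fin n → Finset (Fin n))

/-- The state of the game. -/
structure State (P : Params) where
  /-- the number of completed iterations, which is also the index of the current iteration -/
  t : ℕ
  /-- the adversarial direction of the current iteration, if that has begun -/
  dir : Option Bool
  /-- the corrupted processes -/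
  bad : Finset (Fin P.n)
  /-- the processes that were corrupted when the first iteration of the current epoch began -/
  startBad : Finset (Fin P.n)
  /-- `board τ i` lists the values in column `i` of the blackboard of iteration `τ` -/
  board : ℕ → Fin P.n → List Bool
  /-- the consensus weights used in the current epoch -/
  weight : Fin P.n → ℝ
  /-- the game has ended naturally, i.e. agreement has been reached -/
  agreed : Prop
  /-- the full history of the play, latest move first -/
  log : List (Move P.n)

namespace State

variable {P : Params}

/-- The initial state. -/
def init (P : Params) : State P where
  t := 0
  dir := none
  bad := ∅
  startBad := ∅
  board := fun _ _ => []
  weight := fun _ => 1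
  agreed := False
  log := []

/-- Column `i` of the blackboard of iteration `τ` in the view of the history in which the last
value written so far by each process in `A` is missing. -/
def viewCol (s : State P) (A : Finset (Fin P.n)) (τ : ℕ) (i : Fin P.n) : List Bool :=
  if i ∈ A ∧ ∀ τ', τ < τ' → s.board τ' i = [] then (s.board τ i).dropLast else s.board τ i

/-- `X_i(τ)` in the view with missing values `A`: the sum of column `i`, mapped to the nearest
point of `[-X_max, X_max]`. -/
def X (s : State P) (A : Finset (Fin P.n)) (τ : ℕ) (i : Fin P.n) : ℝ :=
  max (-P.Xmax) (min P.Xmax ((s.viewCol A τ i).map signVal).sum)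

/-- The output of the coin flip of the current iteration in the view with missing values `A`. -/
def coinFlip (s : State P) (A : Finset (Fin P.n)) : Bool :=
  sgn (∑ i, s.weight i * s.X A s.t i)

/-- When the current iteration is the last one of its epoch: the iterations of that epoch. -/
def epoch (s : State P) : Finset ℕ := Finset.Ico (s.t + 1 - P.T) (s.t + 1)

/-- The deviation score of `i` over the epoch, in the view with missing values `A`. -/
def dev (s : State P) (A : Finset (Fin P.n)) (i : Fin P.n) : ℝ :=
  ∑ τ ∈ s.epoch, (s.weight i * s.X A τ i) ^ 2

/-- The correlation score of `i` and `j` over the epoch, in the view with missing values `A`. -/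
def corr (s : State P) (A : Finset (Fin P.n)) (i j : Fin P.n) : ℝ :=
  ∑ τ ∈ s.epoch, s.weight i * s.weight j * s.X A τ i * s.X A τ j

/-- The excess graph at the end of the epoch, in the view with missing values `A`. -/
def excess (s : State P) (A : Finset (Fin P.n)) : CapGraph (Fin P.n) where
  cV := s.weight
  cE := Sym2.lift ⟨fun i j =>
    16 / (P.ε * P.f * P.α) *
      if i = j then max 0 (s.dev A i - s.weight i ^ 2 * P.α)
      else 2 * max 0 (s.corr A i j - s.weight i * s.weight j * P.β), by
    intro i j
    have h : s.corr A i j = s.corr A j i :=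
      Finset.sum_congr rfl fun τ _ => by ring
    by_cases hij : i = j
    · subst hij; rfl
    · simp only [if_neg hij, if_neg (Ne.symm hij), h, mul_comm (s.weight i) (s.weight j)]⟩

/-- The weight of `i` after the epoch, computed in the view with missing values `A`. -/
def localWeight (s : State P) (A : Finset (Fin P.n)) (i : Fin P.n) : ℝ :=
  s.weight i - CapGraph.load (s.excess A).risingTide i

/-- The consensus weight of `i` after the epoch: it is computed in the view of `i` itself, and
rounded down to `0` unless it exceeds `w_min`. -/
def nextWeight (s : State P) (A : Fin P.n → Finset (Fin P.n)) (i : Fin P.n) : ℝ :=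
  if P.wmin < s.localWeight (A i) i then s.localWeight (A i) i else 0

/-- The legal moves. At most `f` processes may be corrupted, a column has `m` cells, a blackboard
may be declared complete only once at least `n - f` of its columns are full, and the view of each
process misses at most `f` values. -/
def Legal (s : State P) : Move P.n → Prop
  | .corrupt i => i ∉ s.bad ∧ s.bad.card < P.f
  | .start _ => s.dir = none
  | .write i _ => s.dir ≠ none ∧ (s.board s.t i).length < P.m
  | .complete A => s.dir ≠ none ∧
      P.n - P.f ≤ (Finset.univ.filter fun i => P.m ≤ (s.board s.t i).length).card ∧
      ∀ p, (A p).card ≤ P.f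

end State

/-- A strategy of the adversary, who sees the entire history, but no future coin flips. -/
structure Adversary (P : Params) where
  move : State P → Move P.n
  legal : ∀ s : State P, s.Legal (move s)

/-- One coin for each cell of each blackboard; the coin of a cell is flipped when a good process
writes to the cell. -/
abbrev Coins (P : Params) : Type := Fin P.iterations × Fin P.m × Fin P.n → Bool

/-- The coins are independent and fair. -/
def coinMeasure (P : Params) : Measure (Coins P) :=
  Measure.pi fun _ => (PMF.uniformOfFintype Bool).toMeasure

namespace State

variable {P : Params}

/-- The coin for row `r` of column `i` of the blackboard of iteration `τ`. -/
def coin (ω : Coins P) (τ r : ℕ) (i : Fin P.n) : Bool :=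
  if h : τ < P.iterations ∧ r < P.m then ω (⟨τ, h.1⟩, ⟨r, h.2⟩, i) else true

/-- The value that is written when process `i` is scheduled. -/
def writtenValue (ω : Coins P) (s : State P) (i : Fin P.n) (v : Bool) : Bool :=
  if i ∈ s.bad then v else coin ω s.t (s.board s.t i).length i

/-- The effect of a move. When an iteration is completed, the game ends naturally if the coin flip
of every good process has the outcome opposite to the adversarial direction; when an epoch is
completed, the weights are updated. -/
def apply (ω : Coins P) (s : State P) : Move P.n → State P
  | .corrupt i => { s with
      bad := insert i s.bad
      log := .corrupt i :: s.log }
  | .start σ => { s with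
      dir := some σ
      startBad := if P.T ∣ s.t then s.bad else s.startBad
      log := .start σ :: s.log }
  | .write i v => { s with
      board := Function.update s.board s.t
        (Function.update (s.board s.t) i (s.board s.t i ++ [writtenValue ω s i v]))
      log := .write i (writtenValue ω s i v) :: s.log }
  | .complete A => { s with
      t := s.t + 1
      dir := none
      weight := if P.T ∣ s.t + 1 then s.nextWeight A else s.weight
      agreed := s.agreed ∨ ∀ p, p ∉ s.bad → s.dir = some (!(s.coinFlip (A p)))
      log := .complete A :: s.log }

/-- The play stops after all `K_max` epochs. -/
def step (𝒜 : Adversary P) (ω : Coins P) (s : State P) : State P :=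
  if s.t = P.iterations then s else s.apply ω (𝒜.move s)

end State

/-- The state of the game after `k` moves. -/
def play {P : Params} (𝒜 : Adversary P) (ω : Coins P) (k : ℕ) : State P :=
  (State.step 𝒜 ω)^[k] (State.init P)

/-- The `k`-th move completes an epoch such that no process was corrupted in the course of that
epoch and agreement has not been reached by the end of it. -/
def EndsCleanEpoch {P : Params} (𝒜 : Adversary P) (ω : Coins P) (k : ℕ) : Prop :=
  (play 𝒜 ω (k + 1)).t = (play 𝒜 ω k).t + 1 ∧ P.T ∣ (play 𝒜 ω k).t + 1 ∧
    (play 𝒜 ω k).startBad = (play 𝒜 ω k).bad ∧ ¬ (play 𝒜 ω (k + 1)).agreed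

/-- At the end of every epoch without corruptions and without agreement, the edge capacities of
the excess graph sum up to at least `1` on the edges (self-loops included) between bad processes.
This is claimed for the excess graph of the actual blackboards (`A = ∅`) as well as for the one in
every view that a process may have. -/
def BadCapacityAtLeastOne {P : Params} (𝒜 : Adversary P) (ω : Coins P) : Prop :=
  ∀ k, EndsCleanEpoch 𝒜 ω k → ∀ A : Finset (Fin P.n), A.card ≤ P.f →
    1 ≤ ∑ e ∈ (play 𝒜 ω k).bad.sym2, ((play 𝒜 ω k).excess A).cE e

/-- If agreement has not been reached when all `K_max` epochs are over, then every bad process has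
weight `0`. -/
def BadWeightsVanish {P : Params} (𝒜 : Adversary P) (ω : Coins P) : Prop :=
  ∀ k, (play 𝒜 ω k).t = P.iterations → ¬ (play 𝒜 ω k).agreed →
    ∀ i ∈ (play 𝒜 ω k).bad, (play 𝒜 ω k).weight i = 0

end

noncomputable section

open scoped Classical Topology
open Filter

namespace CapGraph

/-! ### Rising Tide: every edge ends at its capacity or at a bottleneck vertex. -/

section RisingTide

/-! The proof separates chance from bookkeeping. A play is typical (`Typical`) if no column sum of a
good process is truncated, the squares and products of good columns over each epoch stay below `P.α`
and `P.β`, and in each epoch without corruptions and agreement the squares of the bad processes'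
weighted sums are large in total. Typical plays satisfy both claims deterministically, and atypical
ones are improbable (`measure_exists_not_typical_le`).

Why the bad sums are large: if an iteration brings no agreement, some good process outputs the
adversarial direction, so the bad columns must have offset the good ones whenever these pointed the
other way (`badSum_sq_ge`). The direction is fixed before the coins, so the opposing part of the
good sum has expected square about half the variance. By `Balanced.heavy` the full good columns have
variance at least about `2m(∑ w² + 0.45 εf)`, the sum being over the bad processes; here `n = (4 +
ε) f` is used. Half of this exceeds what the diagonal thresholds allow the bad processes by a
multiple of `εfm`. Since the adversary chooses adaptively which columns to fill, the second moment
is controlled by a potential that compares the weighted walk with a fixed number of tiny steps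
(`heat_le_average`, `value_average`). Multiplying over the iterations of an epoch gives a
supermartingale, `fraudPotential`, and Markov's inequality yields `measure_fraud_le`. The good
columns themselves are handled by ordinary exponential potentials (`measure_dev_le`,
`measure_corr_le`).

The bookkeeping: edges between good processes have no capacity, so the matching takes no more weight
from the good than from the bad, which keeps the play `Balanced`. After an epoch without corruptions
and agreement the edges inside the bad set have total capacity at least 4 (`four_le_sum_excess`).
Hence either a bad process of positive weight is saturated and drops to 0, or the bad processes
together lose at least 3 (`exists_kill_or_drop`). Charging 3 per epoch to a corruption, to a killed
process or to lost weight allows at most `7f / 3` epochs, fewer than `Kmax`; so agreement is always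
reached in a typical play, and the second claim becomes vacuous.

Processes compute weights from different views. This is harmless because the loads of Rising Tide
are Lipschitz in the capacities (`sum_abs_load_sub_le`): every view's load is within `wmin` of the
true one, and rounding below `wmin` turns saturation in the true graph into weight exactly 0. -/

lemma raise_zero {V : Type} (μ : Sym2 V → ℝ) (E' : Finset (Sym2 V)) : raise μ E' 0 = μ := by
  funext e; simp [raise]

variable {V : Type} [Fintype V]

/-- Every unsaturated edge has a saturated endpoint at which no edge carries more. -/
def Bottleneck (G : CapGraph V) (μ : Sym2 V → ℝ) : Prop :=
  ∀ e, μ e = G.cE e ∨ ∃ i ∈ e, load μ i = G.cV i ∧ ∀ j, μ s(i, j) ≤ μ e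

/-- The number of edges of `E'` at `i`. -/
def activeDegree (E' : Finset (Sym2 V)) (i : V) : ℝ := ∑ j, if s(i, j) ∈ E' then 1 else 0

lemma load_raise (μ : Sym2 V → ℝ) (E' : Finset (Sym2 V)) (δ : ℝ) (i : V) :
    load (raise μ E' δ) i = load μ i + δ * activeDegree E' i := by
  simp only [load, raise, activeDegree, Finset.sum_add_distrib, Finset.mul_sum, mul_ite, mul_one,
    mul_zero]

lemma activeDegree_nonneg (E' : Finset (Sym2 V)) (i : V) : 0 ≤ activeDegree E' i :=
  Finset.sum_nonneg fun j _ => by split_ifs <;> norm_num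

lemma activeDegree_eq_zero {E' : Finset (Sym2 V)} {i : V} (h : ∀ j, s(i, j) ∉ E') :
    activeDegree E' i = 0 :=
  Finset.sum_eq_zero fun j _ => if_neg (h j)

/-- The invariant of the loop of Rising Tide: all edges of the working set are at level `θ`. -/
structure TideInv (G : CapGraph V) (x : (Sym2 V → ℝ) × Finset (Sym2 V)) (θ : ℝ) : Prop where
  feasible : G.Feasible x.1
  active : ∀ e ∈ x.2, x.1 e = θ
  le : ∀ e, x.1 e ≤ θ
  frozen : ∀ e, e ∉ x.2 → x.1 e = G.cE e ∨
    ∃ i ∈ e, load x.1 i = G.cV i ∧ (∀ j, s(i, j) ∉ x.2) ∧ ∀ j, x.1 s(i, j) ≤ x.1 e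

/-- The amount by which Rising Tide raises the edges of the working set. -/
def maxRaise (G : CapGraph V) (μ : Sym2 V → ℝ) (E' : Finset (Sym2 V)) : ℝ :=
  sSup {δ : ℝ | 0 ≤ δ ∧ G.Feasible (raise μ E' δ)}

lemma raise_bddAbove {G : CapGraph V} {μ : Sym2 V → ℝ} {E' : Finset (Sym2 V)}
    (hE : E'.Nonempty) : BddAbove {δ : ℝ | 0 ≤ δ ∧ G.Feasible (raise μ E' δ)} := by
  obtain ⟨e, he⟩ := hE
  refine ⟨G.cE e - μ e, fun δ hδ => ?_⟩
  have := (hδ.2.1 e).2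
  simp only [raise, if_pos he] at this
  linarith

/-- The feasible raises are cut out by finitely many non-strict linear inequalities, so their
supremum is itself feasible. -/
lemma maxRaise_spec {G : CapGraph V} {μ : Sym2 V → ℝ} {E' : Finset (Sym2 V)}
    (hE : E'.Nonempty) (h : G.Feasible μ) :
    0 ≤ G.maxRaise μ E' ∧ G.Feasible (raise μ E' (G.maxRaise μ E')) := by
  have hb := raise_bddAbove (G := G) (μ := μ) hE
  have h0 : (0 : ℝ) ∈ {δ : ℝ | 0 ≤ δ ∧ G.Feasible (raise μ E' δ)} :=
    ⟨le_rfl, by rwa [raise_zero]⟩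
  have hnn : 0 ≤ G.maxRaise μ E' := le_csSup hb h0
  refine ⟨hnn, fun e => ⟨?_, ?_⟩, fun i => ?_⟩
  · have := (h.1 e).1
    simp only [raise]
    split_ifs <;> linarith
  · by_cases he : e ∈ E'
    · have : G.maxRaise μ E' ≤ G.cE e - μ e := by
        refine csSup_le ⟨0, h0⟩ fun δ hδ => ?_
        have := (hδ.2.1 e).2
        simp only [raise, if_pos he] at this
        linarith
      simp only [raise, if_pos he]
      linarith
    · simpa [raise, he] using (h.1 e).2
  · rw [load_raise]
    rcases (activeDegree_nonneg E' i).eq_or_lt with hd | hd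
    · rw [← hd]; simpa using h.2 i
    · have : G.maxRaise μ E' ≤ (G.cV i - load μ i) / activeDegree E' i := by
        refine csSup_le ⟨0, h0⟩ fun δ hδ => ?_
        have := hδ.2.2 i
        rw [load_raise] at this
        rw [le_div_iff₀ hd]; linarith
      rw [le_div_iff₀ hd] at this
      linarith

/-- Were every edge of the working set unsaturated, all constraints involving it would be slack at
the supremum, and a slightly larger raise would still be feasible. -/
lemma exists_saturated {G : CapGraph V} {μ : Sym2 V → ℝ} {E' : Finset (Sym2 V)}
    (hE : E'.Nonempty) (h : G.Feasible μ) :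
    ∃ e ∈ E', e ∉ G.unsaturated (raise μ E' (G.maxRaise μ E')) E' := by
  obtain ⟨hnn, hf⟩ := maxRaise_spec hE h
  by_contra! hcon
  set δ₀ := G.maxRaise μ E' with hδ₀
  have hun : ∀ e ∈ E', raise μ E' δ₀ e ≠ G.cE e ∧ ∀ i ∈ e, load (raise μ E' δ₀) i ≠ G.cV i :=
    fun e he => (Finset.mem_filter.1 (hcon e he)).2
  have ht : Tendsto (fun δ : ℝ => δ₀ + δ) (𝓝[>] 0) (𝓝 δ₀) := by
    have : Tendsto (fun δ : ℝ => δ₀ + δ) (𝓝 0) (𝓝 (δ₀ + 0)) :=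
      (continuous_const.add continuous_id).tendsto 0
    rw [add_zero] at this
    exact this.mono_left nhdsWithin_le_nhds
  have h1 : ∀ e, ∀ᶠ δ in 𝓝[>] (0 : ℝ), raise μ E' (δ₀ + δ) e ≤ G.cE e := by
    intro e
    by_cases he : e ∈ E'
    · have hlt : μ e + δ₀ < G.cE e := by
        have := lt_of_le_of_ne (hf.1 e).2 (hun e he).1
        simpa [raise, he] using this
      have := (tendsto_const_nhds (x := μ e)).add ht
      filter_upwards [this.eventually (gt_mem_nhds hlt)] with δ hδ
      simp only [raise, if_pos he]
      exact hδ.le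
    · exact Eventually.of_forall fun δ => by simpa [raise, he] using (h.1 e).2
  have h2 : ∀ i, ∀ᶠ δ in 𝓝[>] (0 : ℝ), load (raise μ E' (δ₀ + δ)) i ≤ G.cV i := by
    intro i
    by_cases hi : ∃ j, s(i, j) ∈ E'
    · obtain ⟨j, hj⟩ := hi
      have hlt := lt_of_le_of_ne (hf.2 i) ((hun _ hj).2 i (Sym2.mem_mk_left i j))
      rw [load_raise] at hlt
      have := (tendsto_const_nhds (x := load μ i)).add (ht.mul_const (activeDegree E' i))
      filter_upwards [this.eventually (gt_mem_nhds hlt)] with δ hδ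
      rw [load_raise]
      exact hδ.le
    · push Not at hi
      refine Eventually.of_forall fun δ => ?_
      rw [load_raise, activeDegree_eq_zero hi]
      simpa using h.2 i
  obtain ⟨δ, ⟨hδ1, hδ2⟩, hδ3⟩ := (((eventually_all.2 h1).and (eventually_all.2 h2)).and
    self_mem_nhdsWithin).exists
  have hδ3 : 0 < δ := hδ3
  have hmem : δ₀ + δ ∈ {δ : ℝ | 0 ≤ δ ∧ G.Feasible (raise μ E' δ)} := by
    refine ⟨by linarith, fun e => ⟨?_, hδ1 e⟩, hδ2⟩
    have := (h.1 e).1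
    simp only [raise]
    split_ifs <;> linarith
  have := le_csSup (raise_bddAbove hE) hmem
  have : δ₀ + δ ≤ δ₀ := this
  linarith

/-- The active edges share the largest level `θ`, so when a saturated vertex freezes one of them, no
edge there carries more. That vertex has no active edge left, so its load and edges never change
again and the certificate persists. -/
lemma TideInv.step {G : CapGraph V} {x : (Sym2 V → ℝ) × Finset (Sym2 V)} {θ : ℝ}
    (h : TideInv G x θ) (hx : x.2.Nonempty) :
    (∃ θ', TideInv G (G.tideStep x) θ') ∧ (G.tideStep x).2.card < x.2.card := by
  obtain ⟨μ, E'⟩ := x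
  have hstep : G.tideStep (μ, E') = (raise μ E' (G.maxRaise μ E'),
      G.unsaturated (raise μ E' (G.maxRaise μ E')) E') := by
    simp only [tideStep]
    rw [if_neg hx.ne_empty]; rfl
  obtain ⟨hnn, hf⟩ := maxRaise_spec hx h.feasible
  rw [hstep]
  set δ := G.maxRaise μ E'
  constructor
  · refine ⟨θ + δ, hf, ?_, ?_, ?_⟩
    · intro e he
      have he' : e ∈ E' := (Finset.mem_filter.1 he).1
      simpa [raise, he'] using h.active e he'
    · intro e
      have := h.le e
      simp only [raise] at this ⊢
      split_ifs <;> simp only at * <;> linarith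
    · intro e he
      by_cases he' : e ∈ E'
      · have hsat : raise μ E' δ e = G.cE e ∨ ∃ i ∈ e, load (raise μ E' δ) i = G.cV i := by
          by_contra! hcon
          exact he (Finset.mem_filter.2 ⟨he', hcon⟩)
        rcases hsat with hs | ⟨i, hi, hs⟩
        · exact Or.inl hs
        · refine Or.inr ⟨i, hi, hs, fun j hj => ?_, fun j => ?_⟩
          · exact (Finset.mem_filter.1 hj).2.2 i (Sym2.mem_mk_left i j) hs
          · have h1 := h.le s(i, j)
            have h2 := h.active e he'
            simp only [raise, if_pos he'] at h1 h2 ⊢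
            split_ifs <;> linarith
      · rcases h.frozen e he' with hs | ⟨i, hi, hs, hE, hle⟩
        · left; simpa [raise, he'] using hs
        · refine Or.inr ⟨i, hi, ?_, fun j hj => hE j (Finset.mem_filter.1 hj).1, fun j => ?_⟩
          · rw [load_raise, activeDegree_eq_zero hE]; simpa using hs
          · have hij : s(i, j) ∉ E' := hE j
            simpa [raise, he', hij] using hle j
  · obtain ⟨e, he, hne⟩ := exists_saturated hx h.feasible
    exact Finset.card_lt_card ⟨Finset.filter_subset _ _, fun hsub => hne (hsub he)⟩

theorem risingTide_spec {G : CapGraph V} (hE : ∀ e, 0 ≤ G.cE e) (hV : ∀ i, 0 ≤ G.cV i) :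
    G.Feasible G.risingTide ∧ G.Bottleneck G.risingTide := by
  set x₀ : (Sym2 V → ℝ) × Finset (Sym2 V) :=
    (fun _ => 0, Finset.univ.filter fun e => 0 < G.cE e) with hx₀
  have h0 : TideInv G x₀ 0 := by
    refine ⟨⟨fun e => ⟨le_rfl, hE e⟩, fun i => ?_⟩, fun _ _ => rfl, fun _ => le_rfl, fun e he => ?_⟩
    · simpa [x₀, load] using hV i
    · left
      have : ¬ 0 < G.cE e := fun h => he (by simp [x₀, h])
      exact le_antisymm (hE e) (not_lt.1 this)
  -- Each pass removes an edge, so after as many passes as there are edges the working set is empty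
  -- and `frozen` covers every edge.
  have key : ∀ k, (∃ θ, TideInv G (G.tideStep^[k] x₀) θ) ∧
      ((G.tideStep^[k] x₀).2 = ∅ ∨ (G.tideStep^[k] x₀).2.card + k ≤ Fintype.card (Sym2 V)) := by
    intro k
    induction k with
    | zero => exact ⟨⟨0, h0⟩, Or.inr (by simpa using Finset.card_le_univ _)⟩
    | succ k ih =>
      obtain ⟨⟨θ, hθ⟩, hc⟩ := ih
      rw [Function.iterate_succ_apply']
      by_cases hemp : (G.tideStep^[k] x₀).2 = ∅
      · have : G.tideStep (G.tideStep^[k] x₀) = G.tideStep^[k] x₀ := by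
          rw [tideStep, if_pos hemp]
        rw [this]
        exact ⟨⟨θ, hθ⟩, Or.inl hemp⟩
      · obtain ⟨h1, h2⟩ := hθ.step (Finset.nonempty_iff_ne_empty.2 hemp)
        refine ⟨h1, Or.inr ?_⟩
        rcases hc with hc | hc
        · exact absurd hc hemp
        · omega
  obtain ⟨⟨θ, hθ⟩, hc⟩ := key (Fintype.card (Sym2 V))
  have hemp : (G.tideStep^[Fintype.card (Sym2 V)] x₀).2 = ∅ := by
    rcases hc with hc | hc
    · exact hc
    · exact Finset.card_eq_zero.1 (by omega)
  refine ⟨hθ.feasible, fun e => ?_⟩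
  rcases hθ.frozen e (by simp [hemp]) with h | ⟨i, hi, h1, _, h2⟩
  · exact Or.inl h
  · exact Or.inr ⟨i, hi, h1, h2⟩

end RisingTide

/-! ### Lipschitz dependence of the loads on the edge capacities. -/

section Stability

variable {V : Type} [Fintype V]

lemma eventually_min_add (v θ : ℝ) :
    ∀ᶠ h in 𝓝[>] (0 : ℝ), min v (θ + h) = min v θ + h * (if θ < v then 1 else 0) := by
  by_cases hv : θ < v
  · filter_upwards [Ioo_mem_nhdsGT (sub_pos.2 hv)] with h hh
    rw [if_pos hv, min_eq_right hv.le, min_eq_right (by linarith [hh.2])]; ring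
  · filter_upwards [self_mem_nhdsWithin] with h hh
    have hh : 0 < h := hh
    rw [if_neg hv, min_eq_left (not_lt.1 hv), min_eq_left (by linarith [not_lt.1 hv])]; ring

lemma eventually_abs_add (d r : ℝ) :
    ∀ᶠ h in 𝓝[>] (0 : ℝ), |d + h * r| = |d| +
      h * (if 0 < d then r else if d < 0 then -r else |r|) := by
  have ht : Tendsto (fun h : ℝ => d + h * r) (𝓝[>] 0) (𝓝 d) := by
    have : Tendsto (fun h : ℝ => d + h * r) (𝓝 0) (𝓝 (d + 0 * r)) :=
      (continuous_const.add (continuous_id.mul continuous_const)).tendsto 0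
    rw [zero_mul, add_zero] at this
    exact this.mono_left nhdsWithin_le_nhds
  rcases lt_trichotomy d 0 with hd | hd | hd
  · filter_upwards [ht.eventually (gt_mem_nhds hd)] with h hh
    rw [if_neg (by linarith), if_pos hd, abs_of_neg hh, abs_of_neg hd]; ring
  · filter_upwards [self_mem_nhdsWithin] with h hh
    have hh : 0 < h := hh
    subst hd
    simp [abs_mul, abs_of_pos hh]
  · filter_upwards [ht.eventually (lt_mem_nhds hd)] with h hh
    rw [if_pos hd, abs_of_pos hh, abs_of_pos hd]

lemma abs_min_sub_min_add {c c' θ h : ℝ} (hh : 0 < h)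
    (h1 : min c (θ + h) = min c θ + h * (if θ < c then 1 else 0))
    (h2 : min c' (θ + h) = min c' θ + h * (if θ < c' then 1 else 0)) :
    |min c (θ + h) - min c' (θ + h)| = |min c θ - min c' θ| +
      h * |(if θ < c then (1 : ℝ) else 0) - (if θ < c' then 1 else 0)| := by
  rw [h1, h2]
  by_cases hc : θ < c <;> by_cases hc' : θ < c'
  · simp [hc, hc']
  · rw [min_eq_right hc.le, min_eq_left (not_lt.1 hc')]
    simp only [hc, hc', if_true, if_false]
    rw [abs_of_nonneg (by linarith [not_lt.1 hc']), abs_of_nonneg (by linarith [not_lt.1 hc'])]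
    norm_num; ring
  · rw [min_eq_right hc'.le, min_eq_left (not_lt.1 hc)]
    simp only [hc, hc', if_true, if_false]
    rw [abs_of_nonpos (by linarith [not_lt.1 hc]), abs_of_nonpos (by linarith [not_lt.1 hc])]
    norm_num; ring
  · simp [hc, hc']

/-- The rate at which `|load μ i - load μ' i|` grows on account of an edge, when both matchings
are truncated at a rising level; `d` is the current difference of the loads. -/
def growth (d r : ℝ) : ℝ := if 0 < d then r else if d < 0 then -r else |r|

lemma growth_le (d r : ℝ) : growth d r ≤ |r| := by
  unfold growth
  split_ifs
  · exact le_abs_self r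
  · exact neg_le_abs r
  · exact le_rfl

lemma growth_neg_neg (d r : ℝ) : growth (-d) (-r) = growth d r := by
  unfold growth
  rcases lt_trichotomy d 0 with h | h | h
  · simp [h, h.le]
  · simp [h]
  · simp [h, h.le]

lemma growth_sum_le {ι : Type*} (t : Finset ι) (d : ℝ) (r : ι → ℝ) :
    growth d (∑ j ∈ t, r j) ≤ ∑ j ∈ t, growth d (r j) := by
  unfold growth
  split_ifs
  · exact le_rfl
  · rw [Finset.sum_neg_distrib]
  · exact Finset.abs_sum_le_sum_abs _ _

/-- Truncation at `θ` leaves the saturated vertex of `μ'` at full capacity but strictly cuts the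
edge `s(i, j)` of `μ`, so at this vertex `μ` lags behind. -/
lemma load_min_lt {μ μ' : Sym2 V → ℝ} {b θ : ℝ} {i j : V} (hload : load μ i ≤ b)
    (hθ : θ < μ s(i, j)) (hsat : load μ' i = b) (hle : ∀ l, μ' s(i, l) ≤ θ) :
    load (fun e => min (μ e) θ) i - load (fun e => min (μ' e) θ) i < 0 := by
  have h1 : load (fun e => min (μ' e) θ) i = b := by
    rw [← hsat]
    exact Finset.sum_congr rfl fun l _ => min_eq_left (hle l)
  have h2 : load (fun e => min (μ e) θ) i < load μ i :=
    Finset.sum_lt_sum (fun l _ => min_le_left _ _) ⟨j, Finset.mem_univ _, min_lt_iff.2 (Or.inr hθ)⟩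
  linarith

/-- The edge still grows in `μ` but has stopped in `μ'`. If it stopped at its capacity, the
capacities part at level `θ` and pay 1 for each endpoint. If it stopped at a saturated endpoint, `μ`
lags behind there, so growth narrows the gap at that endpoint and cancels what it may add at the
other. -/
lemma growth_edge_le {G G' : CapGraph V} (hV : G.cV = G'.cV) {μ μ' : Sym2 V → ℝ}
    (hf : G.Feasible μ) (hb' : G'.Bottleneck μ') {θ : ℝ} {i j : V} (h1 : θ < μ s(i, j)) (h2 : ¬ θ < μ' s(i, j)) (D : V → ℝ)
    (hD : ∀ i, D i = load (fun e => min (μ e) θ) i - load (fun e => min (μ' e) θ) i) :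
    growth (D i) 1 + growth (D j) 1 ≤
      2 * |(if θ < G.cE s(i, j) then (1 : ℝ) else 0) - (if θ < G'.cE s(i, j) then 1 else 0)| := by
  have gi := growth_le (D i) 1
  have gj := growth_le (D j) 1
  rw [abs_one] at gi gj
  have gneg : ∀ x : ℝ, x < 0 → growth x 1 = -1 := by
    intro x hx; unfold growth; rw [if_neg (by linarith), if_pos hx]
  rcases hb' s(i, j) with h | ⟨l, hl, hs, hle⟩
  · rw [if_pos (h1.trans_le (hf.1 _).2), if_neg (by rw [← h]; exact h2)]
    norm_num; linarith
  · have hle' : ∀ l', μ' s(l, l') ≤ θ := fun l' => (hle l').trans (not_lt.1 h2)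
    have hnn := abs_nonneg ((if θ < G.cE s(i, j) then (1 : ℝ) else 0) -
      (if θ < G'.cE s(i, j) then 1 else 0))
    rcases Sym2.mem_iff.1 hl with rfl | rfl
    · have := load_min_lt (hf.2 l) h1 (hs.trans (by rw [hV])) hle'
      rw [← hD] at this
      rw [gneg _ this]; linarith
    · have := load_min_lt (hf.2 l) (by rwa [Sym2.eq_swap] at h1) (hs.trans (by rw [hV])) hle'
      rw [← hD] at this
      rw [gneg _ this]; linarith

/-- The loads of a bottleneck matching are Lipschitz in the edge capacities. -/
theorem sum_abs_load_sub_le {G G' : CapGraph V} (hV : G.cV = G'.cV) {μ μ' : Sym2 V → ℝ}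
    (hf : G.Feasible μ) (hb : G.Bottleneck μ) (hf' : G'.Feasible μ') (hb' : G'.Bottleneck μ') :
    ∑ i, |load μ i - load μ' i| ≤ ∑ i, ∑ j, |G.cE s(i, j) - G'.cE s(i, j)| := by
  set D : ℝ → V → ℝ := fun θ i =>
    load (fun e => min (μ e) θ) i - load (fun e => min (μ' e) θ) i with hD
  -- Matchings and capacities are all truncated at `θ`. `H` vanishes at 0 and never increases to the
  -- right; above all capacities the truncation is void, so `H M ≤ 0` is the claim.
  set H : ℝ → ℝ := fun θ => ∑ i, |D θ i| -
    ∑ i, ∑ j, |min (G.cE s(i, j)) θ - min (G'.cE s(i, j)) θ| with hH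
  have hHc : Continuous H := by
    simp only [hH, hD, load]
    fun_prop
  have hc0 : ∀ e, 0 ≤ G.cE e := fun e => (hf.1 e).1.trans (hf.1 e).2
  have hc0' : ∀ e, 0 ≤ G'.cE e := fun e => (hf'.1 e).1.trans (hf'.1 e).2
  have hH0 : H 0 = 0 := by
    simp only [hH, hD, load]
    simp [hc0, hc0', (hf.1 _).1, (hf'.1 _).1]
  have hloc : ∀ θ, ∀ᶠ h in 𝓝[>] (0 : ℝ), H (θ + h) ≤ H θ := by
    intro θ
    set a : Sym2 V → ℝ := fun e => (if θ < μ e then 1 else 0) with ha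
    set a' : Sym2 V → ℝ := fun e => (if θ < μ' e then 1 else 0) with ha'
    set r : V → ℝ := fun i => ∑ j, (a s(i, j) - a' s(i, j)) with hr
    set B : Sym2 V → ℝ := fun e =>
      |(if θ < G.cE e then (1 : ℝ) else 0) - (if θ < G'.cE e then 1 else 0)| with hB
    have hrate : ∑ i, growth (D θ i) (r i) ≤ ∑ i, ∑ j, B s(i, j) := by
      -- The rates at the two endpoints must be added before comparing: at a single endpoint the gap
      -- may widen although the capacities agree.
      have hedge : ∀ i j, growth (D θ i) (a s(i, j) - a' s(i, j)) +
          growth (D θ j) (a s(i, j) - a' s(i, j)) ≤ 2 * B s(i, j) := by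
        intro i j
        by_cases h1 : θ < μ s(i, j) <;> by_cases h2 : θ < μ' s(i, j)
        · simp only [ha, ha', h1, h2, if_true, sub_self]
          simp only [growth, neg_zero, abs_zero, ite_self, add_zero]
          exact mul_nonneg zero_le_two (abs_nonneg _)
        · simp only [ha, ha', h1, h2, if_true, if_false, sub_zero]
          exact growth_edge_le hV hf hb' h1 h2 (D θ) fun _ => rfl
        · simp only [ha, ha', h1, h2, if_true, if_false, zero_sub]
          have := growth_edge_le hV.symm hf' hb h2 h1 (fun i => - D θ i)
            (fun i => by simp [hD])
          rw [← growth_neg_neg (D θ i), ← growth_neg_neg (D θ j), neg_neg]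
          simp only [hB]
          rw [abs_sub_comm]
          exact this
        · simp only [ha, ha', h1, h2, if_false, sub_self]
          simp only [growth, neg_zero, abs_zero, ite_self, add_zero]
          exact mul_nonneg zero_le_two (abs_nonneg _)
      have h1 : ∑ i, growth (D θ i) (r i) ≤
          ∑ i, ∑ j, growth (D θ i) (a s(i, j) - a' s(i, j)) :=
        Finset.sum_le_sum fun i _ => growth_sum_le _ _ _
      have h2 : ∑ i, ∑ j, growth (D θ i) (a s(i, j) - a' s(i, j)) =
          ∑ i, ∑ j, growth (D θ j) (a s(i, j) - a' s(i, j)) := by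
        rw [Finset.sum_comm]
        exact Finset.sum_congr rfl fun i _ => Finset.sum_congr rfl fun j _ => by
          rw [Sym2.eq_swap]
      have h3 : ∑ i, ∑ j, (growth (D θ i) (a s(i, j) - a' s(i, j)) +
          growth (D θ j) (a s(i, j) - a' s(i, j))) ≤ ∑ i, ∑ j, 2 * B s(i, j) :=
        Finset.sum_le_sum fun i _ => Finset.sum_le_sum fun j _ => hedge i j
      simp only [Finset.sum_add_distrib, ← Finset.mul_sum] at h3
      linarith
    have e1 : ∀ e, ∀ᶠ h in 𝓝[>] (0 : ℝ), min (μ e) (θ + h) = min (μ e) θ + h * a e :=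
      fun e => eventually_min_add _ _
    have e2 : ∀ e, ∀ᶠ h in 𝓝[>] (0 : ℝ), min (μ' e) (θ + h) = min (μ' e) θ + h * a' e :=
      fun e => eventually_min_add _ _
    have e3 : ∀ e, ∀ᶠ h in 𝓝[>] (0 : ℝ), min (G.cE e) (θ + h) = min (G.cE e) θ +
        h * (if θ < G.cE e then 1 else 0) := fun e => eventually_min_add _ _
    have e4 : ∀ e, ∀ᶠ h in 𝓝[>] (0 : ℝ), min (G'.cE e) (θ + h) = min (G'.cE e) θ +
        h * (if θ < G'.cE e then 1 else 0) := fun e => eventually_min_add _ _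
    have e5 : ∀ i, ∀ᶠ h in 𝓝[>] (0 : ℝ), |D θ i + h * r i| = |D θ i| +
        h * growth (D θ i) (r i) := fun i => eventually_abs_add _ _
    filter_upwards [eventually_all.2 e1, eventually_all.2 e2, eventually_all.2 e3,
      eventually_all.2 e4, eventually_all.2 e5, self_mem_nhdsWithin] with h f1 f2 f3 f4 f5 hpos
    have hpos : 0 < h := hpos
    have g1 : ∀ i, D (θ + h) i = D θ i + h * r i := by
      intro i
      simp only [hD, load, f1, f2, hr, Finset.sum_add_distrib, Finset.sum_sub_distrib,
        ← Finset.mul_sum]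
      ring
    have g2 : ∀ i j, |min (G.cE s(i, j)) (θ + h) - min (G'.cE s(i, j)) (θ + h)| =
        |min (G.cE s(i, j)) θ - min (G'.cE s(i, j)) θ| + h * B s(i, j) :=
      fun i j => abs_min_sub_min_add hpos (f3 _) (f4 _)
    simp only [hH, g1, f5, g2, Finset.sum_add_distrib, ← Finset.mul_sum]
    have := mul_le_mul_of_nonneg_left hrate hpos.le
    linarith
  set M : ℝ := ∑ e, G.cE e + ∑ e, G'.cE e with hM
  have hcM : ∀ e, G.cE e ≤ M := fun e => by
    have h1 := Finset.single_le_sum (fun e _ => hc0 e) (Finset.mem_univ e)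
    have h2 := Finset.sum_nonneg (fun e (_ : e ∈ Finset.univ) => hc0' e)
    linarith
  have hcM' : ∀ e, G'.cE e ≤ M := fun e => by
    have h1 := Finset.single_le_sum (fun e _ => hc0' e) (Finset.mem_univ e)
    have h2 := Finset.sum_nonneg (fun e (_ : e ∈ Finset.univ) => hc0 e)
    linarith
  have hM0 : 0 ≤ M := add_nonneg (Finset.sum_nonneg fun e _ => hc0 e)
    (Finset.sum_nonneg fun e _ => hc0' e)
  have hsub : Set.Icc 0 M ⊆ {θ | H θ ≤ 0} := by
    refine IsClosed.Icc_subset_of_forall_exists_gt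
      ((isClosed_le hHc continuous_const).inter isClosed_Icc) hH0.le fun θ hθ y hy => ?_
    obtain ⟨h, h1, h2⟩ := ((hloc θ).and (Ioc_mem_nhdsGT (sub_pos.2 hy))).exists
    have hθ1 : H θ ≤ 0 := hθ.1
    exact ⟨θ + h, h1.trans hθ1, by linarith [h2.1], by linarith [h2.2]⟩
  have hfin : H M ≤ 0 := hsub ⟨hM0, le_rfl⟩
  simp only [hH, hD, load, min_eq_left (hcM _), min_eq_left (hcM' _),
    min_eq_left ((hf.1 _).2.trans (hcM _)), min_eq_left ((hf'.1 _).2.trans (hcM' _))] at hfin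
  simp only [load]
  linarith

end Stability

end CapGraph

end

noncomputable section

open scoped Classical
open MeasureTheory

/-! ### The coin measure as a uniform average. -/

section Expectation

variable {P : Params}

/-- The expectation of a function of the coins. -/
def expect (F : Coins P → ℝ) : ℝ := (∑ ω, F ω) / Fintype.card (Coins P)

lemma expect_mono {F G : Coins P → ℝ} (h : ∀ ω, F ω ≤ G ω) : expect F ≤ expect G :=
  div_le_div_of_nonneg_right (Finset.sum_le_sum fun ω _ => h ω) (Nat.cast_nonneg _)

lemma expect_const (a : ℝ) : expect (fun _ : Coins P => a) = a := by
  simp [expect]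

instance : IsProbabilityMeasure (coinMeasure P) := by
  unfold coinMeasure; infer_instance

lemma coinMeasure_real_singleton (ω : Coins P) :
    (coinMeasure P).real {ω} = (1 / 2) ^ Fintype.card (Fin P.iterations × Fin P.m × Fin P.n) := by
  have : (coinMeasure P) {ω} =
      (1 / 2) ^ Fintype.card (Fin P.iterations × Fin P.m × Fin P.n) := by
    unfold coinMeasure
    rw [Measure.pi_singleton]
    simp
  rw [Measure.real, this]
  simp

lemma coinMeasure_real_eq (S : Set (Coins P)) :
    (coinMeasure P).real S = expect (S.indicator fun _ => 1) := by
  have key : ∀ U : Finset (Coins P), (coinMeasure P).real U =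
      U.card * (1 / 2) ^ Fintype.card (Fin P.iterations × Fin P.m × Fin P.n) := by
    intro U
    rw [← sum_measureReal_singleton]
    simp [coinMeasure_real_singleton]
  have h1 := key Finset.univ
  have h2 := key (Finset.univ.filter (· ∈ S))
  rw [Finset.coe_univ, probReal_univ] at h1
  rw [Finset.coe_filter] at h2
  simp only [Finset.mem_univ, true_and, Set.ofPred_mem_eq] at h2
  have h3 : expect (S.indicator fun _ => 1) =
      ((Finset.univ.filter (· ∈ S)).card : ℝ) / Fintype.card (Coins P) := by
    unfold expect
    simp [Set.indicator_apply, Finset.sum_boole]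
  rw [h2, h3, ← Finset.card_univ (α := Coins P)]
  have h4 : ((Finset.univ : Finset (Coins P)).card : ℝ) ≠ 0 := by
    intro h; rw [h] at h1; simp at h1
  rw [eq_div_iff h4, mul_assoc, mul_comm (_ ^ _) _, ← h1, mul_one]

end Expectation

/-! ### Each move reads at most one fresh coin. -/

section FreshCoin

variable {P : Params}

namespace State

lemma length_le_apply (ω : Coins P) (s : State P) (mv : Move P.n) (τ : ℕ) (i : Fin P.n) :
    (s.board τ i).length ≤ ((s.apply ω mv).board τ i).length := by
  cases mv with
  | write j v =>
    simp only [apply]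
    by_cases h : τ = s.t
    · subst h
      by_cases h' : i = j
      · subst h'; simp
      · simp [h']
    · simp [h]
  | _ => simp [apply]

lemma length_le_step (𝒜 : Adversary P) (ω : Coins P) (s : State P) (τ : ℕ) (i : Fin P.n) :
    (s.board τ i).length ≤ ((step 𝒜 ω s).board τ i).length := by
  unfold step
  split_ifs
  · exact le_rfl
  · exact length_le_apply ω s _ τ i

lemma apply_congr {ω ω' : Coins P} {s : State P} {mv : Move P.n}
    (h : ∀ τ r i, r < ((s.apply ω mv).board τ i).length → coin ω τ r i = coin ω' τ r i) :
    s.apply ω' mv = s.apply ω mv := by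
  cases mv with
  | write j v =>
    have hw : writtenValue ω' s j v = writtenValue ω s j v := by
      unfold writtenValue
      split_ifs
      · rfl
      · exact (h s.t _ j (by simp [apply])).symm
    simp only [apply, hw]
  | _ => rfl

lemma step_congr {𝒜 : Adversary P} {ω ω' : Coins P} {s : State P}
    (h : ∀ τ r i, r < ((step 𝒜 ω s).board τ i).length → coin ω τ r i = coin ω' τ r i) :
    step 𝒜 ω' s = step 𝒜 ω s := by
  unfold step at h ⊢
  split_ifs at h ⊢
  · rfl
  · exact apply_congr h

end State

open State

lemma play_succ (𝒜 : Adversary P) (ω : Coins P) (k : ℕ) :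
    play 𝒜 ω (k + 1) = step 𝒜 ω (play 𝒜 ω k) := by
  unfold play; rw [Function.iterate_succ_apply']

/-- The play depends only on the coins of the cells that have been written. -/
lemma play_congr {𝒜 : Adversary P} {ω ω' : Coins P} (k : ℕ)
    (h : ∀ τ r i, r < ((play 𝒜 ω k).board τ i).length → coin ω τ r i = coin ω' τ r i) :
    play 𝒜 ω' k = play 𝒜 ω k := by
  induction k with
  | zero => rfl
  | succ k ih =>
    rw [play_succ] at h
    have ih' := ih fun τ r i hr => h τ r i (hr.trans_le (length_le_step 𝒜 ω _ τ i))
    rw [play_succ, play_succ, ih']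
    exact step_congr h

/-- The coins with the one that is read by the next move turned over. -/
def flipCoin (ω : Coins P) (s : State P) : Move P.n → Coins P
  | .write i _ => if h : s.t < P.iterations ∧ (s.board s.t i).length < P.m then
      Function.update ω (⟨s.t, h.1⟩, ⟨_, h.2⟩, i) (!ω (⟨s.t, h.1⟩, ⟨_, h.2⟩, i)) else ω
  | _ => ω

lemma flipCoin_flipCoin (ω : Coins P) (s : State P) (mv : Move P.n) :
    flipCoin (flipCoin ω s mv) s mv = ω := by
  cases mv with
  | write i v =>
    simp only [flipCoin]
    split_ifs <;> simp
  | _ => rfl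

lemma coin_flipCoin (ω : Coins P) (s : State P) (mv : Move P.n) {τ r : ℕ} {i : Fin P.n}
    (hr : r < (s.board τ i).length) : coin (flipCoin ω s mv) τ r i = coin ω τ r i := by
  cases mv with
  | write j v =>
    simp only [flipCoin]
    split_ifs with h
    · unfold coin
      split_ifs with h'
      · refine Function.update_of_ne ?_ _ _
        intro heq
        simp only [Prod.mk.injEq, Fin.mk.injEq] at heq
        obtain ⟨rfl, rfl, rfl⟩ := heq
        exact lt_irrefl _ hr
      · rfl
    · rfl
  | _ => rfl

lemma play_flipCoin (𝒜 : Adversary P) (ω : Coins P) (k : ℕ) (mv : Move P.n) :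
    play 𝒜 (flipCoin ω (play 𝒜 ω k) mv) k = play 𝒜 ω k :=
  play_congr k fun _ _ _ hr => (coin_flipCoin ω _ mv hr).symm

/-- A move reads at most one coin, so the two constant coin functions stand for its two outcomes. If
no coin is read, all four terms agree. -/
lemma apply_add_apply_flipCoin (F : State P → ℝ) (ω : Coins P) (s : State P) (mv : Move P.n) :
    F (s.apply ω mv) + F (s.apply (flipCoin ω s mv) mv) =
      F (s.apply (fun _ => true) mv) + F (s.apply (fun _ => false) mv) := by
  cases mv with
  | write i v =>
    by_cases hi : i ∈ s.bad
    · simp [apply, writtenValue, hi]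
    · by_cases h : s.t < P.iterations ∧ (s.board s.t i).length < P.m
      · simp only [apply, writtenValue, hi, if_false, flipCoin, coin, dif_pos h,
          Function.update_self]
        cases ω (⟨s.t, h.1⟩, ⟨_, h.2⟩, i)
        · simp only [Bool.not_false]; rw [add_comm]
        · simp only [Bool.not_true]
      · simp only [apply, writtenValue, hi, if_false, flipCoin, coin, dif_neg h]
  | _ => rfl

lemma step_add_step_flipCoin (𝒜 : Adversary P) (F : State P → ℝ) (ω : Coins P) (s : State P) :
    F (step 𝒜 ω s) + F (step 𝒜 (flipCoin ω s (𝒜.move s)) s) =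
      F (step 𝒜 (fun _ => true) s) + F (step 𝒜 (fun _ => false) s) := by
  unfold step
  split_ifs
  · rfl
  · exact apply_add_apply_flipCoin F ω s _

/-- The coin read by the next move has not influenced the history. Turning it over is therefore an
involution of the coin space that preserves the first `k` moves, and pairing each `ω` with its image
averages the two outcomes. -/
lemma expect_play_succ (𝒜 : Adversary P) (F : State P → ℝ) (k : ℕ) :
    expect (fun ω => F (play 𝒜 ω (k + 1))) = expect (fun ω =>
      (F (step 𝒜 (fun _ => true) (play 𝒜 ω k)) +
        F (step 𝒜 (fun _ => false) (play 𝒜 ω k))) / 2) := by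
  unfold expect
  congr 1
  set φ : Coins P → Coins P := fun ω => flipCoin ω (play 𝒜 ω k) (𝒜.move (play 𝒜 ω k)) with hφ
  have hplay : ∀ ω, play 𝒜 (φ ω) k = play 𝒜 ω k := fun ω => play_flipCoin 𝒜 ω k _
  have hinv : Function.Involutive φ := by
    intro ω
    have : φ (φ ω) = flipCoin (φ ω) (play 𝒜 ω k) (𝒜.move (play 𝒜 ω k)) := by
      rw [← hplay ω]
    rw [this]
    exact flipCoin_flipCoin ω _ _
  have h1 : ∑ ω, F (play 𝒜 ω (k + 1)) = ∑ ω, F (play 𝒜 (φ ω) (k + 1)) :=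
    (Equiv.sum_comp hinv.toPerm fun ω => F (play 𝒜 ω (k + 1))).symm
  have h2 : ∑ ω, F (play 𝒜 ω (k + 1)) + ∑ ω, F (play 𝒜 (φ ω) (k + 1)) =
      ∑ ω, (F (step 𝒜 (fun _ => true) (play 𝒜 ω k)) +
        F (step 𝒜 (fun _ => false) (play 𝒜 ω k))) := by
    rw [← Finset.sum_add_distrib]
    refine Finset.sum_congr rfl fun ω _ => ?_
    rw [play_succ, play_succ, hplay]
    exact step_add_step_flipCoin 𝒜 F ω _
  rw [← Finset.sum_div, ← h2, ← h1]
  ring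

end FreshCoin

/-! ### Invariants, supermartingales and the length of a play. -/

section Invariant

variable {P : Params}

/-- Basic properties of the states that occur in a play. -/
structure State.Inv (s : State P) : Prop where
  t_le : s.t ≤ P.iterations
  empty : ∀ τ, s.t < τ → ∀ i, s.board τ i = []
  empty_of_dir : s.dir = none → ∀ i, s.board s.t i = []
  length_le : ∀ τ i, (s.board τ i).length ≤ P.m
  startBad_subset : s.startBad ⊆ s.bad
  card_le : s.bad.card ≤ P.f
  weight_nonneg : ∀ i, 0 ≤ s.weight i
  weight_le : ∀ i, s.weight i ≤ 1

lemma Params.α_nonneg (P : Params) : 0 ≤ P.α := by unfold Params.α; positivity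

lemma Params.wmin_nonneg (P : Params) : 0 ≤ P.wmin := by unfold Params.wmin; positivity

lemma Params.Xmax_nonneg (P : Params) : 0 ≤ P.Xmax := Real.sqrt_nonneg _

namespace State

lemma excess_nonneg (hε : 0 ≤ P.ε) (s : State P) (A : Finset (Fin P.n)) (e : Sym2 (Fin P.n)) :
    0 ≤ (s.excess A).cE e := by
  induction e using Sym2.ind with
  | _ i j =>
    have := P.α_nonneg
    simp only [excess, Sym2.lift_mk]
    split_ifs <;> positivity

lemma excess_spec (hε : 0 ≤ P.ε) {s : State P} (hw : ∀ i, 0 ≤ s.weight i)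
    (A : Finset (Fin P.n)) :
    (s.excess A).Feasible (s.excess A).risingTide ∧
      (s.excess A).Bottleneck (s.excess A).risingTide :=
  CapGraph.risingTide_spec (s.excess_nonneg hε A) hw

lemma load_nonneg (hε : 0 ≤ P.ε) {s : State P} (hw : ∀ i, 0 ≤ s.weight i)
    (A : Finset (Fin P.n)) (i : Fin P.n) : 0 ≤ CapGraph.load (s.excess A).risingTide i :=
  Finset.sum_nonneg fun _ _ => ((excess_spec hε hw A).1.1 _).1

lemma nextWeight_nonneg (s : State P) (A : Fin P.n → Finset (Fin P.n)) (i : Fin P.n) :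
    0 ≤ s.nextWeight A i := by
  unfold nextWeight
  split_ifs with h
  · exact P.wmin_nonneg.trans h.le
  · exact le_rfl

lemma nextWeight_le (hε : 0 ≤ P.ε) {s : State P} (hw : ∀ i, 0 ≤ s.weight i)
    (A : Fin P.n → Finset (Fin P.n)) (i : Fin P.n) : s.nextWeight A i ≤ s.weight i := by
  unfold nextWeight
  split_ifs with h
  · have := load_nonneg hε hw (A i) i
    unfold localWeight; linarith
  · exact hw i

lemma init_inv (P : Params) : (init P).Inv := by
  constructor <;> simp [init]

lemma Inv.apply {s : State P} (hs : s.Inv) (hε : 0 ≤ P.ε) (ht : s.t < P.iterations) (ω : Coins P)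
    {mv : Move P.n} (hl : s.Legal mv) : (s.apply ω mv).Inv := by
  cases mv with
  | corrupt i =>
    obtain ⟨h1, h2⟩ := hl
    refine { hs with startBad_subset := ?_, card_le := ?_ }
    · exact hs.startBad_subset.trans (Finset.subset_insert _ _)
    · simp only [State.apply]
      rw [Finset.card_insert_of_notMem h1]
      exact h2
  | start σ =>
    refine { hs with empty_of_dir := ?_, startBad_subset := ?_ }
    · intro h; simp [State.apply] at h
    · simp only [State.apply]
      split_ifs
      · exact subset_rfl
      · exact hs.startBad_subset
  | write i v =>
    obtain ⟨h1, h2⟩ := hl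
    refine { hs with empty := ?_, empty_of_dir := ?_, length_le := ?_ }
    · intro τ hτ j
      have hτ' : s.t < τ := hτ
      have : τ ≠ s.t := hτ'.ne'
      simp [State.apply, this, hs.empty τ hτ']
    · intro h; exact absurd h h1
    · intro τ j
      simp only [State.apply]
      by_cases h : τ = s.t
      · subst h
        by_cases h' : j = i
        · subst h'; simpa using h2
        · simpa [h'] using hs.length_le _ _
      · simpa [h] using hs.length_le _ _
  | complete A =>
    refine { hs with t_le := ht, empty := ?_, empty_of_dir := ?_, weight_nonneg := ?_,
                     weight_le := ?_ }
    · intro τ hτ j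
      exact hs.empty τ ((Nat.lt_succ_self s.t).trans hτ) j
    · intro _ j
      exact hs.empty _ (Nat.lt_succ_self s.t) j
    · intro i
      simp only [State.apply]
      split_ifs
      · exact s.nextWeight_nonneg A i
      · exact hs.weight_nonneg i
    · intro i
      simp only [State.apply]
      split_ifs
      · exact (nextWeight_le hε hs.weight_nonneg A i).trans (hs.weight_le i)
      · exact hs.weight_le i

lemma Inv.step {s : State P} (hs : s.Inv) (hε : 0 ≤ P.ε) (𝒜 : Adversary P) (ω : Coins P) :
    (step 𝒜 ω s).Inv := by
  unfold State.step
  split_ifs with h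
  · exact hs
  · exact hs.apply hε (lt_of_le_of_ne hs.t_le h) ω (𝒜.legal s)

end State

open State

lemma play_inv (hε : 0 ≤ P.ε) (𝒜 : Adversary P) (ω : Coins P) (k : ℕ) : (play 𝒜 ω k).Inv := by
  induction k with
  | zero => exact init_inv P
  | succ k ih => rw [play_succ]; exact ih.step hε 𝒜 ω

/-- `F` does not increase in expectation, whatever legal move the adversary makes. -/
structure IsSupermartingale (F : State P → ℝ) : Prop where
  corrupt : ∀ (s : State P) (ω : Coins P) i, s.Inv → s.t < P.iterations → i ∉ s.bad →
    F (s.apply ω (.corrupt i)) ≤ F s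
  start : ∀ (s : State P) (ω : Coins P) σ, s.Inv → s.t < P.iterations → s.dir = none →
    F (s.apply ω (.start σ)) ≤ F s
  write_bad : ∀ (s : State P) (ω : Coins P) i v, s.Inv → s.t < P.iterations → s.dir ≠ none →
    (s.board s.t i).length < P.m → i ∈ s.bad → F (s.apply ω (.write i v)) ≤ F s
  write_good : ∀ (s : State P) i v, s.Inv → s.t < P.iterations → s.dir ≠ none →
    (s.board s.t i).length < P.m → i ∉ s.bad →
    F (s.apply (fun _ => true) (.write i v)) + F (s.apply (fun _ => false) (.write i v)) ≤ 2 * F s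
  complete : ∀ (s : State P) (ω : Coins P) A, s.Inv → s.t < P.iterations →
    s.Legal (.complete A) → F (s.apply ω (.complete A)) ≤ F s

lemma IsSupermartingale.expect_play_le {F : State P → ℝ} (hF : IsSupermartingale F) (hε : 0 ≤ P.ε)
    (𝒜 : Adversary P) (k : ℕ) : expect (fun ω => F (play 𝒜 ω k)) ≤ F (init P) := by
  induction k with
  | zero => exact (expect_const (F (init P))).le
  | succ k ih =>
    rw [expect_play_succ]
    refine (expect_mono fun ω => ?_).trans ih
    have hs := play_inv hε 𝒜 ω k
    set s := play 𝒜 ω k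
    unfold step
    by_cases ht : s.t = P.iterations
    · simp [ht]
    · simp only [if_neg ht]
      have ht' := lt_of_le_of_ne hs.t_le ht
      have hl := 𝒜.legal s
      cases hmv : 𝒜.move s with
      | corrupt i =>
        rw [hmv] at hl
        have h1 := hF.corrupt s (fun _ => true) i hs ht' hl.1
        have h2 := hF.corrupt s (fun _ => false) i hs ht' hl.1
        linarith
      | start σ =>
        rw [hmv] at hl
        have h1 := hF.start s (fun _ => true) σ hs ht' hl
        have h2 := hF.start s (fun _ => false) σ hs ht' hl
        linarith
      | write i v =>
        rw [hmv] at hl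
        by_cases hi : i ∈ s.bad
        · have h1 := hF.write_bad s (fun _ => true) i v hs ht' hl.1 hl.2 hi
          have h2 := hF.write_bad s (fun _ => false) i v hs ht' hl.1 hl.2 hi
          linarith
        · have h1 := hF.write_good s i v hs ht' hl.1 hl.2 hi
          linarith
      | complete A =>
        rw [hmv] at hl
        have h1 := hF.complete s (fun _ => true) A hs ht' hl
        have h2 := hF.complete s (fun _ => false) A hs ht' hl
        linarith

/-- Markov's inequality for a supermartingale of the game. -/
lemma IsSupermartingale.measure_le {F : State P → ℝ} (hF : IsSupermartingale F) (hε : 0 ≤ P.ε)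
    (hnn : ∀ s : State P, s.Inv → 0 ≤ F s) (𝒜 : Adversary P) (k : ℕ) (p : State P → Prop) {a : ℝ}
    (ha : 0 < a) (hp : ∀ s : State P, s.Inv → p s → a ≤ F s) :
    (coinMeasure P).real {ω | p (play 𝒜 ω k)} ≤ F (init P) / a := by
  rw [coinMeasure_real_eq, le_div_iff₀ ha]
  refine le_trans ?_ (hF.expect_play_le hε 𝒜 k)
  unfold expect
  rw [div_mul_eq_mul_div, Finset.sum_mul]
  refine expect_mono fun ω => ?_
  have hs := play_inv hε 𝒜 ω k
  by_cases h : p (play 𝒜 ω k)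
  · simpa [Set.indicator_apply, h] using hp _ hs h
  · simpa [Set.indicator_apply, h] using hnn _ hs

/-- A quantity that increases with every move. -/
def State.rank (s : State P) : ℕ :=
  s.bad.card + 2 * s.t + (if s.dir = none then 0 else 1) +
    ∑ τ ∈ Finset.range P.iterations, ∑ i, (s.board τ i).length

/-- A bound on the number of moves in a play. -/
def Params.moveBound (P : Params) : ℕ :=
  P.f + 2 * P.iterations + 1 + P.iterations * (P.n * P.m)

lemma State.Inv.rank_le {s : State P} (hs : s.Inv) : s.rank ≤ P.moveBound := by
  have h1 : ∑ τ ∈ Finset.range P.iterations, ∑ i, (s.board τ i).length ≤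
      ∑ _τ ∈ Finset.range P.iterations, ∑ _i : Fin P.n, P.m :=
    Finset.sum_le_sum fun τ _ => Finset.sum_le_sum fun i _ => hs.length_le τ i
  simp only [Finset.sum_const, Finset.card_univ, Fintype.card_fin, Finset.card_range,
    smul_eq_mul] at h1
  have h2 := hs.card_le
  have h3 := hs.t_le
  unfold State.rank Params.moveBound
  split_ifs <;> omega

/-- Completing an iteration loses the unit contributed by `dir`; this is why `t` counts twice. -/
lemma State.Inv.rank_lt_apply {s : State P} (ht : s.t < P.iterations)
    (ω : Coins P) {mv : Move P.n} (hl : s.Legal mv) : s.rank < (s.apply ω mv).rank := by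
  cases mv with
  | corrupt i =>
    have h2 : (s.apply ω (.corrupt i)).t = s.t ∧ (s.apply ω (.corrupt i)).dir = s.dir ∧
      (s.apply ω (.corrupt i)).board = s.board := ⟨rfl, rfl, rfl⟩
    have h3 : (s.apply ω (.corrupt i)).bad.card = s.bad.card + 1 :=
      Finset.card_insert_of_notMem hl.1
    simp only [State.rank, h2, h3]
    gcongr
    exact Nat.lt_succ_self _
  | start σ =>
    have : s.dir = none := hl
    simp [State.rank, State.apply, this]
  | write i v =>
    have : ∑ τ ∈ Finset.range P.iterations, ∑ j, (s.board τ j).length <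
        ∑ τ ∈ Finset.range P.iterations, ∑ j, ((s.apply ω (.write i v)).board τ j).length := by
      refine Finset.sum_lt_sum (fun τ _ => Finset.sum_le_sum fun j _ =>
        length_le_apply ω s _ τ j) ⟨s.t, Finset.mem_range.2 ht, ?_⟩
      refine Finset.sum_lt_sum (fun j _ => length_le_apply ω s _ _ j) ⟨i, Finset.mem_univ _, ?_⟩
      simp [State.apply]
    have h2 : (s.apply ω (.write i v)).bad = s.bad ∧ (s.apply ω (.write i v)).t = s.t ∧
      (s.apply ω (.write i v)).dir = s.dir := ⟨rfl, rfl, rfl⟩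
    simp only [State.rank, h2]
    gcongr
  | complete A =>
    simp only [State.rank, State.apply]
    split_ifs <;> omega

lemma play_t_eq (hε : 0 ≤ P.ε) (𝒜 : Adversary P) (ω : Coins P) {k : ℕ} (hk : P.moveBound < k) :
    (play 𝒜 ω k).t = P.iterations := by
  have key : ∀ k, (play 𝒜 ω k).t = P.iterations ∨ k ≤ (play 𝒜 ω k).rank := by
    intro k
    induction k with
    | zero => exact Or.inr (Nat.zero_le _)
    | succ k ih =>
      rw [play_succ]
      have hs := play_inv hε 𝒜 ω k
      set s := play 𝒜 ω k
      unfold step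
      by_cases ht : s.t = P.iterations
      · left; rw [if_pos ht]; exact ht
      · rw [if_neg ht]
        right
        have := State.Inv.rank_lt_apply (lt_of_le_of_ne hs.t_le ht) ω (𝒜.legal s)
        rcases ih with h | h
        · exact absurd h ht
        · omega
  rcases key k with h | h
  · exact h
  · have := (play_inv hε 𝒜 ω k).rank_le
    omega

lemma play_eq_of_le {𝒜 : Adversary P} {ω : Coins P} {k : ℕ}
    (h : (play 𝒜 ω k).t = P.iterations) {k' : ℕ} (hk : k ≤ k') : play 𝒜 ω k' = play 𝒜 ω k := by
  induction k', hk using Nat.le_induction with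
  | base => rfl
  | succ k' _ ih => rw [play_succ, ih, step, if_pos h]

/-- What holds with high probability after each number of moves holds with high probability
throughout the play. -/
lemma measure_exists_le (hε : 0 ≤ P.ε) (𝒜 : Adversary P) (p : State P → Prop) {δ : ℝ}
    (h : ∀ k, (coinMeasure P).real {ω | p (play 𝒜 ω k)} ≤ δ) :
    (coinMeasure P).real {ω | ∃ k, p (play 𝒜 ω k)} ≤ (P.moveBound + 2) * δ := by
  have hsub : {ω | ∃ k, p (play 𝒜 ω k)} ⊆
      ⋃ k ∈ Finset.range (P.moveBound + 2), {ω | p (play 𝒜 ω k)} := by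
    rintro ω ⟨k, hk⟩
    simp only [Set.mem_iUnion, Finset.mem_range, Set.mem_ofPred_eq]
    by_cases hlt : k < P.moveBound + 2
    · exact ⟨k, hlt, hk⟩
    -- The play has stopped by then and no longer changes, so finitely many move numbers suffice for
    -- the union bound.
    · refine ⟨P.moveBound + 1, by omega, ?_⟩
      rwa [← play_eq_of_le (play_t_eq hε 𝒜 ω (Nat.lt_succ_self _))
        (show P.moveBound + 1 ≤ k by omega)]
  refine (measureReal_mono hsub (measure_ne_top _ _)).trans ((measureReal_biUnion_finset_le _ _).trans ?_)
  refine (Finset.sum_le_sum fun k _ => h k).trans ?_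
  simp

end Invariant

end

noncomputable section

open scoped Classical
open MeasureTheory

/-! ### Exponential tail bounds for the columns of good processes. -/

section Tails

/-- The sum of a column. -/
def colSum (l : List Bool) : ℝ := (l.map signVal).sum

@[simp] lemma colSum_nil : colSum [] = 0 := by simp [colSum]

@[simp] lemma colSum_append_singleton (l : List Bool) (b : Bool) :
    colSum (l ++ [b]) = colSum l + signVal b := by simp [colSum]

lemma exp_add_exp_le (A B : ℝ) :
    Real.exp (A + B) + Real.exp (A - B) ≤ 2 * Real.exp (A + B ^ 2 / 2) := by
  have h := Real.cosh_le_exp_half_sq B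
  rw [Real.cosh_eq] at h
  rw [Real.exp_add A B, sub_eq_add_neg, Real.exp_add A (-B), Real.exp_add A]
  have := mul_le_mul_of_nonneg_left h (Real.exp_pos A).le
  linarith

variable {P : Params}

open State

/-- An exponential potential of the columns in `H` that does not increase on average when a coin
is added. -/
structure ColumnPotential (P : Params) (H : Finset (Fin P.n))
    (Q : (Fin P.n → List Bool) → ℝ) : Prop where
  invariant : ∀ b i l, i ∉ H → Q (Function.update b i l) = Q b
  average : ∀ b i, i ∈ H → (∀ j, (b j).length ≤ P.m) → (b i).length < P.m →
    Real.exp (Q (Function.update b i (b i ++ [true]))) +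
      Real.exp (Q (Function.update b i (b i ++ [false]))) ≤ 2 * Real.exp (Q b)

lemma sum_update_board (s : State P) (Q : (Fin P.n → List Bool) → ℝ) (E : Finset ℕ)
    (b : Fin P.n → List Bool) :
    ∑ τ ∈ E, Q (Function.update s.board s.t b τ) =
      ∑ τ ∈ E, Q (s.board τ) + if s.t ∈ E then Q b - Q (s.board s.t) else 0 := by
  have : ∀ τ ∈ E, Q (Function.update s.board s.t b τ) =
      Q (s.board τ) + if s.t = τ then Q b - Q (s.board s.t) else 0 := by
    intro τ _
    by_cases h : s.t = τ
    · subst h; simp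
    · simp [Function.update_of_ne (Ne.symm h), h]
  rw [Finset.sum_congr rfl this, Finset.sum_add_distrib, Finset.sum_ite_eq]

/-- Corrupting a member of `H` sets the functional to 0, which can only lower it. Until then the
columns of `H` receive nothing but fair coins, whatever the schedule, and `average` applies. -/
lemma ColumnPotential.isSupermartingale {H : Finset (Fin P.n)}
    {Q : (Fin P.n → List Bool) → ℝ} (hQ : ColumnPotential P H Q) (E : Finset ℕ) :
    IsSupermartingale fun s : State P =>
      if Disjoint H s.bad then Real.exp (∑ τ ∈ E, Q (s.board τ)) else 0 := by
  constructor
  · intro s ω i _ _ _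
    by_cases h1 : Disjoint H (s.apply ω (.corrupt i)).bad
    · rw [if_pos h1, if_pos (h1.mono_right (Finset.subset_insert _ _))]
      exact le_rfl
    · rw [if_neg h1]; positivity
  · intro s ω σ _ _ _
    simp only [State.apply]; exact le_rfl
  · intro s ω i v _ _ _ _ hi
    simp only [State.apply]
    by_cases h : Disjoint H s.bad
    · have hiH : i ∉ H := fun hH => Finset.disjoint_left.1 h hH hi
      rw [sum_update_board, hQ.invariant _ _ _ hiH]
      simp
    · simp [h]
  · intro s i v hs _ _ hlen hi
    simp only [State.apply, writtenValue, hi, if_false]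
    by_cases h : Disjoint H s.bad
    · simp only [sum_update_board, if_pos h]
      by_cases hiH : i ∈ H
      · by_cases htE : s.t ∈ E
        · simp only [if_pos htE]
          have havg := hQ.average (s.board s.t) i hiH (hs.length_le s.t) hlen
          have hcoin : ∀ b : Bool, coin (fun _ : Fin P.iterations × Fin P.m × Fin P.n => b) s.t
              (s.board s.t i).length i = b := by
            intro b
            unfold coin
            rw [dif_pos ⟨by assumption, hlen⟩]
          rw [hcoin, hcoin]
          set S := ∑ τ ∈ E, Q (s.board τ)
          have e : ∀ y, S + (y - Q (s.board s.t)) = (S - Q (s.board s.t)) + y := fun y => by ring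
          rw [e, e, Real.exp_add, Real.exp_add _ (Q _)]
          have h3 := mul_le_mul_of_nonneg_left havg (Real.exp_pos (S - Q (s.board s.t))).le
          have h4 : Real.exp (S - Q (s.board s.t)) * Real.exp (Q (s.board s.t)) = Real.exp S := by
            rw [← Real.exp_add]; congr 1; ring
          rw [← mul_add]
          calc _ ≤ _ := h3
            _ = _ := by rw [mul_left_comm, h4]
        · simp only [if_neg htE, add_zero]; linarith
      · rw [hQ.invariant _ _ _ hiH, hQ.invariant _ _ _ hiH]
        simp only [sub_self, ite_self, add_zero]; linarith
    · simp [h]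
  · intro s ω A _ _ _
    simp only [State.apply]; exact le_rfl

lemma ColumnPotential.measure_le {H : Finset (Fin P.n)} {Q : (Fin P.n → List Bool) → ℝ}
    (hQ : ColumnPotential P H Q) (hε : 0 ≤ P.ε) (𝒜 : Adversary P) (k : ℕ) (E : Finset ℕ)
    {g : (Fin P.n → List Bool) → ℝ} (hg : ∀ b, (∀ j, (b j).length ≤ P.m) → g b ≤ Q b) (a : ℝ) :
    (coinMeasure P).real {ω | Disjoint H (play 𝒜 ω k).bad ∧
      a ≤ ∑ τ ∈ E, g ((play 𝒜 ω k).board τ)} ≤ Real.exp (E.card * Q (fun _ => []) - a) := by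
  have := (hQ.isSupermartingale E).measure_le hε (fun s _ => by positivity) 𝒜 k
    (fun s => Disjoint H s.bad ∧ a ≤ ∑ τ ∈ E, g (s.board τ)) (Real.exp_pos a) (by
      rintro s hs ⟨h1, h2⟩
      simp only [if_pos h1]
      exact Real.exp_le_exp.2 (h2.trans (Finset.sum_le_sum fun τ _ => hg _ (hs.length_le τ))))
  refine this.trans (le_of_eq ?_)
  rw [Real.exp_sub]
  simp [State.init]

/-- The potential for the deviation of column `i`. -/
def devPotential (P : Params) (lam : ℝ) (i : Fin P.n) (b : Fin P.n → List Bool) : ℝ :=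
  (lam + 8 * lam ^ 2 * (P.m - (b i).length)) * colSum (b i) ^ 2 +
    (lam + 8 * lam ^ 2 * P.m) * (P.m - (b i).length)

/-- Let `a'` be the coefficient of the square after the coin. A coin changes `a' x²` by `a' ± 2a'x`;
averaging the exponential costs at most `2a'²x² ≤ 8 lam² x²`, exactly what the coefficient of `x²`
loses per coin. The constant `a'` is paid by the second summand. -/
lemma devPotential_isPotential {lam : ℝ} (h0 : 0 ≤ lam) (h1 : 8 * lam * P.m ≤ 1) (i : Fin P.n) :
    ColumnPotential P {i} (devPotential P lam i) := by
  constructor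
  · intro b j l hj
    have : i ≠ j := fun h => hj (by simp [h])
    simp [devPotential, this]
  · intro b j hj hlen hlt
    obtain rfl := Finset.mem_singleton.1 hj
    simp only [devPotential, Function.update_self, colSum_append_singleton, List.length_append,
      List.length_singleton, signVal, if_true, Bool.false_eq_true, if_false]
    push_cast
    set x := colSum (b j)
    have hR : ((b j).length : ℝ) + 1 ≤ P.m := by exact_mod_cast hlt
    have hl : (0 : ℝ) ≤ (b j).length := Nat.cast_nonneg _
    set R : ℝ := P.m - (b j).length with hRdef
    set a' := lam + 8 * lam ^ 2 * (R - 1) with ha'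
    have ha0 : 0 ≤ a' := by
      have : 0 ≤ R - 1 := by linarith
      positivity
    have ha1 : a' ≤ lam + 8 * lam ^ 2 * P.m := by
      have : R - 1 ≤ P.m := by linarith
      have := mul_le_mul_of_nonneg_left this (by positivity : 0 ≤ 8 * lam ^ 2)
      linarith
    have ha2 : a' ≤ 2 * lam := by nlinarith
    have key := exp_add_exp_le (a' * x ^ 2 + a' + (lam + 8 * lam ^ 2 * P.m) * (R - 1)) (2 * a' * x)
    rw [show (P.m : ℝ) - ((b j).length + 1) = R - 1 by rw [hRdef]; ring]
    refine le_trans (le_of_eq ?_) (key.trans ?_)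
    · congr 2 <;> ring
    · refine mul_le_mul_of_nonneg_left (Real.exp_le_exp.2 ?_) zero_le_two
      have : (2 * a' * x) ^ 2 / 2 ≤ 8 * lam ^ 2 * x ^ 2 := by
        have : a' ^ 2 ≤ (2 * lam) ^ 2 := pow_le_pow_left₀ ha0 ha2 2
        nlinarith [sq_nonneg x, mul_le_mul_of_nonneg_right this (sq_nonneg x)]
      have e : lam + 8 * lam ^ 2 * R = a' + 8 * lam ^ 2 := by rw [ha']; ring
      rw [e]
      linarith

/-- The tail bound for the sum of the squares of column `i` over a set of iterations. -/
lemma measure_dev_le (hε : 0 ≤ P.ε) (𝒜 : Adversary P) (k : ℕ) (E : Finset ℕ) (i : Fin P.n)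
    {lam : ℝ} (h0 : 0 ≤ lam) (h1 : 8 * lam * P.m ≤ 1) (a : ℝ) :
    (coinMeasure P).real {ω | i ∉ (play 𝒜 ω k).bad ∧
      a ≤ ∑ τ ∈ E, colSum ((play 𝒜 ω k).board τ i) ^ 2} ≤
        Real.exp (E.card * (lam * P.m + 8 * (lam * P.m) ^ 2) - lam * a) := by
  have := (devPotential_isPotential h0 h1 i).measure_le hε 𝒜 k E
    (g := fun b => lam * colSum (b i) ^ 2) (by
      intro b hb
      have hR : (0 : ℝ) ≤ P.m - (b i).length := by
        have : ((b i).length : ℝ) ≤ P.m := by exact_mod_cast hb i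
        linarith
      unfold devPotential
      have h3 : 0 ≤ 8 * lam ^ 2 * (P.m - (b i).length) * colSum (b i) ^ 2 := by positivity
      have h4 : 0 ≤ (lam + 8 * lam ^ 2 * P.m) * (P.m - (b i).length) := by positivity
      linarith) (lam * a)
  refine le_trans (measureReal_mono ?_ (measure_ne_top _ _)) (this.trans (le_of_eq ?_))
  · rintro ω ⟨h2, h3⟩
    refine ⟨Finset.disjoint_singleton_left.2 h2, ?_⟩
    rw [← Finset.mul_sum]
    exact mul_le_mul_of_nonneg_left h3 h0
  · congr 1; simp only [devPotential, List.length_nil, colSum_nil]; push_cast; ring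

/-- The potential for the correlation of columns `i` and `j`. -/
def corrPotential (P : Params) (lam : ℝ) (i j : Fin P.n) (b : Fin P.n → List Bool) : ℝ :=
  lam * colSum (b i) * colSum (b j) + (2 * P.m - (b i).length - (b j).length) *
    (lam ^ 2 * (colSum (b i) ^ 2 + colSum (b j) ^ 2) + 2 * P.m * lam ^ 2)

lemma corrPotential_comm (lam : ℝ) (i j : Fin P.n) (b : Fin P.n → List Bool) :
    corrPotential P lam i j b = corrPotential P lam j i b := by
  unfold corrPotential; ring

/-- The coin shifts the exponent by `±(lam y + 2a'x)`, and half the square of this is at most `lam²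
(x² + y²)` since `2a' ≤ lam`. That is the reserve released when one fewer coin remains in the two
columns. -/
lemma corrPotential_average {lam : ℝ} (h0 : 0 ≤ lam) (h1 : 4 * lam * P.m ≤ 1) {i j : Fin P.n}
    (hij : i ≠ j) (b : Fin P.n → List Bool) (hlen : ∀ j, (b j).length ≤ P.m)
    (hlt : (b i).length < P.m) :
    Real.exp (corrPotential P lam i j (Function.update b i (b i ++ [true]))) +
      Real.exp (corrPotential P lam i j (Function.update b i (b i ++ [false]))) ≤
        2 * Real.exp (corrPotential P lam i j b) := by
  simp only [corrPotential, Function.update_self, Function.update_of_ne (Ne.symm hij),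
    colSum_append_singleton, List.length_append, List.length_singleton, signVal, if_true, Bool.false_eq_true, if_false]
  push_cast
  set x := colSum (b i)
  set y := colSum (b j)
  have hR : ((b i).length : ℝ) + 1 ≤ P.m := by exact_mod_cast hlt
  have hR' : ((b j).length : ℝ) ≤ P.m := by exact_mod_cast hlen j
  have hl : (0 : ℝ) ≤ (b i).length := Nat.cast_nonneg _
  have hl' : (0 : ℝ) ≤ (b j).length := Nat.cast_nonneg _
  set R : ℝ := 2 * P.m - (b i).length - (b j).length with hRdef
  have hR1 : 0 ≤ R - 1 := by linarith
  set a' := lam ^ 2 * (R - 1) with ha'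
  have ha0 : 0 ≤ a' := by positivity
  have ha1 : a' ≤ 2 * P.m * lam ^ 2 := by
    have : R - 1 ≤ 2 * P.m := by linarith
    have := mul_le_mul_of_nonneg_left this (by positivity : 0 ≤ lam ^ 2)
    linarith
  have ha2 : 2 * a' ≤ lam := by nlinarith
  have key := exp_add_exp_le (lam * x * y + a' * (x ^ 2 + y ^ 2) + a' +
    2 * P.m * lam ^ 2 * (R - 1)) (lam * y + 2 * a' * x)
  rw [show 2 * (P.m : ℝ) - ((b i).length + 1) - (b j).length = R - 1 by rw [hRdef]; ring]
  refine le_trans (le_of_eq ?_) (key.trans ?_)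
  · congr 2 <;> rw [ha'] <;> ring
  · refine mul_le_mul_of_nonneg_left (Real.exp_le_exp.2 ?_) zero_le_two
    have h3 : (2 * a') ^ 2 ≤ lam ^ 2 := pow_le_pow_left₀ (by positivity) ha2 2
    have h4 : (lam * y + 2 * a' * x) ^ 2 / 2 ≤ lam ^ 2 * (x ^ 2 + y ^ 2) := by
      nlinarith [sq_nonneg (lam * y - 2 * a' * x), mul_le_mul_of_nonneg_right h3 (sq_nonneg x)]
    have e : R * (lam ^ 2 * (x ^ 2 + y ^ 2) + 2 * P.m * lam ^ 2) =
        a' * (x ^ 2 + y ^ 2) + lam ^ 2 * (x ^ 2 + y ^ 2) + 2 * P.m * lam ^ 2 * (R - 1) +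
          2 * P.m * lam ^ 2 := by
      rw [ha']; ring
    rw [e]
    linarith

lemma corrPotential_isPotential {lam : ℝ} (h0 : 0 ≤ lam) (h1 : 4 * lam * P.m ≤ 1)
    {i j : Fin P.n} (hij : i ≠ j) : ColumnPotential P {i, j} (corrPotential P lam i j) := by
  constructor
  · intro b l c hl
    simp only [Finset.mem_insert, Finset.mem_singleton, not_or] at hl
    simp [corrPotential, Ne.symm hl.1, Ne.symm hl.2]
  · intro b l hl hlen hlt
    rcases Finset.mem_insert.1 hl with rfl | hl
    · exact corrPotential_average h0 h1 hij b hlen hlt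
    · obtain rfl := Finset.mem_singleton.1 hl
      simp only [corrPotential_comm lam i l]
      exact corrPotential_average h0 h1 hij.symm b hlen hlt

/-- The tail bound for the correlation of columns `i` and `j` over a set of iterations. -/
lemma measure_corr_le (hε : 0 ≤ P.ε) (𝒜 : Adversary P) (k : ℕ) (E : Finset ℕ) {i j : Fin P.n}
    (hij : i ≠ j) {lam : ℝ} (h0 : 0 ≤ lam) (h1 : 4 * lam * P.m ≤ 1) (a : ℝ) :
    (coinMeasure P).real {ω | (i ∉ (play 𝒜 ω k).bad ∧ j ∉ (play 𝒜 ω k).bad) ∧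
      a ≤ ∑ τ ∈ E, colSum ((play 𝒜 ω k).board τ i) * colSum ((play 𝒜 ω k).board τ j)} ≤
        Real.exp (E.card * (4 * (lam * P.m) ^ 2) - lam * a) := by
  have := (corrPotential_isPotential h0 h1 hij).measure_le hε 𝒜 k E
    (g := fun b => lam * (colSum (b i) * colSum (b j))) (by
      intro b hb
      have hi : ((b i).length : ℝ) ≤ P.m := by exact_mod_cast hb i
      have hj : ((b j).length : ℝ) ≤ P.m := by exact_mod_cast hb j
      have hR : (0 : ℝ) ≤ 2 * P.m - (b i).length - (b j).length := by linarith
      unfold corrPotential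
      have h3 : 0 ≤ (2 * P.m - (b i).length - (b j).length : ℝ) *
        (lam ^ 2 * (colSum (b i) ^ 2 + colSum (b j) ^ 2) + 2 * P.m * lam ^ 2) := by positivity
      linarith) (lam * a)
  refine le_trans (measureReal_mono ?_ (measure_ne_top _ _)) (this.trans (le_of_eq ?_))
  · rintro ω ⟨⟨h2, h2'⟩, h3⟩
    refine ⟨?_, ?_⟩
    · simp [Finset.disjoint_insert_left, h2, h2']
    · rw [← Finset.mul_sum]
      exact mul_le_mul_of_nonneg_left h3 h0
  · congr 1; simp only [corrPotential, List.length_nil, colSum_nil]; push_cast; ring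

end Tails

end

noncomputable section

/-! ### Comparison of a random walk with a walk of tiny steps. -/

section Heat

/-- A twice differentiable function `g` with second derivative `h ≥ 0`, for which the second
difference quotients are controlled as if the fourth derivative were bounded by `C`. -/
structure SecondOrder (C : ℝ) (g h : ℝ → ℝ) : Prop where
  taylor : ∀ x w, 0 ≤ w → |g (x + w) + g (x - w) - 2 * g x - w ^ 2 * h x| ≤ C * w ^ 4
  diff : ∀ x w, 0 ≤ w → |h (x + w) + h (x - w) - 2 * h x| ≤ C * w ^ 2
  nonneg : ∀ x, 0 ≤ h x

lemma abs_le_of_hasDerivAt {f f' : ℝ → ℝ} (hf : ∀ t, HasDerivAt f (f' t) t) (h0 : f 0 = 0)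
    {B B' : ℝ → ℝ} (hB : ∀ t, HasDerivAt B (B' t) t) (hB0 : B 0 = 0)
    (hb : ∀ t, 0 ≤ t → |f' t| ≤ B' t) {w : ℝ} (hw : 0 ≤ w) : |f w| ≤ B w := by
  have := image_norm_le_of_norm_deriv_right_le_deriv_boundary (a := 0) (b := w)
    (fun t _ => (hf t).continuousAt.continuousWithinAt)
    (fun t _ => (hf t).hasDerivWithinAt) (by simp [h0, hB0]) hB
    (fun t ht => hb t ht.1) (Set.right_mem_Icc.2 hw)
  simpa using this

/-- In symmetric differences the odd orders cancel; the bound on the fourth derivative is integrated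
from 0 to `w`, one order at a time. -/
lemma secondOrder_of_hasDerivAt {g0 g1 g2 g3 g4 : ℝ → ℝ} {C : ℝ}
    (h0 : ∀ x, HasDerivAt g0 (g1 x) x) (h1 : ∀ x, HasDerivAt g1 (g2 x) x)
    (h2 : ∀ x, HasDerivAt g2 (g3 x) x) (h3 : ∀ x, HasDerivAt g3 (g4 x) x)
    (h4 : ∀ x, |g4 x| ≤ C) (hnn : ∀ x, 0 ≤ g2 x) : SecondOrder C g0 g2 := by
  have hC : 0 ≤ C := (abs_nonneg _).trans (h4 0)
  have hp : ∀ {g g' : ℝ → ℝ} (_ : ∀ x, HasDerivAt g (g' x) x) (x t : ℝ),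
      HasDerivAt (fun t => g (x + t)) (g' (x + t)) t := fun h x t => (h (x + t)).comp_const_add x t
  have hm : ∀ {g g' : ℝ → ℝ} (_ : ∀ x, HasDerivAt g (g' x) x) (x t : ℝ),
      HasDerivAt (fun t => g (x - t)) (-g' (x - t)) t := fun h x t => (h (x - t)).comp_const_sub x t
  have b3 : ∀ x w, 0 ≤ w → |g3 (x + w) - g3 (x - w)| ≤ 2 * C * w := by
    intro x w hw
    refine abs_le_of_hasDerivAt (f := fun t => g3 (x + t) - g3 (x - t))
      (fun t => (hp h3 x t).sub (hm h3 x t)) (by simp) (B := fun t => 2 * C * t)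
      (B' := fun _ => 2 * C) (fun t => by simpa using (hasDerivAt_id t).const_mul (2 * C))
      (by simp) (fun t _ => ?_) hw
    rw [sub_neg_eq_add]
    have := abs_add_le (g4 (x + t)) (g4 (x - t))
    linarith [h4 (x + t), h4 (x - t)]
  have b2 : ∀ x w, 0 ≤ w → |g2 (x + w) + g2 (x - w) - 2 * g2 x| ≤ C * w ^ 2 := by
    intro x w hw
    refine abs_le_of_hasDerivAt (f := fun t => g2 (x + t) + g2 (x - t) - 2 * g2 x)
      (fun t => ((hp h2 x t).add (hm h2 x t)).sub_const _) (by simp; ring)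
      (B := fun t => C * t ^ 2) (B' := fun t => C * (2 * t)) (fun t => by
        simpa using (hasDerivAt_pow 2 t).const_mul C)
      (by simp) (fun t ht => ?_) hw
    have := b3 x t ht
    rw [← sub_eq_add_neg]; linarith
  have b1 : ∀ x w, 0 ≤ w → |g1 (x + w) - g1 (x - w) - 2 * w * g2 x| ≤ C * w ^ 3 := by
    intro x w hw
    refine abs_le_of_hasDerivAt (f := fun t => g1 (x + t) - g1 (x - t) - 2 * t * g2 x)
      (f' := fun t => g2 (x + t) - -g2 (x - t) - 2 * g2 x)
      (fun t => ((hp h1 x t).sub (hm h1 x t)).sub (by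
        simpa using ((hasDerivAt_id t).const_mul 2).mul_const (g2 x))) (by simp)
      (B := fun t => C * t ^ 3) (B' := fun t => C * (3 * t ^ 2)) (fun t => by
        simpa using (hasDerivAt_pow 3 t).const_mul C)
      (by simp) (fun t ht => ?_) hw
    have := b2 x t ht
    rw [sub_neg_eq_add]
    nlinarith [mul_nonneg hC (sq_nonneg t)]
  refine ⟨fun x w hw => ?_, b2, hnn⟩
  refine abs_le_of_hasDerivAt (f := fun t => g0 (x + t) + g0 (x - t) - 2 * g0 x - t ^ 2 * g2 x)
    (f' := fun t => g1 (x + t) + -g1 (x - t) - 2 * t * g2 x)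
    (fun t => (((hp h0 x t).add (hm h0 x t)).sub_const _).sub (by
      simpa using (hasDerivAt_pow 2 t).mul_const (g2 x))) (by simp; ring)
    (B := fun t => C * t ^ 4) (B' := fun t => C * (4 * t ^ 3)) (fun t => by
      simpa using (hasDerivAt_pow 4 t).const_mul C)
    (by simp) (fun t ht => ?_) hw
  have := b1 x t ht
  rw [← sub_eq_add_neg]
  nlinarith [mul_nonneg hC (pow_nonneg ht 3)]

/-- A smooth approximation to `x ↦ max 0 x ^ 2`. -/
def psi (s x : ℝ) : ℝ := (x ^ 2 + x * √(x ^ 2 + s)) / 2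

/-- The second derivative of `psi s`. -/
def psi2 (s x : ℝ) : ℝ := 1 + x * (2 * x ^ 2 + 3 * s) / (2 * √(x ^ 2 + s) ^ 3)

/-- This exact symmetry survives averaging and makes the walk from 0 collect precisely half of its
variance in `heat_zero_right`. -/
lemma psi_add_psi_neg (s x : ℝ) : psi s x + psi s (-x) = x ^ 2 := by
  unfold psi; rw [neg_sq]; ring

lemma psi_le {s : ℝ} (hs : 0 < s) (x : ℝ) : psi s x ≤ max 0 x ^ 2 + s / 4 := by
  unfold psi
  have h1 : √(x ^ 2 + s) ^ 2 = x ^ 2 + s := Real.sq_sqrt (by positivity)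
  set q := √(x ^ 2 + s)
  have hq : 0 ≤ q := Real.sqrt_nonneg _
  rcases le_total x 0 with hx | hx
  · rw [max_eq_left hx]
    have : -x ≤ q := Real.le_sqrt_of_sq_le (by nlinarith)
    nlinarith
  · rw [max_eq_right hx]
    nlinarith [sq_nonneg (q - x)]

/-- With `q = √(x² + s)` the fourth derivative is `-15 s² x / (2 q⁷)`. As `|x| ≤ q` and `s ≤ q²`, it
is bounded by `15 / (2 s)`. -/
lemma secondOrder_psi {s : ℝ} (hs : 0 < s) : SecondOrder (8 / s) (psi s) (psi2 s) := by
  have hpos : ∀ x : ℝ, 0 < x ^ 2 + s := fun x => by positivity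
  have hq : ∀ x : ℝ, 0 < √(x ^ 2 + s) := fun x => Real.sqrt_pos.2 (hpos x)
  have hq2 : ∀ x : ℝ, √(x ^ 2 + s) ^ 2 = x ^ 2 + s := fun x => Real.sq_sqrt (hpos x).le
  have dq : ∀ x : ℝ, HasDerivAt (fun x => √(x ^ 2 + s)) (x / √(x ^ 2 + s)) x := by
    intro x
    have := (((hasDerivAt_pow 2 x).add_const s).sqrt (hpos x).ne')
    refine this.congr_deriv ?_
    have := (hq x).ne'
    field_simp
    push_cast; ring
  have dx : ∀ x : ℝ, HasDerivAt (fun x : ℝ => x ^ 2) (2 * x) x := fun x => by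
    simpa using hasDerivAt_pow 2 x
  have dqk : ∀ (k : ℕ) (x : ℝ), HasDerivAt (fun x => √(x ^ 2 + s) ^ k)
      (k * √(x ^ 2 + s) ^ (k - 1) * (x / √(x ^ 2 + s))) x := fun k x => (dq x).fun_pow k
  refine secondOrder_of_hasDerivAt (g1 := fun x => x + (2 * x ^ 2 + s) / (2 * √(x ^ 2 + s)))
    (g3 := fun x => 3 * s ^ 2 / (2 * √(x ^ 2 + s) ^ 5))
    (g4 := fun x => -(15 * s ^ 2 * x) / (2 * √(x ^ 2 + s) ^ 7)) ?_ ?_ ?_ ?_ ?_ ?_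
  · intro x
    have := ((dx x).add ((hasDerivAt_id x).mul (dq x))).div_const 2
    refine this.congr_deriv ?_
    have h := (hq x).ne'
    have h2 := hq2 x
    simp only [id]
    set q := √(x ^ 2 + s)
    field_simp
    linear_combination h2
  · intro x
    have := (hasDerivAt_id x).add ((((dx x).const_mul 2).add_const s).div ((dq x).const_mul 2)
      (by have := hq x; positivity))
    refine this.congr_deriv ?_
    have h := (hq x).ne'
    have h2 := hq2 x
    simp only [psi2]
    set q := √(x ^ 2 + s)
    have hs2 : s = q ^ 2 - x ^ 2 := by rw [h2]; ring
    rw [hs2]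
    field_simp
    ring
  · intro x
    have := ((((hasDerivAt_id x).mul (((dx x).const_mul 2).add_const (3 * s))).div
      ((dqk 3 x).const_mul 2) (by have := hq x; positivity)).const_add 1)
    refine this.congr_deriv ?_
    have h := (hq x).ne'
    have h2 := hq2 x
    simp only [id, Pi.mul_apply]
    set q := √(x ^ 2 + s)
    have hs2 : s = q ^ 2 - x ^ 2 := by rw [h2]; ring
    rw [hs2]
    push_cast
    field_simp
    ring
  · intro x
    have := (hasDerivAt_const x (3 * s ^ 2)).div ((dqk 5 x).const_mul 2)
      (by have := hq x; positivity)
    refine this.congr_deriv ?_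
    have h := (hq x).ne'
    set q := √(x ^ 2 + s)
    push_cast
    field_simp
    ring
  · intro x
    have h := hq x
    have h2 := hq2 x
    set q := √(x ^ 2 + s)
    have hx : |x| ≤ q := Real.abs_le_sqrt (by linarith)
    rw [abs_div, abs_neg, abs_mul, abs_of_pos (by positivity : 0 < 15 * s ^ 2),
      abs_of_pos (by positivity : 0 < 2 * q ^ 7), div_le_div_iff₀ (by positivity) hs]
    have h3 : s ≤ q ^ 2 := by nlinarith [sq_nonneg x]
    have h4 : s ^ 3 ≤ (q ^ 2) ^ 3 := pow_le_pow_left₀ hs.le h3 3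
    have h5 : s ^ 3 * |x| ≤ (q ^ 2) ^ 3 * q := mul_le_mul h4 hx (abs_nonneg _) (by positivity)
    have h6 : 0 < q ^ 7 := by positivity
    nlinarith
  · intro x
    have h := hq x
    have h2 := hq2 x
    unfold psi2
    set q := √(x ^ 2 + s)
    -- The difference of the two squares is `3 x² s² + 4 s³`.
    have h3 : |x * (2 * x ^ 2 + 3 * s)| ≤ 2 * q ^ 3 := by
      refine abs_le_of_sq_le_sq ?_ (by positivity)
      have : (2 * q ^ 3) ^ 2 = 4 * (x ^ 2 + s) ^ 3 := by rw [← h2]; ring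
      rw [this]
      nlinarith [mul_nonneg (sq_nonneg x) (sq_nonneg s), pow_pos hs 3]
    have h4 : -1 ≤ x * (2 * x ^ 2 + 3 * s) / (2 * q ^ 3) := by
      rw [le_div_iff₀ (by positivity)]
      linarith [(abs_le.1 h3).1]
    linarith

/-- One step of a symmetric random walk with step length `η`, applied to a function. -/
def walkStep (η : ℝ) (g : ℝ → ℝ) (x : ℝ) : ℝ := (g (x + η) + g (x - η)) / 2

/-- The expectation of `psi s` after `K` steps of a random walk with step length `η`. -/
def heat (s η : ℝ) (K : ℕ) : ℝ → ℝ := (walkStep η)^[K] (psi s)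

lemma heat_succ (s η : ℝ) (K : ℕ) : heat s η (K + 1) = walkStep η (heat s η K) :=
  Function.iterate_succ_apply' _ _ _

lemma SecondOrder.average {C : ℝ} {g h : ℝ → ℝ} (hg : SecondOrder C g h) (η : ℝ) :
    SecondOrder C (walkStep η g) (walkStep η h) := by
  constructor
  · intro x w hw
    have h1 := abs_le.1 (hg.taylor (x + η) w hw)
    have h2 := abs_le.1 (hg.taylor (x - η) w hw)
    unfold walkStep
    rw [show x + w + η = x + η + w by ring, show x - w + η = x + η - w by ring,
      show x + w - η = x - η + w by ring, show x - w - η = x - η - w by ring]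
    exact abs_le.2 ⟨by linarith, by linarith⟩
  · intro x w hw
    have h1 := abs_le.1 (hg.diff (x + η) w hw)
    have h2 := abs_le.1 (hg.diff (x - η) w hw)
    unfold walkStep
    rw [show x + w + η = x + η + w by ring, show x - w + η = x + η - w by ring,
      show x + w - η = x - η + w by ring, show x - w - η = x - η - w by ring]
    exact abs_le.2 ⟨by linarith, by linarith⟩
  · intro x
    have h1 := hg.nonneg (x + η)
    have h2 := hg.nonneg (x - η)
    unfold walkStep
    linarith

/-- Each step adds `η² h / 2` to `g` up to a fourth-order error, while `h` drifts by at most `C η²`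
per step; summing the drift gives the quadratic error. -/
lemma SecondOrder.iterate_le {C : ℝ} {g h : ℝ → ℝ} (hg : SecondOrder C g h) (hC : 0 ≤ C) {η : ℝ}
    (hη : 0 ≤ η) (j : ℕ) (x : ℝ) :
    (walkStep η)^[j] g x ≤ g x + j * η ^ 2 / 2 * h x + C * (j * η ^ 2) ^ 2 ∧
      (walkStep η)^[j] h x ≤ h x + j * (C * η ^ 2) ∧
        SecondOrder C ((walkStep η)^[j] g) ((walkStep η)^[j] h) := by
  induction j with
  | zero => exact ⟨by simp, by simp, hg⟩
  | succ j ih =>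
    obtain ⟨h1, h2, h3⟩ := ih
    rw [Function.iterate_succ_apply', Function.iterate_succ_apply']
    refine ⟨?_, ?_, h3.average η⟩
    · have h4 := (abs_le.1 (h3.taylor x η hη)).2
      have h5 := mul_le_mul_of_nonneg_left h2 (sq_nonneg η)
      rw [walkStep]
      push_cast
      have h6 : 0 ≤ C * η ^ 4 := by positivity
      have h7 : 0 ≤ C * η ^ 4 * j := by positivity
      nlinarith
    · have h4 := (abs_le.1 (h3.diff x η hη)).2
      have h6 : 0 ≤ C * η ^ 2 := by positivity
      rw [walkStep]
      push_cast
      linarith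

/-- A step of length `w` of the adversary's walk loses little against `k` steps of length `η`. -/
lemma heat_le_average {s η w : ℝ} (hs : 0 < s) (hη : 0 ≤ η) (hw : 0 ≤ w) {k : ℕ}
    (hk : k * η ^ 2 ≤ w ^ 2) (K : ℕ) (x : ℝ) :
    2 * heat s η K x - 24 / s * w ^ 4 ≤ heat s η (K - k) (x + w) + heat s η (K - k) (x - w) := by
  have hC : 0 ≤ 8 / s := by positivity
  obtain ⟨-, -, h1⟩ := (secondOrder_psi hs).iterate_le hC hη (K - k) x
  -- If fewer than `k` fine steps remain, only those are replaced; the surplus variance of the long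
  -- step can only help, as the second derivative is nonnegative. With `C = 8 / s` the errors are
  -- `2C w⁴` from the fine steps and `C w⁴` from the long one.
  have h2 := (h1.iterate_le hC hη (min k K) x).1
  rw [← Function.iterate_add_apply, show min k K + (K - k) = K by omega] at h2
  have h3 := (abs_le.1 (h1.taylor x w hw)).1
  have h4 := h1.nonneg x
  have h5 : (min k K : ℕ) * η ^ 2 ≤ w ^ 2 := by
    refine le_trans ?_ hk
    gcongr
    exact min_le_left _ _
  have h6 : ((min k K : ℕ) * η ^ 2) ^ 2 ≤ (w ^ 2) ^ 2 := pow_le_pow_left₀ (by positivity) h5 2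
  have h7 := mul_le_mul_of_nonneg_left h6 hC
  have h8 := mul_le_mul_of_nonneg_right h5 h4
  unfold heat
  have e : 24 / s = 3 * (8 / s) := by ring
  rw [e]
  nlinarith

lemma heat_add_heat_neg (s η : ℝ) (K : ℕ) (x : ℝ) :
    heat s η K x + heat s η K (-x) = x ^ 2 + K * η ^ 2 := by
  induction K generalizing x with
  | zero => simpa [heat] using psi_add_psi_neg s x
  | succ K ih =>
    have h1 := ih (x + η)
    have h2 := ih (x - η)
    rw [heat_succ]
    unfold walkStep
    rw [show -(x + η) = -x - η by ring] at h1
    rw [show -(x - η) = -x + η by ring] at h2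
    push_cast
    linarith

lemma heat_zero_right (s η : ℝ) (K : ℕ) : heat s η K 0 = K * η ^ 2 / 2 := by
  have := heat_add_heat_neg s η K 0
  rw [neg_zero] at this
  linarith

lemma heat_le {s : ℝ} (hs : 0 < s) (η : ℝ) (K : ℕ) (x : ℝ) :
    heat s η K x ≤ x ^ 2 + K * η ^ 2 + s / 4 := by
  induction K generalizing x with
  | zero =>
    have h1 := psi_le hs x
    have h2 : max 0 x ^ 2 ≤ x ^ 2 := by
      rcases le_total x 0 with hx | hx
      · rw [max_eq_left hx]; nlinarith
      · rw [max_eq_right hx]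
    simp only [heat, Function.iterate_zero, id]
    push_cast; linarith
  | succ K ih =>
    have h1 := ih (x + η)
    have h2 := ih (x - η)
    rw [heat_succ]
    unfold walkStep
    push_cast
    linarith

end Heat

end

noncomputable section

open scoped Classical

/-! ### How little a view can differ from the blackboards. -/

section Views

variable {P : Params}

namespace State

lemma X_empty (s : State P) (τ : ℕ) (i : Fin P.n) :
    s.X ∅ τ i = max (-P.Xmax) (min P.Xmax (colSum (s.board τ i))) := by
  simp [X, viewCol, colSum]

lemma X_empty_of_abs_le {s : State P} {τ : ℕ} {i : Fin P.n}
    (h : |colSum (s.board τ i)| ≤ P.Xmax) : s.X ∅ τ i = colSum (s.board τ i) := by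
  obtain ⟨h1, h2⟩ := abs_le.1 h
  rw [X_empty, min_eq_right h2, max_eq_right h1]

lemma abs_X_le (s : State P) (A : Finset (Fin P.n)) (τ : ℕ) (i : Fin P.n) :
    |s.X A τ i| ≤ P.Xmax := by
  have := P.Xmax_nonneg
  exact abs_le.2 ⟨le_max_left _ _, max_le (by linarith) (min_le_left _ _)⟩

lemma abs_colSum_dropLast_sub_le (l : List Bool) : |colSum l.dropLast - colSum l| ≤ 1 := by
  rcases l.eq_nil_or_concat with rfl | ⟨l, b, rfl⟩
  · simp
  · rw [List.concat_eq_append, List.dropLast_concat, colSum_append_singleton]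
    cases b <;> simp [signVal]

lemma abs_X_sub_le_abs (s : State P) (A : Finset (Fin P.n)) (τ : ℕ) (i : Fin P.n) :
    |s.X A τ i - s.X ∅ τ i| ≤ |colSum (s.viewCol A τ i) - colSum (s.board τ i)| := by
  rw [X_empty, X, max_comm (-P.Xmax), max_comm (-P.Xmax), min_comm P.Xmax, min_comm P.Xmax]
  exact (abs_sup_sub_sup_le_abs _ _ _).trans (abs_inf_sub_inf_le_abs _ _ _)

lemma abs_X_sub_le (s : State P) (A : Finset (Fin P.n)) (τ : ℕ) (i : Fin P.n) :
    |s.X A τ i - s.X ∅ τ i| ≤ if i ∈ A then 1 else 0 := by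
  refine (s.abs_X_sub_le_abs A τ i).trans ?_
  unfold viewCol
  by_cases h : i ∈ A
  · rw [if_pos h]
    split_ifs
    · exact abs_colSum_dropLast_sub_le _
    · simp
  · simp [h]

/-- In a view, at most one entry of each column history is missing. -/
lemma sum_abs_X_sub_le (s : State P) (A : Finset (Fin P.n)) (E : Finset ℕ) (i : Fin P.n) :
    ∑ τ ∈ E, |s.X A τ i - s.X ∅ τ i| ≤ 1 := by
  by_cases hall : ∀ τ ∈ E, s.X A τ i - s.X ∅ τ i = 0
  · rw [Finset.sum_eq_zero fun τ hτ => by rw [hall τ hτ, abs_zero]]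
    exact zero_le_one
  · push Not at hall
    obtain ⟨τ₀, hτ₀, hne⟩ := hall
    -- Only the last value a process has written can be missing, so a discrepancy singles out the
    -- last iteration in which its column is nonempty.
    have key : ∀ τ, s.X A τ i - s.X ∅ τ i ≠ 0 →
        s.board τ i ≠ [] ∧ ∀ τ', τ < τ' → s.board τ' i = [] := by
      intro τ h
      have h1 : s.viewCol A τ i ≠ s.board τ i := by
        intro heq
        have := s.abs_X_sub_le_abs A τ i
        rw [heq, sub_self, abs_zero] at this
        exact h (abs_nonpos_iff.1 this)
      unfold viewCol at h1
      split_ifs at h1 with h2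
      · refine ⟨fun h3 => h1 (by simp [h3]), h2.2⟩
      · exact absurd rfl h1
    have huniq : ∀ τ ∈ E, τ ≠ τ₀ → |s.X A τ i - s.X ∅ τ i| = 0 := by
      intro τ _ hτne
      by_contra hcon
      have h1 := key τ fun h => hcon (by rw [h, abs_zero])
      have h2 := key τ₀ hne
      rcases lt_or_gt_of_ne hτne with h | h
      · exact h2.1 (h1.2 _ h)
      · exact h1.1 (h2.2 _ h)
    rw [Finset.sum_eq_single_of_mem τ₀ hτ₀ huniq]
    refine (s.abs_X_sub_le A τ₀ i).trans ?_
    split_ifs <;> norm_num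

end State

end Views

/-! ### The potential of a single iteration. -/

section Walk

/-- The data of the weighted sum of the good columns of one blackboard, regarded as a random walk
whose variance is compared with that of `K` steps of length `η`. -/
structure WalkData (n : ℕ) where
  m : ℕ
  bad : Finset (Fin n)
  w : Fin n → ℝ
  sign : ℝ
  K : ℕ
  η : ℝ
  s : ℝ
  lam : ℝ

namespace WalkData

variable {n : ℕ} (D : WalkData n)

/-- The standing assumptions. -/
structure Valid : Prop where
  w_nonneg : ∀ i, 0 ≤ D.w i
  w_le : ∀ i, D.w i ≤ 1
  sign_eq : D.sign = 1 ∨ D.sign = -1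
  η_pos : 0 < D.η
  s_pos : 0 < D.s
  lam_nonneg : 0 ≤ D.lam

/-- The position of the walk. -/
def pos (b : Fin n → List Bool) : ℝ := -D.sign * ∑ i ∈ D.badᶜ, D.w i * colSum (b i)

/-- The number of steps of length `η` that a coin of process `i` accounts for. -/
def quanta (i : Fin n) : ℕ := ⌊D.w i ^ 2 / D.η ^ 2⌋₊

/-- The number of steps of length `η` accounted for so far. -/
def used (b : Fin n → List Bool) : ℕ := ∑ i ∈ D.badᶜ, D.quanta i * (b i).length

/-- The number of coins that remain to be flipped by the good processes. -/
def rem (b : Fin n → List Bool) : ℝ := ∑ i ∈ D.badᶜ, ((D.m : ℝ) - (b i).length)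

/-- A lower estimate of the expected final value of `max 0 pos ^ 2`. -/
def main (b : Fin n → List Bool) : ℝ :=
  heat D.s D.η (D.K - D.used b) (D.pos b) - D.s / 4 - 12 / D.s * D.rem b

/-- An upper estimate of the expected final value of `pos ^ 4`. -/
def quartic (b : Fin n → List Bool) : ℝ :=
  D.pos b ^ 4 + 6 * D.pos b ^ 2 * D.rem b + 3 * D.rem b ^ 2

/-- An upper estimate of the expected final value of `exp (-lam * max 0 pos ^ 2)`. -/
def value (b : Fin n → List Bool) : ℝ :=
  1 - D.lam * D.main b + D.lam ^ 2 / 2 * D.quartic b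

variable {D}

lemma sum_compl_update {M : Type*} [AddCommMonoid M] {b : Fin n → List Bool} {i : Fin n}
    (hi : i ∈ D.bad) (l : List Bool) (g : Fin n → List Bool → M) :
    ∑ j ∈ D.badᶜ, g j (Function.update b i l j) = ∑ j ∈ D.badᶜ, g j (b j) := by
  refine Finset.sum_congr rfl fun j hj => ?_
  have : j ≠ i := fun h => (Finset.mem_compl.1 hj) (h ▸ hi)
  rw [Function.update_of_ne this]

lemma value_update_bad {b : Fin n → List Bool} {i : Fin n} (hi : i ∈ D.bad) (l : List Bool) :
    D.value (Function.update b i l) = D.value b := by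
  have h1 : D.pos (Function.update b i l) = D.pos b := by
    unfold pos; rw [sum_compl_update hi l fun j c => D.w j * colSum c]
  have h2 : D.used (Function.update b i l) = D.used b :=
    sum_compl_update hi l fun j c => D.quanta j * c.length
  have h3 : D.rem (Function.update b i l) = D.rem b :=
    sum_compl_update hi l fun j c => (D.m : ℝ) - c.length
  simp only [value, main, quartic, h1, h2, h3]

lemma sum_compl_append {M : Type*} [AddCommGroup M] {b : Fin n → List Bool} {i : Fin n}
    (hi : i ∉ D.bad) (l : List Bool) (g : Fin n → List Bool → M) :
    ∑ j ∈ D.badᶜ, g j (Function.update b i l j) =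
      ∑ j ∈ D.badᶜ, g j (b j) + (g i l - g i (b i)) := by
  have hi' : i ∈ D.badᶜ := Finset.mem_compl.2 hi
  rw [← Finset.add_sum_erase _ _ hi', ← Finset.add_sum_erase _ (fun j => g j (b j)) hi',
    Function.update_self]
  have : ∑ j ∈ D.badᶜ.erase i, g j (Function.update b i l j) =
      ∑ j ∈ D.badᶜ.erase i, g j (b j) := by
    refine Finset.sum_congr rfl fun j hj => ?_
    rw [Function.update_of_ne (Finset.ne_of_mem_erase hj)]
  rw [this]
  abel

/-- `main` does not decrease on average: the error in `heat_le_average` is paid by `rem` dropping by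
1. `quartic` does not increase: it is designed for `rem` further steps of unit length, and weights
are at most 1. -/
lemma value_average (hD : D.Valid) {b : Fin n → List Bool} {i : Fin n} (hi : i ∉ D.bad)
    (hlen : ∀ j, (b j).length ≤ D.m) (hlt : (b i).length < D.m) :
    D.value (Function.update b i (b i ++ [true])) +
      D.value (Function.update b i (b i ++ [false])) ≤ 2 * D.value b := by
  have h1 : ∀ c, D.pos (Function.update b i (b i ++ [c])) =
      D.pos b - D.sign * (D.w i * signVal c) := by
    intro c
    unfold pos
    rw [sum_compl_append hi _ fun j c => D.w j * colSum c]
    simp only [colSum_append_singleton]; ring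
  have h2 : ∀ c, D.used (Function.update b i (b i ++ [c])) = D.used b + D.quanta i := by
    intro c
    have := sum_compl_append (b := b) hi (b i ++ [c]) fun j l => ((D.quanta j * l.length : ℕ) : ℤ)
    have h3 : ((D.used (Function.update b i (b i ++ [c])) : ℕ) : ℤ) = D.used b + D.quanta i := by
      unfold used
      push_cast at this ⊢
      rw [this]
      simp; ring
    exact_mod_cast h3
  have h3 : ∀ c, D.rem (Function.update b i (b i ++ [c])) = D.rem b - 1 := by
    intro c
    unfold rem
    rw [sum_compl_append hi _ fun j c => (D.m : ℝ) - c.length]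
    simp; ring
  have hrem : 1 ≤ D.rem b := by
    have h4 : (1 : ℝ) ≤ (D.m : ℝ) - (b i).length := by
      have : ((b i).length : ℝ) + 1 ≤ D.m := by exact_mod_cast hlt
      linarith
    refine h4.trans (Finset.single_le_sum (f := fun j => (D.m : ℝ) - (b j).length)
      (fun j _ => ?_) (Finset.mem_compl.2 hi))
    have : ((b j).length : ℝ) ≤ D.m := by exact_mod_cast hlen j
    simpa using this
  have hw0 := hD.w_nonneg i
  have hw1 := hD.w_le i
  have hq : D.quanta i * D.η ^ 2 ≤ D.w i ^ 2 := by
    rw [← le_div_iff₀ (by have := hD.η_pos; positivity)]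
    exact Nat.floor_le (by positivity)
  have hheat := heat_le_average hD.s_pos hD.η_pos.le hw0 hq (D.K - D.used b) (D.pos b)
  rw [← Nat.sub_add_eq] at hheat
  have hw4 : D.w i ^ 4 ≤ 1 := pow_le_one₀ hw0 hw1
  have hw2 : D.w i ^ 2 ≤ 1 := pow_le_one₀ hw0 hw1
  have hmain : 2 * D.main b ≤ D.main (Function.update b i (b i ++ [true])) +
      D.main (Function.update b i (b i ++ [false])) := by
    have h5 : 24 / D.s * D.w i ^ 4 ≤ 24 / D.s := by
      have : 0 ≤ 24 / D.s := by have := hD.s_pos; positivity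
      nlinarith
    have e : 24 / D.s = 2 * (12 / D.s) := by ring
    simp only [main, h1, h2, h3, signVal]
    rw [e] at h5 hheat
    rcases hD.sign_eq with h | h <;> simp only [h, if_true, Bool.false_eq_true, if_false]
    · rw [show D.pos b - 1 * (D.w i * 1) = D.pos b - D.w i by ring,
        show D.pos b - 1 * (D.w i * -1) = D.pos b + D.w i by ring]
      linarith
    · rw [show D.pos b - -1 * (D.w i * 1) = D.pos b + D.w i by ring,
        show D.pos b - -1 * (D.w i * -1) = D.pos b - D.w i by ring]
      linarith
  have hquart : D.quartic (Function.update b i (b i ++ [true])) +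
      D.quartic (Function.update b i (b i ++ [false])) ≤ 2 * D.quartic b := by
    have hs : D.sign ^ 2 = 1 := by rcases hD.sign_eq with h | h <;> rw [h] <;> norm_num
    simp only [quartic, h1, h3, signVal, if_true, Bool.false_eq_true, if_false]
    set x := D.pos b
    set R := D.rem b
    set v := D.sign * D.w i with hv
    have hv2 : v ^ 2 = D.w i ^ 2 := by rw [hv, mul_pow, hs, one_mul]
    rw [← hv2] at hw2
    have hv0 : 0 ≤ v ^ 2 := sq_nonneg v
    have e1 : D.sign * (D.w i * 1) = v := by rw [hv]; ring
    have e2 : D.sign * (D.w i * -1) = -v := by rw [hv]; ring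
    rw [e1, e2]
    have h7 : 0 ≤ (1 - v ^ 2) * (R - 1) := mul_nonneg (by linarith) (by linarith)
    have h8 : 0 ≤ (1 - v ^ 2) * x ^ 2 := mul_nonneg (by linarith) (sq_nonneg x)
    have h9 : v ^ 4 ≤ v ^ 2 := by nlinarith
    nlinarith
  have h4 := mul_le_mul_of_nonneg_left hmain hD.lam_nonneg
  have h5 := mul_le_mul_of_nonneg_left hquart (by positivity : 0 ≤ D.lam ^ 2 / 2)
  unfold value
  linarith

lemma rem_nonneg {b : Fin n → List Bool} (hlen : ∀ j, (b j).length ≤ D.m) : 0 ≤ D.rem b :=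
  Finset.sum_nonneg fun j _ => by
    have : ((b j).length : ℝ) ≤ D.m := by exact_mod_cast hlen j
    linarith

/-- Markov's inequality needs a nonnegative potential. The assumption on `K` keeps the variance of
the outstanding fine steps below `rem`, so `y = pos² + rem` satisfies `main ≤ y` and `y² ≤ quartic`,
while `1 - lam y + (lam y)² / 2` is positive. -/
lemma value_nonneg (hD : D.Valid) {b : Fin n → List Bool} (hlen : ∀ j, (b j).length ≤ D.m)
    (hK : D.K ≤ D.m * ∑ i ∈ D.badᶜ, D.quanta i) : 0 ≤ D.value b := by
  have hrem := rem_nonneg hlen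
  have hle : ((D.K - D.used b : ℕ) : ℝ) * D.η ^ 2 ≤ D.rem b := by
    have h1 : ((D.K - D.used b : ℕ) : ℝ) ≤ ∑ i ∈ D.badᶜ, D.quanta i * ((D.m : ℝ) - (b i).length) := by
      rcases le_total D.K (D.used b) with h | h
      · rw [Nat.sub_eq_zero_of_le h, Nat.cast_zero]
        refine Finset.sum_nonneg fun j _ => ?_
        have : ((b j).length : ℝ) ≤ D.m := by exact_mod_cast hlen j
        exact mul_nonneg (Nat.cast_nonneg _) (by linarith)
      · rw [Nat.cast_sub h]
        have h2 : (D.K : ℝ) ≤ D.m * ∑ i ∈ D.badᶜ, (D.quanta i : ℝ) := by exact_mod_cast hK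
        unfold used
        push_cast
        simp only [mul_sub, Finset.sum_sub_distrib, ← Finset.sum_mul]
        linarith
    have hη := hD.η_pos
    calc _ ≤ (∑ i ∈ D.badᶜ, D.quanta i * ((D.m : ℝ) - (b i).length)) * D.η ^ 2 := by gcongr
      _ ≤ D.rem b := by
        unfold rem
        rw [Finset.sum_mul]
        refine Finset.sum_le_sum fun i _ => ?_
        have h3 : ((b i).length : ℝ) ≤ D.m := by exact_mod_cast hlen i
        have h4 : D.quanta i * D.η ^ 2 ≤ 1 := by
          refine le_trans ?_ (pow_le_one₀ (hD.w_nonneg i) (hD.w_le i) : D.w i ^ 2 ≤ 1)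
          rw [← le_div_iff₀ (by positivity)]
          exact Nat.floor_le (by positivity)
        nlinarith
  have hmain : D.main b ≤ D.pos b ^ 2 + D.rem b := by
    have h1 := heat_le hD.s_pos D.η (D.K - D.used b) (D.pos b)
    have h2 : 0 ≤ 12 / D.s * D.rem b := mul_nonneg (by have := hD.s_pos; positivity) hrem
    unfold main
    linarith
  have hlam := mul_le_mul_of_nonneg_left hmain hD.lam_nonneg
  have hq : (D.pos b ^ 2 + D.rem b) ^ 2 ≤ D.quartic b := by
    unfold quartic
    nlinarith [mul_nonneg (sq_nonneg (D.pos b)) hrem, sq_nonneg (D.rem b)]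
  have hq' := mul_le_mul_of_nonneg_left hq (by positivity : 0 ≤ D.lam ^ 2 / 2)
  unfold value
  nlinarith [sq_nonneg (D.lam * (D.pos b ^ 2 + D.rem b) - 1)]

/-- On the empty board the walk is at 0, where the heat flow equals `K η² / 2`; the rest is `1 + x ≤
exp x`. -/
lemma value_nil_le (hD : D.Valid) :
    D.value (fun _ => []) ≤ Real.exp (-(D.lam * (D.K * D.η ^ 2 / 2 - D.s / 4 -
      12 / D.s * (n * D.m)) - 3 / 2 * D.lam ^ 2 * (n * D.m) ^ 2)) := by
  have hr : D.rem (fun _ => []) ≤ n * D.m := by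
    simp only [rem, List.length_nil, Nat.cast_zero, sub_zero, Finset.sum_const, nsmul_eq_mul]
    gcongr
    simpa using Finset.card_le_univ D.badᶜ
  have hr0 : 0 ≤ D.rem (fun _ => []) := rem_nonneg fun _ => by simp
  have hp : D.pos (fun _ => []) = 0 := by simp [pos]
  have hu : D.used (fun _ => []) = 0 := by simp [used]
  have hs : 0 ≤ 12 / D.s := by have := hD.s_pos; positivity
  have h1 := mul_le_mul_of_nonneg_left hr hs
  have h2 := mul_le_mul_of_nonneg_left h1 hD.lam_nonneg
  have h3 := pow_le_pow_left₀ hr0 hr 2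
  have h4 := mul_le_mul_of_nonneg_left h3 (by positivity : 0 ≤ 3 / 2 * D.lam ^ 2)
  refine le_trans ?_ (Real.add_one_le_exp _)
  simp only [value, main, quartic, hp, hu, Nat.sub_zero, heat_zero_right]
  nlinarith

/-- Once all `K` fine steps are used, `main` is at most `max 0 pos ^ 2` and `quartic` at least its
square, so `exp (-z) ≤ 1 - z + z² / 2` for `z ≥ 0` suffices. -/
lemma exp_le_value (hD : D.Valid) {b : Fin n → List Bool} (hlen : ∀ j, (b j).length ≤ D.m)
    (hK : D.K ≤ D.used b) : Real.exp (-(D.lam * max 0 (D.pos b) ^ 2)) ≤ D.value b := by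
  have hrem := rem_nonneg hlen
  set y := max 0 (D.pos b) ^ 2 with hy
  have hy0 : 0 ≤ y := sq_nonneg _
  have h1 : Real.exp (-(D.lam * y)) ≤ 1 - D.lam * y + (D.lam * y) ^ 2 / 2 := by
    have hz : 0 ≤ D.lam * y := mul_nonneg hD.lam_nonneg hy0
    set z := D.lam * y
    have h2 := Real.quadratic_le_exp_of_nonneg hz
    have h3 : 0 < 1 - z + z ^ 2 / 2 := by nlinarith [sq_nonneg (z - 1)]
    have h4 : Real.exp (-z) * Real.exp z = 1 := by rw [← Real.exp_add]; simp
    have h5 : Real.exp (-z) * (1 + z + z ^ 2 / 2) ≤ 1 := by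
      calc _ ≤ Real.exp (-z) * Real.exp z := mul_le_mul_of_nonneg_left h2 (Real.exp_pos _).le
        _ = 1 := h4
    -- The product is `1 + z⁴ / 4`.
    have h6 : 1 ≤ (1 - z + z ^ 2 / 2) * (1 + z + z ^ 2 / 2) := by nlinarith [sq_nonneg (z ^ 2)]
    by_contra! hcon
    have h7 : 0 < 1 + z + z ^ 2 / 2 := by positivity
    nlinarith
  have hmain : D.main b ≤ y := by
    have h2 := psi_le hD.s_pos (D.pos b)
    have h3 : 0 ≤ 12 / D.s * D.rem b := mul_nonneg (by have := hD.s_pos; positivity) hrem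
    unfold main
    rw [Nat.sub_eq_zero_of_le hK]
    simp only [heat, Function.iterate_zero, id]
    linarith
  have hq : y ^ 2 ≤ D.quartic b := by
    have h2 : y ^ 2 ≤ D.pos b ^ 4 := by
      rw [hy, ← pow_mul]
      rcases le_total (D.pos b) 0 with h | h
      · rw [max_eq_left h]; exact le_trans (by norm_num) (by positivity : 0 ≤ D.pos b ^ 4)
      · rw [max_eq_right h]
    unfold quartic
    nlinarith [mul_nonneg (sq_nonneg (D.pos b)) hrem, sq_nonneg (D.rem b)]
  have h2 := mul_le_mul_of_nonneg_left hmain hD.lam_nonneg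
  have h3 := mul_le_mul_of_nonneg_left hq (by positivity : 0 ≤ D.lam ^ 2 / 2)
  unfold value
  nlinarith

end WalkData

end Walk

end

noncomputable section

open scoped Classical
open MeasureTheory

/-! ### The supermartingale of an epoch without corruptions and agreement. -/

section Fraud

variable {P : Params}

/-- The parameters of the potential that bounds the probability of undetected fraud. -/
structure Tuning where
  η : ℝ
  s : ℝ
  lam : ℝ
  δ : ℝ
  η_pos : 0 < η
  s_pos : 0 < s
  lam_nonneg : 0 ≤ lam
  δ_pos : 0 < δ
  δ_le : δ ≤ 1

namespace State

/-- The contribution of the bad processes to the weighted sum of iteration `τ`. -/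
def badSum (st : State P) (τ : ℕ) : ℝ := ∑ i ∈ st.bad, st.weight i * st.X ∅ τ i

/-- The variance that the good columns are sure to have, in units of `η ^ 2`. -/
def stepCount (st : State P) (U : Tuning) : ℕ :=
  ⌊2 * P.m * (∑ i ∈ st.bad, st.weight i ^ 2 + 9 / 20 * (P.ε * P.f)) / U.η ^ 2⌋₊

/-- The walk of the good columns of the current blackboard. -/
def walkData (st : State P) (U : Tuning) : WalkData P.n where
  m := P.m
  bad := st.bad
  w := st.weight
  sign := signVal (st.dir.getD true)
  K := st.stepCount U
  η := U.η
  s := U.s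
  lam := U.lam * (1 - U.δ)

/-- A lower bound for the expected effect of one iteration. -/
def rho (st : State P) (U : Tuning) : ℝ :=
  U.lam * (1 - U.δ) * (st.stepCount U * U.η ^ 2 / 2 - U.s / 4 - 12 / U.s * (P.n * P.m)) -
    3 / 2 * (U.lam * (1 - U.δ)) ^ 2 * (P.n * P.m) ^ 2 - U.lam * (P.f ^ 2 / U.δ)

/-- The factor of the current iteration. -/
def current (st : State P) (U : Tuning) : ℝ :=
  Real.exp (st.rho U + U.lam * (P.f ^ 2 / U.δ)) * (st.walkData U).value (st.board st.t)

/-- The exponent of the completed iterations of epoch `e`. -/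
def past (st : State P) (U : Tuning) (e : ℕ) : ℝ :=
  ∑ τ ∈ Finset.Ico (e * P.T) st.t, (st.rho U - U.lam * st.badSum τ ^ 2)

/-- Enough weight rests with the good processes. -/
def Heavy (st : State P) (U : Tuning) : Prop :=
  ∀ H : Finset (Fin P.n), H ⊆ st.badᶜ → P.n ≤ H.card + st.bad.card + P.f →
    st.stepCount U ≤ P.m * ∑ i ∈ H, (st.walkData U).quanta i

/-- No sum of a good column of iteration `τ` has been truncated. -/
def Clipless (st : State P) (τ : ℕ) : Prop := ∀ i, i ∉ st.bad → |colSum (st.board τ i)| ≤ P.Xmax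

/-- Epoch `e` has not begun. -/
def Before (st : State P) (e : ℕ) : Prop := st.t < e * P.T ∨ st.t = e * P.T ∧ st.dir = none

/-- The potential of epoch `e` has not been set to `0`. -/
structure Live (st : State P) (U : Tuning) (e : ℕ) : Prop where
  t_lt : st.t < (e + 1) * P.T
  agreed : ¬ st.agreed
  clean : st.startBad = st.bad
  heavy : st.Heavy U
  clipless : ∀ τ < st.t, st.Clipless τ

/-- The potential that bounds the probability of undetected fraud in epoch `e`. -/
def fraudPotential (U : Tuning) (e : ℕ) (st : State P) : ℝ :=
  if st.Before e then 1 else if st.Live U e then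
    Real.exp (st.past U e) * (if st.dir = none then 1 else st.current U) else 0

variable {U : Tuning} {e : ℕ} {st : State P}

lemma fraudPotential_before (h : st.Before e) : fraudPotential U e st = 1 := if_pos h

lemma fraudPotential_dead (h : ¬ st.Before e) (h' : ¬ st.Live U e) :
    fraudPotential U e st = 0 := by
  unfold fraudPotential; rw [if_neg h, if_neg h']

lemma fraudPotential_none (h : ¬ st.Before e) (h' : st.Live U e) (hd : st.dir = none) :
    fraudPotential U e st = Real.exp (st.past U e) := by
  unfold fraudPotential; rw [if_neg h, if_pos h', if_pos hd, mul_one]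

lemma fraudPotential_some (h : ¬ st.Before e) (h' : st.Live U e) (hd : st.dir ≠ none) :
    fraudPotential U e st = Real.exp (st.past U e) * st.current U := by
  unfold fraudPotential; rw [if_neg h, if_pos h', if_neg hd]

lemma signVal_eq (b : Bool) : signVal b = 1 ∨ signVal b = -1 := by
  cases b <;> simp [signVal]

lemma Inv.walkData_valid (hs : st.Inv) (U : Tuning) : (st.walkData U).Valid where
  w_nonneg := hs.weight_nonneg
  w_le := hs.weight_le
  sign_eq := signVal_eq _
  η_pos := U.η_pos
  s_pos := U.s_pos
  lam_nonneg := mul_nonneg U.lam_nonneg (by linarith [U.δ_le])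

lemma Inv.current_nonneg (hs : st.Inv) (h : st.Heavy U) : 0 ≤ st.current U := by
  refine mul_nonneg (Real.exp_pos _).le
    (WalkData.value_nonneg (hs.walkData_valid U) (hs.length_le st.t) ?_)
  refine h st.badᶜ subset_rfl ?_
  rw [Finset.card_compl, Fintype.card_fin]
  omega

lemma fraudPotential_nonneg (hs : st.Inv) : 0 ≤ fraudPotential U e st := by
  by_cases h : st.Before e
  · rw [fraudPotential_before h]; exact zero_le_one
  · by_cases h' : st.Live U e
    · by_cases hd : st.dir = none
      · rw [fraudPotential_none h h' hd]; positivity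
      · rw [fraudPotential_some h h' hd]
        exact mul_nonneg (Real.exp_pos _).le (hs.current_nonneg h'.heavy)
    · rw [fraudPotential_dead h h']

/-- `rho` is the exponent from `value_nil_le` less the cost `lam f² / δ` of incomplete views, so the
prefactor of `current` normalizes an empty board. -/
lemma Inv.current_le_one (hs : st.Inv) (hb : ∀ i, st.board st.t i = []) : st.current U ≤ 1 := by
  have h0 : st.board st.t = fun _ => [] := funext hb
  have h1 := WalkData.value_nil_le (hs.walkData_valid U)
  unfold current
  rw [h0]
  refine (mul_le_mul_of_nonneg_left h1 (Real.exp_pos _).le).trans ?_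
  rw [← Real.exp_add]
  refine Real.exp_le_one_iff.2 (le_of_eq ?_)
  simp only [rho, walkData]
  ring

lemma sum_X_sub_le (hs : st.Inv) (A : Finset (Fin P.n)) (hA : A.card ≤ P.f) (τ : ℕ) :
    |∑ i, st.weight i * st.X A τ i - ∑ i, st.weight i * st.X ∅ τ i| ≤ P.f := by
  rw [← Finset.sum_sub_distrib]
  refine (Finset.abs_sum_le_sum_abs _ _).trans ?_
  have : ∀ i ∈ Finset.univ, |st.weight i * st.X A τ i - st.weight i * st.X ∅ τ i| ≤
      if i ∈ A then (1 : ℝ) else 0 := by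
    intro i _
    rw [← mul_sub, abs_mul, abs_of_nonneg (hs.weight_nonneg i)]
    calc _ ≤ 1 * |st.X A τ i - st.X ∅ τ i| :=
          mul_le_mul_of_nonneg_right (hs.weight_le i) (abs_nonneg _)
      _ ≤ _ := by rw [one_mul]; exact st.abs_X_sub_le A τ i
  refine (Finset.sum_le_sum this).trans ?_
  simp only [Finset.sum_ite_mem, Finset.univ_inter, Finset.sum_const, nsmul_eq_mul, mul_one]
  exact_mod_cast hA

/-- If a good process outputs the adversarial direction, the bad processes must have made up for
the good ones. -/
lemma badSum_sq_ge (hs : st.Inv) {A : Finset (Fin P.n)} (hA : A.card ≤ P.f)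
    (hd : st.dir = some (st.coinFlip A)) (hc : st.Clipless st.t) {δ : ℝ} (hδ : 0 < δ)
    (hδ1 : δ ≤ 1) :
    (1 - δ) * max 0 ((st.walkData U).pos (st.board st.t)) ^ 2 - P.f ^ 2 / δ ≤
      st.badSum st.t ^ 2 := by
  set x := (st.walkData U).pos (st.board st.t) with hx
  set ς := signVal (st.coinFlip A) with hς
  have hx' : x = -ς * ∑ i ∈ st.badᶜ, st.weight i * st.X ∅ st.t i := by
    rw [hx, WalkData.pos]
    simp only [walkData, hd, Option.getD_some]
    congr 1
    exact Finset.sum_congr rfl fun i hi => by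
      rw [X_empty_of_abs_le (hc i (Finset.mem_compl.1 hi))]
  have h1 : 0 ≤ ς * ∑ i, st.weight i * st.X A st.t i := by
    rw [hς]
    unfold coinFlip sgn
    by_cases h : 0 ≤ ∑ i, st.weight i * st.X A st.t i
    · simp [h, signVal]
    · simp [h, signVal, (not_le.1 h).le]
  have h2 := abs_le.1 (sum_X_sub_le hs A hA st.t)
  have h3 : ∑ i, st.weight i * st.X ∅ st.t i = st.badSum st.t +
      ∑ i ∈ st.badᶜ, st.weight i * st.X ∅ st.t i := by
    rw [badSum, Finset.sum_add_sum_compl]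
  -- The total in the view does not oppose `ς`, and the view distorts it by at most `f`; so the bad
  -- sum offsets the opposition `x` of the good columns up to `f`.
  have h4 : x - P.f ≤ ς * st.badSum st.t := by
    rw [h3] at h2
    rcases signVal_eq (st.coinFlip A) with h | h <;> rw [hς, h] at h1 hx' <;> rw [hς, h] <;>
      linarith [h2.1, h2.2]
  have h5 : (ς * st.badSum st.t) ^ 2 = st.badSum st.t ^ 2 := by
    rcases signVal_eq (st.coinFlip A) with h | h <;> rw [hς, h] <;> ring
  rw [← h5]
  have hf : (0 : ℝ) ≤ P.f := Nat.cast_nonneg _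
  have h6 : (P.f : ℝ) ^ 2 ≤ P.f ^ 2 / δ := by
    rw [le_div_iff₀ hδ]
    have : (0 : ℝ) ≤ P.f ^ 2 := by positivity
    nlinarith
  set y := ς * st.badSum st.t
  rcases le_total x P.f with h | h
  · have h7 : max 0 x ^ 2 ≤ (P.f : ℝ) ^ 2 :=
      pow_le_pow_left₀ (le_max_left _ _) (max_le hf h) 2
    have h8 : 0 ≤ max 0 x ^ 2 := sq_nonneg _
    nlinarith [sq_nonneg y]
  · rw [max_eq_right (hf.trans h)]
    have h7 : (x - P.f) ^ 2 ≤ y ^ 2 := pow_le_pow_left₀ (by linarith) h4 2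
    refine le_trans ?_ h7
    -- What remains is `(x - f)² - (1 - δ) x² + f² / δ = δ (x - f / δ)² + f²`.
    have h8 : (P.f : ℝ) ^ 2 / δ = P.f ^ 2 / δ ^ 2 * δ := by field_simp
    have h9 : (P.f : ℝ) / δ * δ = P.f := by field_simp
    have h10 : (P.f : ℝ) ^ 2 / δ ^ 2 = (P.f / δ) ^ 2 := by rw [div_pow]
    rw [h8, h10]
    set z := (P.f : ℝ) / δ
    have h11 : 0 ≤ δ * (x - z) ^ 2 := by positivity
    rw [← h9]
    nlinarith [mul_nonneg (mul_nonneg hδ.le hδ.le) (sq_nonneg z)]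

/-- At least `n - f` columns are full. Dropping the bad ones leaves a set to which `Heavy` applies,
and each of its columns has used `m` times its quanta. -/
lemma stepCount_le_used
    (hfull : P.n - P.f ≤ (Finset.univ.filter fun i => P.m ≤ (st.board st.t i).length).card)
    (h : st.Heavy U) : st.stepCount U ≤ (st.walkData U).used (st.board st.t) := by
  set H := (Finset.univ.filter fun i => P.m ≤ (st.board st.t i).length) \ st.bad with hH
  have h1 : st.stepCount U ≤ P.m * ∑ i ∈ H, (st.walkData U).quanta i := by
    refine h H (fun i hi => Finset.mem_compl.2 (Finset.mem_sdiff.1 hi).2) ?_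
    have := Finset.le_card_sdiff st.bad
      (Finset.univ.filter fun i => P.m ≤ (st.board st.t i).length)
    rw [← hH] at this
    omega
  refine h1.trans ?_
  rw [Finset.mul_sum]
  calc _ ≤ ∑ i ∈ H, (st.walkData U).quanta i * (st.board st.t i).length := by
        refine Finset.sum_le_sum fun i hi => ?_
        rw [mul_comm]
        exact Nat.mul_le_mul_left _ (Finset.mem_filter.1 (Finset.mem_sdiff.1 hi).1).2
    _ ≤ _ := Finset.sum_le_sum_of_subset fun i hi =>
        Finset.mem_compl.2 (Finset.mem_sdiff.1 hi).2

/-- At the end of an iteration without agreement, the factor of the current iteration accounts for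
the contribution of the bad processes. -/
lemma exp_le_current (hs : st.Inv) {A : Fin P.n → Finset (Fin P.n)}
    (hl : st.Legal (.complete A))
    (hna : ¬ ∀ p, p ∉ st.bad → st.dir = some (!(st.coinFlip (A p))))
    (hc : st.Clipless st.t) (hh : st.Heavy U) :
    Real.exp (st.rho U - U.lam * st.badSum st.t ^ 2) ≤ st.current U := by
  obtain ⟨hd, hfull, hA⟩ := hl
  push Not at hna
  obtain ⟨p, -, hp⟩ := hna
  have hd' : st.dir = some (st.coinFlip (A p)) := by
    cases h : st.dir with
    | none => exact absurd h hd
    | some σ =>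
      rw [h] at hp
      cases hσ : σ <;> cases hf : st.coinFlip (A p) <;> simp_all
  have h1 := badSum_sq_ge (U := U) hs (hA p) hd' hc U.δ_pos U.δ_le
  have h2 := WalkData.exp_le_value (hs.walkData_valid U) (hs.length_le st.t)
    (stepCount_le_used hfull hh)
  unfold current
  refine le_trans ?_ (mul_le_mul_of_nonneg_left h2 (Real.exp_pos _).le)
  rw [← Real.exp_add]
  refine Real.exp_le_exp.2 ?_
  have h3 := mul_le_mul_of_nonneg_left h1 U.lam_nonneg
  simp only [walkData] at h3 ⊢
  nlinarith

lemma not_dvd_of_between {T t e : ℕ} (h1 : e * T < t) (h2 : t < (e + 1) * T) : ¬ T ∣ t := by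
  rintro ⟨q, rfl⟩
  rw [mul_comm T q] at h1 h2
  have h3 := Nat.lt_of_mul_lt_mul_right h1
  have h4 := Nat.lt_of_mul_lt_mul_right h2
  omega

/-- The direction is committed while the board is empty, so `current ≤ 1` whichever sign is chosen.
Within the epoch a start does not touch `startBad`, so a live potential was live before. -/
lemma fraudPotential_start (hs : st.Inv) (ht : st.t < P.iterations) (hd : st.dir = none)
    (ω : Coins P) (hε : 0 ≤ P.ε) (σ : Bool) :
    fraudPotential U e (st.apply ω (.start σ)) ≤ fraudPotential U e st := by
  have hs' : (st.apply ω (.start σ)).Inv := hs.apply hε ht ω (mv := .start σ) hd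
  have hcur : (st.apply ω (.start σ)).current U ≤ 1 := hs'.current_le_one (hs.empty_of_dir hd)
  by_cases hb' : (st.apply ω (.start σ)).Before e
  · have hb : st.Before e := by
      rcases hb' with h | ⟨_, h⟩
      · exact Or.inl h
      · simp [apply] at h
    rw [fraudPotential_before hb, fraudPotential_before hb']
  · by_cases hl' : (st.apply ω (.start σ)).Live U e
    · rw [fraudPotential_some hb' hl' (by simp [apply])]
      by_cases hb : st.Before e
      · have hteq : st.t = e * P.T := by
          rcases hb with h | ⟨h, _⟩
          · exact absurd (Or.inl h) hb'
          · exact h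
        have hpast : (st.apply ω (.start σ)).past U e = 0 := by
          unfold past
          rw [show (st.apply ω (.start σ)).t = e * P.T from hteq]
          simp
        rw [fraudPotential_before hb, hpast, Real.exp_zero, one_mul]
        exact hcur
      · have hlt : e * P.T < st.t := by
          by_contra hcon
          rcases lt_or_eq_of_le (not_lt.1 hcon) with h | h
          · exact hb (Or.inl h)
          · exact hb (Or.inr ⟨h, hd⟩)
        have hnd := not_dvd_of_between hlt hl'.t_lt
        have hclean := hl'.clean
        simp only [apply, if_neg hnd] at hclean
        have hl : st.Live U e := ⟨hl'.t_lt, hl'.agreed, hclean, hl'.heavy, hl'.clipless⟩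
        rw [fraudPotential_none hb hl hd]
        have hpast : (st.apply ω (.start σ)).past U e = st.past U e := rfl
        rw [hpast]
        exact mul_le_of_le_one_right (Real.exp_pos _).le hcur
    · rw [fraudPotential_dead hb' hl']
      exact fraudPotential_nonneg hs

lemma board_write_of_lt (ω : Coins P) (i : Fin P.n) (v : Bool) {τ : ℕ} (h : τ < st.t) :
    (st.apply ω (.write i v)).board τ = st.board τ := by
  simp [apply, h.ne]

lemma live_write (ω : Coins P) (i : Fin P.n) (v : Bool) :
    (st.apply ω (.write i v)).Live U e ↔ st.Live U e := by
  have hb : ∀ τ < st.t, ((st.apply ω (.write i v)).Clipless τ ↔ st.Clipless τ) := by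
    intro τ hτ
    unfold Clipless
    rw [board_write_of_lt ω i v hτ]; rfl
  constructor
  · intro h
    exact ⟨h.t_lt, h.agreed, h.clean, h.heavy, fun τ hτ => (hb τ hτ).1 (h.clipless τ hτ)⟩
  · intro h
    exact ⟨h.t_lt, h.agreed, h.clean, h.heavy, fun τ hτ => (hb τ hτ).2 (h.clipless τ hτ)⟩

lemma badSum_congr {s' : State P} {τ : ℕ} (h1 : s'.bad = st.bad) (h2 : s'.weight = st.weight)
    (h3 : s'.board τ = st.board τ) : s'.badSum τ = st.badSum τ := by
  simp only [badSum, X_empty, h1, h2, h3]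

lemma past_write (ω : Coins P) (i : Fin P.n) (v : Bool) :
    (st.apply ω (.write i v)).past U e = st.past U e := by
  refine Finset.sum_congr rfl fun τ hτ => ?_
  have := badSum_congr (st := st) (s' := st.apply ω (.write i v)) rfl rfl
    (board_write_of_lt ω i v (Finset.mem_Ico.1 hτ).2)
  rw [this]; rfl

lemma current_write (ω : Coins P) (i : Fin P.n) (v : Bool) :
    (st.apply ω (.write i v)).current U = Real.exp (st.rho U + U.lam * (P.f ^ 2 / U.δ)) *
      (st.walkData U).value (Function.update (st.board st.t) i
        (st.board st.t i ++ [writtenValue ω st i v])) := by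
  have : (st.apply ω (.write i v)).board st.t = Function.update (st.board st.t) i
      (st.board st.t i ++ [writtenValue ω st i v]) := by simp [apply]
  rw [← this]; rfl

/-- The completion that ends the epoch makes `Live` fail, so the potential drops to 0. Any earlier
one keeps the weights and `rho`, and `current` is traded for the smaller exponential that joins
`past`. -/
lemma fraudPotential_complete (hs : st.Inv) (ω : Coins P)
    {A : Fin P.n → Finset (Fin P.n)} (hl : st.Legal (.complete A)) :
    fraudPotential U e (st.apply ω (.complete A)) ≤ fraudPotential U e st := by
  set s' := st.apply ω (.complete A) with hs'
  have ht' : s'.t = st.t + 1 := rfl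
  have hd' : s'.dir = none := rfl
  have hboard : s'.board = st.board := rfl
  have hbad : s'.bad = st.bad := rfl
  by_cases hb : st.Before e
  · have hb' : s'.Before e := by
      rcases hb with h | ⟨_, h⟩
      · rcases lt_or_eq_of_le (Nat.succ_le_of_lt h) with h | h
        · exact Or.inl h
        · exact Or.inr ⟨h, hd'⟩
      · exact absurd h hl.1
    rw [fraudPotential_before hb, fraudPotential_before hb']
  · have hge : e * P.T ≤ st.t := not_lt.1 fun h => hb (Or.inl h)
    have hb' : ¬ s'.Before e := by
      rintro (h | ⟨h, _⟩) <;> rw [ht'] at h <;> omega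
    by_cases hl' : s'.Live U e
    · have hlt := hl'.t_lt
      have hnd : ¬ P.T ∣ st.t + 1 := not_dvd_of_between (Nat.lt_succ_of_le hge) hlt
      have hw : s'.weight = st.weight := by simp only [hs', apply, if_neg hnd]
      have hstep : s'.stepCount U = st.stepCount U := by simp only [stepCount, hbad, hw]
      have hrho : s'.rho U = st.rho U := by simp only [rho, hstep]
      have hheavy : st.Heavy U := by
        intro H h1 h2
        have := hl'.heavy H h1 h2
        rw [hstep] at this
        simpa only [WalkData.quanta, walkData, hw] using this
      have hag : ¬ (st.agreed ∨ ∀ p, p ∉ st.bad → st.dir = some (!(st.coinFlip (A p)))) :=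
        hl'.agreed
      push Not at hag
      have hlive : st.Live U e :=
        ⟨by rw [ht'] at hlt; omega, hag.1, hl'.clean, hheavy,
          fun τ hτ => hl'.clipless τ (hτ.trans (Nat.lt_succ_self _))⟩
      rw [fraudPotential_none hb' hl' hd', fraudPotential_some hb hlive hl.1]
      have hpast : s'.past U e = st.past U e + (st.rho U - U.lam * st.badSum st.t ^ 2) := by
        unfold past
        rw [ht', Finset.sum_Ico_succ_top hge, hrho]
        congr 1
        · exact Finset.sum_congr rfl fun τ _ => by rw [badSum_congr hbad hw (by rw [hboard])]
        · rw [badSum_congr hbad hw (by rw [hboard])]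
      rw [hpast, Real.exp_add]
      refine mul_le_mul_of_nonneg_left ?_ (Real.exp_pos _).le
      exact exp_le_current hs hl (by push Not; exact hag.2)
        (hl'.clipless st.t (Nat.lt_succ_self _)) hheavy
    · rw [fraudPotential_dead hb' hl']
      exact fraudPotential_nonneg hs

/-- A corruption during the epoch separates `bad` from `startBad` and sets the potential to 0, so
the bad set, the weights and `rho` are constant while it is alive. -/
lemma fraudPotential_isSupermartingale (hε : 0 ≤ P.ε) (U : Tuning) (e : ℕ) :
    IsSupermartingale (fraudPotential (P := P) U e) := by
  constructor
  · intro st ω i hs _ hi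
    by_cases hb : st.Before e
    · rw [fraudPotential_before hb, fraudPotential_before (st := st.apply ω (.corrupt i)) hb]
    · rw [fraudPotential_dead (st := st.apply ω (.corrupt i)) hb]
      · exact fraudPotential_nonneg hs
      · intro h
        have h1 : st.startBad = insert i st.bad := h.clean
        exact hi (hs.startBad_subset (h1 ▸ Finset.mem_insert_self i st.bad))
  · intro st ω σ hs ht hd
    exact fraudPotential_start hs ht hd ω hε σ
  · intro st ω i v _ _ hd _ hi
    by_cases hb : st.Before e
    · rw [fraudPotential_before hb, fraudPotential_before (st := st.apply ω (.write i v)) hb]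
    · by_cases hl : st.Live U e
      · have hl' := (live_write (U := U) (e := e) ω i v).2 hl
        rw [fraudPotential_some (st := st.apply ω (.write i v)) hb hl' hd,
          fraudPotential_some hb hl hd, past_write, current_write,
          WalkData.value_update_bad (show i ∈ (st.walkData U).bad from hi)]
        exact le_rfl
      · rw [fraudPotential_dead hb hl, fraudPotential_dead (st := st.apply ω (.write i v)) hb
          (fun h => hl ((live_write ω i v).1 h))]
  · intro st i v hs ht hd hlen hi
    by_cases hb : st.Before e
    · rw [fraudPotential_before hb, fraudPotential_before (st := st.apply _ (.write i v)) hb,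
        fraudPotential_before (st := st.apply _ (.write i v)) hb]
      norm_num
    · by_cases hl : st.Live U e
      · have hl' := fun ω => (live_write (U := U) (e := e) ω i v).2 hl
        rw [fraudPotential_some (st := st.apply _ (.write i v)) hb (hl' _) hd,
          fraudPotential_some (st := st.apply _ (.write i v)) hb (hl' _) hd,
          fraudPotential_some hb hl hd, past_write, past_write, current_write, current_write]
        have hcoin : ∀ b : Bool, writtenValue (fun _ : Fin P.iterations × Fin P.m × Fin P.n => b)
            st i v = b := by
          intro b
          unfold writtenValue coin
          rw [if_neg hi, dif_pos ⟨ht, hlen⟩]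
        rw [hcoin, hcoin, ← mul_add, ← mul_add, mul_left_comm 2]
        refine mul_le_mul_of_nonneg_left ?_ (Real.exp_pos _).le
        unfold current
        rw [mul_left_comm 2]
        refine mul_le_mul_of_nonneg_left ?_ (Real.exp_pos _).le
        exact WalkData.value_average (hs.walkData_valid U) hi (hs.length_le st.t) hlen
      · rw [fraudPotential_dead hb hl, fraudPotential_dead (st := st.apply _ (.write i v)) hb
          (fun h => hl ((live_write _ i v).1 h)), fraudPotential_dead
          (st := st.apply _ (.write i v)) hb (fun h => hl ((live_write _ i v).1 h))]
        norm_num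
  · intro st ω A hs _ hl
    exact fraudPotential_complete hs ω hl

/-- The next move may be the end of epoch `e`, with no corruptions in the course of the epoch and
without agreement. -/
structure CleanEnd (st : State P) (e : ℕ) : Prop where
  t_eq : st.t + 1 = (e + 1) * P.T
  agreed : ¬ st.agreed
  clean : st.startBad = st.bad
  complete : ∃ A, st.Legal (.complete A) ∧
    ¬ ∀ p, p ∉ st.bad → st.dir = some (!(st.coinFlip (A p)))

/-- The bad processes are unlikely to have contributed little in an epoch without corruptions and
without agreement. -/
lemma measure_fraud_le (hε : 0 ≤ P.ε) (hT : 0 < P.T) (𝒜 : Adversary P) (k : ℕ) (U : Tuning)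
    (e : ℕ) (a : ℝ) :
    (coinMeasure P).real {ω | (play 𝒜 ω k).CleanEnd e ∧ (play 𝒜 ω k).Heavy U ∧
      (∀ τ, (play 𝒜 ω k).Clipless τ) ∧
      a ≤ ∑ τ ∈ Finset.Ico (e * P.T) ((e + 1) * P.T),
        ((play 𝒜 ω k).rho U - U.lam * (play 𝒜 ω k).badSum τ ^ 2)} ≤ Real.exp (-a) := by
  have := (fraudPotential_isSupermartingale hε U e).measure_le hε
    (fun st hs => fraudPotential_nonneg hs) 𝒜 k
    (fun st => st.CleanEnd e ∧ st.Heavy U ∧ (∀ τ, st.Clipless τ) ∧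
      a ≤ ∑ τ ∈ Finset.Ico (e * P.T) ((e + 1) * P.T), (st.rho U - U.lam * st.badSum τ ^ 2))
    (Real.exp_pos a) (by
      rintro st hs ⟨hend, hh, hc, ha⟩
      obtain ⟨A, hl, hna⟩ := hend.complete
      have hexp : (e + 1) * P.T = e * P.T + P.T := by ring
      have hte := hend.t_eq
      have hge : e * P.T ≤ st.t := by omega
      have hb : ¬ st.Before e := by
        rintro (h | ⟨_, h⟩)
        · omega
        · exact hl.1 h
      have hlive : st.Live U e :=
        ⟨by omega, hend.agreed, hend.clean, hh, fun τ _ => hc τ⟩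
      rw [fraudPotential_some hb hlive hl.1]
      -- The move that ends the epoch would kill the potential, so it is evaluated just before: the
      -- last iteration is still represented by `current`, which dominates its exponential term.
      refine (Real.exp_le_exp.2 ha).trans ?_
      rw [← hte, Finset.sum_Ico_succ_top hge, Real.exp_add]
      exact mul_le_mul_of_nonneg_left (exp_le_current hs hl hna (hc _) hh) (Real.exp_pos _).le)
  refine this.trans (le_of_eq ?_)
  have hb : (State.init P).Before e := by
    rcases Nat.eq_zero_or_pos (e * P.T) with h | h
    · exact Or.inr ⟨h.symm, rfl⟩
    · exact Or.inl h
  rw [fraudPotential_before hb, Real.exp_neg, one_div]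

end State

end Fraud

end

noncomputable section

open scoped Classical
open MeasureTheory

/-! ### Sums over ordered and unordered pairs. -/

section Sym2Sums

variable {V : Type*}

/-- A sum over ordered pairs, written as a sum over unordered pairs. -/
lemma sum_sum_eq_sum_sym2 [DecidableEq V] (B : Finset V) (r : V → V → ℝ) (q : Sym2 V → ℝ)
    (hdiag : ∀ i, q s(i, i) = r i i) (hoff : ∀ i j, i ≠ j → q s(i, j) = r i j + r j i) :
    ∑ i ∈ B, ∑ j ∈ B, r i j = ∑ e ∈ B.sym2, q e := by
  rw [← Finset.sum_product', ← Finset.sum_fiberwise_of_maps_to (s := B ×ˢ B) (t := B.sym2)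
    (g := fun p => s(p.1, p.2)) (fun p hp => by
      rw [Finset.mk_mem_sym2_iff]; exact Finset.mem_product.1 hp)]
  refine Finset.sum_congr rfl fun e he => ?_
  induction e using Sym2.ind with
  | _ i j =>
    obtain ⟨hi, hj⟩ := Finset.mk_mem_sym2_iff.1 he
    by_cases hij : i = j
    · subst hij
      have : (B ×ˢ B).filter (fun p => s(p.1, p.2) = s(i, i)) = {(i, i)} := by
        ext ⟨x, y⟩
        simp only [Finset.mem_filter, Finset.mem_product, Finset.mem_singleton, Sym2.eq_iff,
          Prod.mk.injEq]
        constructor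
        · rintro ⟨_, h | h⟩ <;> tauto
        · rintro ⟨rfl, rfl⟩; tauto
      rw [this, Finset.sum_singleton, hdiag]
    · have : (B ×ˢ B).filter (fun p => s(p.1, p.2) = s(i, j)) = {(i, j), (j, i)} := by
        ext ⟨x, y⟩
        simp only [Finset.mem_filter, Finset.mem_product, Finset.mem_insert,
          Finset.mem_singleton, Sym2.eq_iff, Prod.mk.injEq]
        constructor
        · rintro ⟨_, h⟩; exact h
        · rintro (⟨rfl, rfl⟩ | ⟨rfl, rfl⟩) <;> tauto
      rw [this, Finset.sum_pair (by simp [hij]), hoff i j hij]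

lemma sum_sym2_le_sum_sum [DecidableEq V] (B : Finset V) {q : Sym2 V → ℝ} (hq : ∀ e, 0 ≤ q e) :
    ∑ e ∈ B.sym2, q e ≤ ∑ i ∈ B, ∑ j ∈ B, q s(i, j) := by
  rw [← Finset.sum_product', ← Finset.sum_fiberwise_of_maps_to (s := B ×ˢ B) (t := B.sym2)
    (g := fun p => s(p.1, p.2)) (fun p hp => by
      rw [Finset.mk_mem_sym2_iff]; exact Finset.mem_product.1 hp)]
  refine Finset.sum_le_sum fun e he => ?_
  induction e using Sym2.ind with
  | _ i j =>
    exact Finset.single_le_sum (f := fun p : V × V => q s(p.1, p.2)) (a := (i, j))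
      (fun _ _ => hq _)
      (Finset.mem_filter.2 ⟨Finset.mem_product.2 (Finset.mk_mem_sym2_iff.1 he), rfl⟩)

end Sym2Sums

/-! ### Deterministic accounting of weights in a typical play. -/

section Accounting

variable {P : Params}

/-- The bounds on the parameters that the accounting of the weights uses. -/
structure Regime (P : Params) (U : Tuning) (a : ℝ) : Prop where
  ε_pos : 0 < P.ε
  n_eq : (P.n : ℝ) = (4 + P.ε) * P.f
  three_lt : 3 < P.f
  m_pos : 0 < P.m
  T_pos : 0 < P.T
  view : (P.n : ℝ) ^ 2 * (16 / (P.ε * P.f * P.α) * (4 * P.Xmax)) ≤ P.wmin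
  loss : 3 * P.n * P.wmin * P.Kmax ≤ P.ε * P.f / 100
  n_mul_wmin : P.n * P.wmin ≤ 1
  step : P.n * U.η ^ 2 ≤ 8 / 100 * (P.ε * P.f)
  beta_mul : P.β * P.f ^ 2 ≤ 2 / 100 * (P.ε * P.f) * (P.m * P.T)
  beta : P.β ≤ 1 / 100 * (P.m * P.T)
  lam_pos : 0 < U.lam
  rho : ∀ st : State P, st.Inv → U.lam * (P.m * (∑ i ∈ st.bad, st.weight i ^ 2 +
    3 / 10 * (P.ε * P.f))) ≤ st.rho U
  a_le : a ≤ U.lam * (P.T * P.m * (1 / 100 * (P.ε * P.f)))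

namespace State

/-- The coin flips have been typical so far. -/
structure Typical (st : State P) (U : Tuning) (a : ℝ) : Prop where
  clipless : ∀ τ, st.Clipless τ
  dev : ∀ e < P.Kmax, ∀ i, i ∉ st.bad →
    ∑ τ ∈ Finset.Ico (e * P.T) ((e + 1) * P.T), colSum (st.board τ i) ^ 2 ≤ P.α
  corr : ∀ e < P.Kmax, ∀ i j, i ≠ j → i ∉ st.bad → j ∉ st.bad →
    ∑ τ ∈ Finset.Ico (e * P.T) ((e + 1) * P.T),
      colSum (st.board τ i) * colSum (st.board τ j) ≤ P.β
  fraud : ∀ e < P.Kmax, st.CleanEnd e → st.Heavy U →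
    ∑ τ ∈ Finset.Ico (e * P.T) ((e + 1) * P.T),
      (st.rho U - U.lam * st.badSum τ ^ 2) ≤ a

variable {U : Tuning} {a : ℝ} {st : State P}

lemma epoch_eq {e : ℕ} (h : st.t + 1 = (e + 1) * P.T) :
    st.epoch = Finset.Ico (e * P.T) ((e + 1) * P.T) := by
  unfold epoch
  rw [h, Nat.add_mul, one_mul, Nat.add_sub_cancel]

lemma epoch_lt (hT : 0 < P.T) {e : ℕ} (ht : st.t < P.iterations)
    (h : st.t + 1 = (e + 1) * P.T) : e < P.Kmax := by
  have : (e + 1) * P.T ≤ P.Kmax * P.T := by rw [← h]; exact ht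
  have := Nat.le_of_mul_le_mul_right this hT
  omega

/-- The factor that scales the capacities of the excess graph. -/
def excessScale (P : Params) : ℝ := 16 / (P.ε * P.f * P.α)

lemma excess_diag (st : State P) (A : Finset (Fin P.n)) (i : Fin P.n) :
    (st.excess A).cE s(i, i) =
      excessScale P * max 0 (st.dev A i - st.weight i ^ 2 * P.α) := by
  simp [excess, excessScale]

lemma excess_off (st : State P) (A : Finset (Fin P.n)) {i j : Fin P.n} (h : i ≠ j) :
    (st.excess A).cE s(i, j) =
      excessScale P * (2 * max 0 (st.corr A i j - st.weight i * st.weight j * P.β)) := by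
  simp [excess, excessScale, h]

lemma excessScale_nonneg (hε : 0 ≤ P.ε) : 0 ≤ excessScale P := by
  have := P.α_nonneg
  unfold excessScale; positivity

lemma dev_eq (st : State P) (A : Finset (Fin P.n)) (i : Fin P.n) :
    st.dev A i = st.corr A i i := Finset.sum_congr rfl fun τ _ => by ring

/-- By the product rule each change is `Xmax` times the change of one column, and over a whole epoch
a view changes the sums of one process by at most 1 in total. -/
lemma abs_corr_sub_le (hs : st.Inv) (A : Finset (Fin P.n)) (i j : Fin P.n) :
    |st.corr A i j - st.corr ∅ i j| ≤ 2 * P.Xmax := by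
  have hX := P.Xmax_nonneg
  unfold corr
  rw [← Finset.sum_sub_distrib]
  refine (Finset.abs_sum_le_sum_abs _ _).trans ?_
  have key : ∀ τ ∈ st.epoch, |st.weight i * st.weight j * st.X A τ i * st.X A τ j -
      st.weight i * st.weight j * st.X ∅ τ i * st.X ∅ τ j| ≤
        P.Xmax * |st.X A τ j - st.X ∅ τ j| + P.Xmax * |st.X A τ i - st.X ∅ τ i| := by
    intro τ _
    have hw : |st.weight i * st.weight j| ≤ 1 := by
      rw [abs_of_nonneg (mul_nonneg (hs.weight_nonneg i) (hs.weight_nonneg j))]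
      exact mul_le_one₀ (hs.weight_le i) (hs.weight_nonneg j) (hs.weight_le j)
    have e : st.weight i * st.weight j * st.X A τ i * st.X A τ j -
      st.weight i * st.weight j * st.X ∅ τ i * st.X ∅ τ j = (st.weight i * st.weight j) *
        (st.X A τ i * (st.X A τ j - st.X ∅ τ j) + (st.X A τ i - st.X ∅ τ i) * st.X ∅ τ j) := by
      ring
    rw [e, abs_mul]
    refine (mul_le_of_le_one_left (abs_nonneg _) hw).trans ((abs_add_le _ _).trans ?_)
    rw [abs_mul, abs_mul, mul_comm |st.X A τ i - st.X ∅ τ i|]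
    exact add_le_add (mul_le_mul_of_nonneg_right (st.abs_X_le A τ i) (abs_nonneg _))
      (mul_le_mul_of_nonneg_right (st.abs_X_le ∅ τ j) (abs_nonneg _))
  refine (Finset.sum_le_sum key).trans ?_
  rw [Finset.sum_add_distrib, ← Finset.mul_sum, ← Finset.mul_sum]
  have h1 := mul_le_mul_of_nonneg_left (st.sum_abs_X_sub_le A st.epoch i) hX
  have h2 := mul_le_mul_of_nonneg_left (st.sum_abs_X_sub_le A st.epoch j) hX
  linarith

lemma abs_max_zero_sub_le (x y c : ℝ) : |max 0 (x - c) - max 0 (y - c)| ≤ |x - y| := by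
  have := abs_sup_sub_sup_le_abs (x - c) (y - c) 0
  rw [max_comm 0, max_comm 0]
  simpa using this

lemma abs_excess_sub_le (hε : 0 ≤ P.ε) (hs : st.Inv) (A : Finset (Fin P.n)) (i j : Fin P.n) :
    |(st.excess A).cE s(i, j) - (st.excess ∅).cE s(i, j)| ≤
      excessScale P * (4 * P.Xmax) := by
  have hX := P.Xmax_nonneg
  have hc := excessScale_nonneg (P := P) hε
  have h1 := abs_corr_sub_le hs A i j
  by_cases h : i = j
  · subst h
    rw [excess_diag, excess_diag, ← mul_sub, abs_mul, abs_of_nonneg hc]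
    refine mul_le_mul_of_nonneg_left ((abs_max_zero_sub_le _ _ _).trans ?_) hc
    rw [dev_eq, dev_eq]
    linarith
  · rw [excess_off st A h, excess_off st ∅ h, ← mul_sub, ← mul_sub, abs_mul, abs_mul,
      abs_of_nonneg hc, abs_of_nonneg (zero_le_two (α := ℝ))]
    refine mul_le_mul_of_nonneg_left ?_ hc
    have := abs_max_zero_sub_le (st.corr A i j) (st.corr ∅ i j)
      (st.weight i * st.weight j * P.β)
    linarith

lemma sum_abs_excess_sub_le (hR : Regime P U a) (hs : st.Inv) (A : Finset (Fin P.n)) :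
    ∑ i, ∑ j, |(st.excess A).cE s(i, j) - (st.excess ∅).cE s(i, j)| ≤ P.wmin := by
  refine le_trans ?_ hR.view
  refine (Finset.sum_le_sum fun i _ => Finset.sum_le_sum fun j _ =>
    abs_excess_sub_le hR.ε_pos.le hs A i j).trans (le_of_eq ?_)
  simp only [Finset.sum_const, Finset.card_univ, Fintype.card_fin, nsmul_eq_mul, excessScale]
  ring

/-- The saturation level of `i` in the matching computed on the actual blackboards. -/
def trueLoad (st : State P) (i : Fin P.n) : ℝ := CapGraph.load (st.excess ∅).risingTide i

/-- Combines the Lipschitz bound with `hR.view`. Although each process uses its own view, all weight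
changes can thus be compared with one true matching. -/
lemma abs_load_sub_le (hR : Regime P U a) (hs : st.Inv) (A : Finset (Fin P.n)) (i : Fin P.n) :
    |CapGraph.load (st.excess A).risingTide i - st.trueLoad i| ≤ P.wmin := by
  obtain ⟨h1, h2⟩ := excess_spec hR.ε_pos.le hs.weight_nonneg A
  obtain ⟨h3, h4⟩ := excess_spec hR.ε_pos.le hs.weight_nonneg (∅ : Finset (Fin P.n))
  have := CapGraph.sum_abs_load_sub_le (G := st.excess A) (G' := st.excess ∅) rfl h1 h2 h3 h4
  refine le_trans ?_ (this.trans (sum_abs_excess_sub_le hR hs A))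
  exact Finset.single_le_sum (f := fun i => |CapGraph.load (st.excess A).risingTide i -
    CapGraph.load (st.excess ∅).risingTide i|) (fun _ _ => abs_nonneg _) (Finset.mem_univ i)

lemma trueLoad_le (hR : Regime P U a) (hs : st.Inv) (i : Fin P.n) :
    st.trueLoad i ≤ st.weight i :=
  (excess_spec hR.ε_pos.le hs.weight_nonneg ∅).1.2 i

lemma nextWeight_bounds (hR : Regime P U a) (hs : st.Inv) (A : Fin P.n → Finset (Fin P.n))
    (i : Fin P.n) :
    st.weight i - st.trueLoad i - 2 * P.wmin ≤ st.nextWeight A i ∧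
      st.nextWeight A i ≤ st.weight i - st.trueLoad i + P.wmin := by
  have h1 := abs_le.1 (abs_load_sub_le hR hs (A i) i)
  have h2 := trueLoad_le hR hs i
  have h3 := P.wmin_nonneg
  unfold nextWeight
  split_ifs with h
  · unfold localWeight; constructor <;> linarith [h1.1, h1.2]
  · unfold localWeight at h; constructor <;> linarith [h1.1, h1.2]

/-- The purpose of rounding: a vertex saturated in the true graph keeps at most `wmin` in its own
view. -/
lemma nextWeight_eq_zero (hR : Regime P U a) (hs : st.Inv) (A : Fin P.n → Finset (Fin P.n))
    {i : Fin P.n} (h : st.trueLoad i = st.weight i) : st.nextWeight A i = 0 := by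
  have h1 := abs_le.1 (abs_load_sub_le hR hs (A i) i)
  unfold nextWeight localWeight
  rw [if_neg (by linarith [h1.1])]

lemma nextWeight_of_weight_eq_zero (hε : 0 ≤ P.ε) (hs : st.Inv)
    (A : Fin P.n → Finset (Fin P.n)) {i : Fin P.n} (h : st.weight i = 0) :
    st.nextWeight A i = 0 :=
  le_antisymm (h ▸ nextWeight_le hε hs.weight_nonneg A i) (st.nextWeight_nonneg A i)

lemma corr_empty_eq (hc : ∀ τ, st.Clipless τ) {e : ℕ} (h : st.t + 1 = (e + 1) * P.T)
    {i j : Fin P.n} (hi : i ∉ st.bad) (hj : j ∉ st.bad) :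
    st.corr ∅ i j = st.weight i * st.weight j *
      ∑ τ ∈ Finset.Ico (e * P.T) ((e + 1) * P.T),
        colSum (st.board τ i) * colSum (st.board τ j) := by
  unfold corr
  rw [epoch_eq h, Finset.mul_sum]
  refine Finset.sum_congr rfl fun τ _ => ?_
  rw [X_empty_of_abs_le (hc τ i hi), X_empty_of_abs_le (hc τ j hj)]
  ring

/-- Edges between good processes have no excess. -/
lemma excess_good_eq_zero (hs : st.Inv) (hty : st.Typical U a) {e : ℕ} (he : e < P.Kmax)
    (h : st.t + 1 = (e + 1) * P.T) {i j : Fin P.n} (hi : i ∉ st.bad) (hj : j ∉ st.bad) :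
    (st.excess ∅).cE s(i, j) = 0 := by
  by_cases hij : i = j
  · subst hij
    rw [excess_diag, dev_eq, corr_empty_eq hty.clipless h hi hi, max_eq_left, mul_zero]
    have h1 := hty.dev e he i hi
    simp only [pow_two] at h1 ⊢
    have := mul_le_mul_of_nonneg_left h1 (mul_self_nonneg (st.weight i))
    linarith
  · rw [excess_off st ∅ hij, corr_empty_eq hty.clipless h hi hj, max_eq_left, mul_zero, mul_zero]
    have h1 := hty.corr e he i j hij hi hj
    have := mul_le_mul_of_nonneg_left h1 (mul_nonneg (hs.weight_nonneg i) (hs.weight_nonneg j))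
    linarith

/-- The matching takes no more weight from the good processes than from the bad ones. -/
lemma sum_trueLoad_good_le (hR : Regime P U a) (hs : st.Inv) (hty : st.Typical U a) {e : ℕ}
    (he : e < P.Kmax) (h : st.t + 1 = (e + 1) * P.T) :
    ∑ i ∈ st.badᶜ, st.trueLoad i ≤ ∑ i ∈ st.bad, st.trueLoad i := by
  obtain ⟨hf, -⟩ := excess_spec hR.ε_pos.le hs.weight_nonneg (∅ : Finset (Fin P.n))
  set μ := (st.excess ∅).risingTide with hμ
  have h1 : ∀ i ∈ st.badᶜ, st.trueLoad i = ∑ j ∈ st.bad, μ s(i, j) := by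
    intro i hi
    unfold trueLoad CapGraph.load
    rw [← hμ, ← Finset.sum_add_sum_compl st.bad, add_eq_left]
    refine Finset.sum_eq_zero fun j hj => ?_
    have h2 := hf.1 s(i, j)
    rw [excess_good_eq_zero hs hty he h (Finset.mem_compl.1 hi) (Finset.mem_compl.1 hj)] at h2
    exact le_antisymm h2.2 h2.1
  rw [Finset.sum_congr rfl h1, Finset.sum_comm]
  refine Finset.sum_le_sum fun j _ => ?_
  unfold trueLoad CapGraph.load
  rw [← hμ]
  refine le_trans (le_of_eq (Finset.sum_congr rfl fun i _ => by rw [Sym2.eq_swap]))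
    (Finset.sum_le_sum_of_subset_of_nonneg (Finset.subset_univ st.badᶜ) fun i _ _ => (hf.1 _).1)

/-- The good processes have not lost much more weight than the bad ones. -/
def Balanced (st : State P) : Prop :=
  ∑ i ∈ st.badᶜ, (1 - st.weight i) ≤ ∑ i ∈ st.bad, (1 - st.weight i) +
    3 * P.n * P.wmin * (st.t / P.T : ℕ)

lemma balanced_complete (hR : Regime P U a) (hs : st.Inv) (ht : st.t < P.iterations)
    (hty : st.Typical U a) (hb : st.Balanced) (ω : Coins P) (A : Fin P.n → Finset (Fin P.n)) :
    (st.apply ω (.complete A)).Balanced := by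
  unfold Balanced at hb ⊢
  have hw := P.wmin_nonneg
  by_cases hd : P.T ∣ st.t + 1
  · simp only [apply, if_pos hd]
    have hdiv : (st.t + 1) / P.T = st.t / P.T + 1 := Nat.succ_div_of_dvd hd
    obtain ⟨q, hq⟩ := hd
    have hq0 : q ≠ 0 := by rintro rfl; omega
    obtain ⟨e, rfl⟩ := Nat.exists_eq_succ_of_ne_zero hq0
    have hte : st.t + 1 = (e + 1) * P.T := by rw [hq, mul_comm]
    have h1 := sum_trueLoad_good_le hR hs hty (epoch_lt hR.T_pos ht hte) hte
    have h2 : ∑ i ∈ st.badᶜ, (1 - st.nextWeight A i) ≤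
        ∑ i ∈ st.badᶜ, ((1 - st.weight i) + st.trueLoad i + 2 * P.wmin) :=
      Finset.sum_le_sum fun i _ => by linarith [(nextWeight_bounds hR hs A i).1]
    have h3 : ∑ i ∈ st.bad, ((1 - st.weight i) + st.trueLoad i - P.wmin) ≤
        ∑ i ∈ st.bad, (1 - st.nextWeight A i) :=
      Finset.sum_le_sum fun i _ => by linarith [(nextWeight_bounds hR hs A i).2]
    simp only [Finset.sum_add_distrib, Finset.sum_sub_distrib, Finset.sum_const,
      nsmul_eq_mul] at h2 h3 hb ⊢
    have h4 : (st.badᶜ.card : ℝ) + st.bad.card = P.n := by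
      have := Finset.card_add_card_compl st.bad
      rw [Fintype.card_fin] at this
      exact_mod_cast (by omega : st.badᶜ.card + st.bad.card = P.n)
    -- A good process may lose `2 wmin` more than its load, a bad one `wmin` less.
    have h5 : (st.badᶜ.card : ℝ) * (2 * P.wmin) + st.bad.card * P.wmin ≤ 3 * P.n * P.wmin := by
      rw [← h4]
      have h6 : (0 : ℝ) ≤ st.badᶜ.card * P.wmin := by positivity
      have h7 : (0 : ℝ) ≤ st.bad.card * P.wmin := by positivity
      nlinarith
    rw [hdiv]
    push_cast at hb ⊢
    linarith
  · simp only [apply, if_neg hd]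
    rw [Nat.succ_div_of_not_dvd hd]
    exact hb

lemma balanced_step (hR : Regime P U a) (𝒜 : Adversary P) (ω : Coins P) (hs : st.Inv)
    (hty : st.Typical U a) (hb : st.Balanced) : (step 𝒜 ω st).Balanced := by
  unfold step
  by_cases ht : st.t = P.iterations
  · rwa [if_pos ht]
  · rw [if_neg ht]
    have hl := 𝒜.legal st
    cases hmv : 𝒜.move st with
    | corrupt i =>
      rw [hmv] at hl
      unfold Balanced at hb ⊢
      simp only [apply]
      rw [Finset.compl_insert, Finset.sum_insert hl.1]
      have hw : 0 ≤ 1 - st.weight i := by linarith [hs.weight_le i]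
      have : ∑ j ∈ st.badᶜ.erase i, (1 - st.weight j) ≤ ∑ j ∈ st.badᶜ, (1 - st.weight j) :=
        Finset.sum_le_sum_of_subset_of_nonneg (Finset.erase_subset _ _)
          fun j _ _ => by linarith [hs.weight_le j]
      linarith
    | start σ => exact hb
    | write i v => exact hb
    | complete A => exact balanced_complete hR hs (lt_of_le_of_ne hs.t_le ht) hty hb ω A

/-- On `H` use `w² ≥ 1 - 2(1 - w)`, on the bad set `w² ≤ w`. Since the good have lost at most as
much as the bad up to `εf / 100`, the squares on `H` sum to at least `n - f - 3|bad| + 2 ∑ w² - 0.02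
εf`, with the sum over the bad set. This is at least `2 ∑ w² + 0.98 εf`, because `|bad| ≤ f` and `n
= (4 + ε) f`. -/
lemma Balanced.heavy (hR : Regime P U a) (hs : st.Inv) (hb : st.Balanced) : st.Heavy U := by
  intro H hH hcard
  have hε := hR.ε_pos
  have hw := P.wmin_nonneg
  have hη := U.η_pos
  have hloss : ∑ i ∈ H, (1 - st.weight i) ≤
      ∑ i ∈ st.bad, (1 - st.weight i) + P.ε * P.f / 100 := by
    have h1 : ∑ i ∈ H, (1 - st.weight i) ≤ ∑ i ∈ st.badᶜ, (1 - st.weight i) :=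
      Finset.sum_le_sum_of_subset_of_nonneg hH fun j _ _ => by linarith [hs.weight_le j]
    have h2 : ((st.t / P.T : ℕ) : ℝ) ≤ P.Kmax := by
      have : st.t / P.T ≤ P.Kmax := by
        have := Nat.div_le_div_right (c := P.T) hs.t_le
        rwa [Params.iterations, Nat.mul_div_cancel _ hR.T_pos] at this
      exact_mod_cast this
    have h3 : 3 * P.n * P.wmin * ((st.t / P.T : ℕ) : ℝ) ≤ P.ε * P.f / 100 :=
      (mul_le_mul_of_nonneg_left h2 (by positivity)).trans hR.loss
    unfold Balanced at hb
    linarith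
  have hH2 : ∑ i ∈ H, (1 - 2 * (1 - st.weight i)) ≤ ∑ i ∈ H, st.weight i ^ 2 :=
    Finset.sum_le_sum fun i _ => by nlinarith [sq_nonneg (st.weight i - 1)]
  have hB2 : ∑ i ∈ st.bad, st.weight i ^ 2 ≤ ∑ i ∈ st.bad, (1 - (1 - st.weight i)) :=
    Finset.sum_le_sum fun i _ => by nlinarith [hs.weight_nonneg i, hs.weight_le i]
  rw [Finset.sum_sub_distrib, ← Finset.mul_sum] at hH2
  rw [Finset.sum_sub_distrib] at hB2
  simp only [Finset.sum_const, nsmul_eq_mul, mul_one] at hH2 hB2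
  have hc1 : (P.n : ℝ) ≤ H.card + st.bad.card + P.f := by exact_mod_cast hcard
  have hc2 : (st.bad.card : ℝ) ≤ P.f := by exact_mod_cast hs.card_le
  have hn := hR.n_eq
  have key : 2 * (∑ i ∈ st.bad, st.weight i ^ 2 + 9 / 20 * (P.ε * P.f)) ≤
      ∑ i ∈ H, st.weight i ^ 2 - P.n * U.η ^ 2 := by
    have := hR.step
    nlinarith
  have hquanta : (∑ i ∈ H, st.weight i ^ 2 - P.n * U.η ^ 2) / U.η ^ 2 ≤
      ∑ i ∈ H, ((st.walkData U).quanta i : ℝ) := by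
    -- Rounding down costs at most one quantum per column, for which `hR.step` sets aside `0.08 εf`.
    have h1 : ∑ i ∈ H, (st.weight i ^ 2 / U.η ^ 2 - 1) ≤
        ∑ i ∈ H, ((st.walkData U).quanta i : ℝ) :=
      Finset.sum_le_sum fun i _ => (Nat.sub_one_lt_floor _).le
    rw [Finset.sum_sub_distrib, ← Finset.sum_div, Finset.sum_const, nsmul_eq_mul, mul_one] at h1
    have h2 : (H.card : ℝ) ≤ P.n := by
      have := Finset.card_le_univ H
      rw [Fintype.card_fin] at this
      exact_mod_cast this
    rw [sub_div, mul_div_cancel_right₀ _ (by positivity)]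
    linarith
  show st.stepCount U ≤ _
  refine Nat.floor_le_of_le ?_
  push_cast
  rw [mul_right_comm, mul_comm _ (P.m : ℝ), mul_div_assoc]
  refine mul_le_mul_of_nonneg_left (le_trans ?_ hquanta) (Nat.cast_nonneg _)
  exact div_le_div_of_nonneg_right key (by positivity)

/-- After an epoch without corruptions and without agreement, the edges between bad processes have
a large excess. -/
lemma four_le_sum_excess (hR : Regime P U a) (hs : st.Inv) (hty : st.Typical U a)
    (hb : st.Balanced) {e : ℕ} (he : e < P.Kmax) (hend : st.CleanEnd e) :
    4 ≤ ∑ x ∈ st.bad.sym2, (st.excess ∅).cE x := by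
  have hε := hR.ε_pos
  have hf : (0 : ℝ) < P.f := by exact_mod_cast (by have := hR.three_lt; omega : 0 < P.f)
  have hmT : (0 : ℝ) < P.m * P.T := by
    have h1 : (0 : ℝ) < P.m := by exact_mod_cast hR.m_pos
    have h2 : (0 : ℝ) < P.T := by exact_mod_cast hR.T_pos
    positivity
  have hβ : 0 ≤ P.β := by unfold Params.β; positivity
  have hαβ : P.α = P.m * P.T + P.β := by unfold Params.α Params.β; ring
  set S := ∑ τ ∈ Finset.Ico (e * P.T) ((e + 1) * P.T), st.badSum τ ^ 2 with hS
  set Q := ∑ i ∈ st.bad, st.weight i ^ 2 with hQ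
  -- `rho` guarantees `Q + 0.30 εf` per iteration, in units of `lam m`; the probability allowance
  -- `a` takes back `0.01 εf`.
  have hSge : P.m * P.T * (Q + 29 / 100 * (P.ε * P.f)) ≤ S := by
    have h1 := hty.fraud e he hend (hb.heavy hR hs)
    rw [Finset.sum_sub_distrib, ← Finset.mul_sum, Finset.sum_const, Nat.card_Ico, nsmul_eq_mul,
      show (e + 1) * P.T - e * P.T = P.T by rw [Nat.add_mul, one_mul, Nat.add_sub_cancel_left]]
      at h1
    have h2 := mul_le_mul_of_nonneg_left (hR.rho st hs) (Nat.cast_nonneg P.T : (0 : ℝ) ≤ P.T)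
    have h3 := hR.a_le
    have h4 : U.lam * (P.m * P.T * (Q + 29 / 100 * (P.ε * P.f))) ≤ U.lam * S := by
      rw [← hS] at h1
      rw [← hQ] at h2
      nlinarith
    exact le_of_mul_le_mul_left h4 hR.lam_pos
  have hSeq : S = ∑ i ∈ st.bad, ∑ j ∈ st.bad, st.corr ∅ i j := by
    rw [hS]
    unfold corr badSum
    rw [epoch_eq hend.t_eq]
    have : ∀ τ ∈ Finset.Ico (e * P.T) ((e + 1) * P.T),
        (∑ i ∈ st.bad, st.weight i * st.X ∅ τ i) ^ 2 = ∑ i ∈ st.bad, ∑ j ∈ st.bad,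
          st.weight i * st.weight j * st.X ∅ τ i * st.X ∅ τ j := by
      intro τ _
      rw [pow_two, Finset.sum_mul_sum]
      exact Finset.sum_congr rfl fun i _ => Finset.sum_congr rfl fun j _ => by ring
    rw [Finset.sum_congr rfl this, Finset.sum_comm]
    exact Finset.sum_congr rfl fun i _ => Finset.sum_comm
  set r : Fin P.n → Fin P.n → ℝ := fun i j =>
    if i = j then max 0 (st.dev ∅ i - st.weight i ^ 2 * P.α)
    else max 0 (st.corr ∅ i j - st.weight i * st.weight j * P.β) with hr
  have hc := excessScale_nonneg (P := P) hε.le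
  have hsum : ∑ x ∈ st.bad.sym2, (st.excess ∅).cE x =
      excessScale P * ∑ i ∈ st.bad, ∑ j ∈ st.bad, r i j := by
    rw [← sum_sum_eq_sum_sym2 st.bad (fun i j => excessScale P * r i j)]
    · simp only [Finset.mul_sum]
    · intro i
      rw [excess_diag]; simp [hr]
    · intro i j hij
      have hcomm : st.corr ∅ j i = st.corr ∅ i j := Finset.sum_congr rfl fun τ _ => by ring
      rw [excess_off st ∅ hij]
      simp only [hr, if_neg hij, if_neg (Ne.symm hij), hcomm, mul_comm (st.weight j)]
      ring
  have hrge : ∀ i j, st.corr ∅ i j - st.weight i * st.weight j * P.β -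
      (if i = j then st.weight i ^ 2 * (P.m * P.T) else 0) ≤ r i j := by
    intro i j
    simp only [hr]
    by_cases hij : i = j
    · subst hij
      rw [if_pos rfl, if_pos rfl, dev_eq, hαβ]
      refine le_trans (le_of_eq ?_) (le_max_right _ _)
      ring
    · rw [if_neg hij, if_neg hij, sub_zero]
      exact le_max_right _ _
  -- As `α = mT + β`, the threshold `β` is charged to every ordered pair, and `mT` to the diagonal
  -- only, where it cancels the term `Q` in `S`.
  have hrsum : S - (∑ i ∈ st.bad, st.weight i) ^ 2 * P.β - Q * (P.m * P.T) ≤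
      ∑ i ∈ st.bad, ∑ j ∈ st.bad, r i j := by
    refine le_trans (le_of_eq ?_)
      (Finset.sum_le_sum fun i _ => Finset.sum_le_sum fun j _ => hrge i j)
    simp only [Finset.sum_sub_distrib]
    rw [← hSeq, pow_two, Finset.sum_mul_sum, Finset.sum_mul, hQ, Finset.sum_mul]
    congr 1
    · congr 1
      exact Finset.sum_congr rfl fun i _ => by rw [Finset.sum_mul]
    · refine Finset.sum_congr rfl fun i hi => ?_
      rw [Finset.sum_ite_eq, if_pos hi]
  have hwf : (∑ i ∈ st.bad, st.weight i) ^ 2 ≤ (P.f : ℝ) ^ 2 := by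
    refine pow_le_pow_left₀ (Finset.sum_nonneg fun i _ => hs.weight_nonneg i) ?_ 2
    refine (Finset.sum_le_sum fun i _ => hs.weight_le i).trans ?_
    simp only [Finset.sum_const, nsmul_eq_mul, mul_one]
    exact_mod_cast hs.card_le
  have hα : 0 < P.α := by rw [hαβ]; linarith
  have hα' : P.α ≤ 101 / 100 * (P.m * P.T) := by rw [hαβ]; linarith [hR.beta]
  -- The `β` terms cost another `0.02 εf`; with `α ≤ 1.01 mT`, the scaled total `16 · 0.27 / 1.01`
  -- still exceeds 4.
  have hfin : 27 / 100 * (P.ε * P.f) * (P.m * P.T) ≤ ∑ i ∈ st.bad, ∑ j ∈ st.bad, r i j := by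
    have := mul_le_mul_of_nonneg_right hwf hβ
    have := hR.beta_mul
    nlinarith
  rw [hsum]
  refine le_trans ?_ (mul_le_mul_of_nonneg_left hfin hc)
  unfold excessScale
  rw [div_mul_eq_mul_div, le_div_iff₀ (by positivity)]
  have h1 : 0 < P.ε * P.f := by positivity
  have h2 := mul_le_mul_of_nonneg_left hα' h1.le
  have h3 : 0 < P.ε * P.f * (P.m * P.T) := by positivity
  nlinarith

lemma one_le_sum_excess (hR : Regime P U a) (hs : st.Inv) (hty : st.Typical U a)
    (hb : st.Balanced) {e : ℕ} (he : e < P.Kmax) (hend : st.CleanEnd e) (A : Finset (Fin P.n)) :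
    1 ≤ ∑ x ∈ st.bad.sym2, (st.excess A).cE x := by
  have h1 := four_le_sum_excess hR hs hty hb he hend
  have h2 : ∑ x ∈ st.bad.sym2, (st.excess ∅).cE x ≤ ∑ x ∈ st.bad.sym2, (st.excess A).cE x +
      ∑ x ∈ st.bad.sym2, |(st.excess A).cE x - (st.excess ∅).cE x| := by
    rw [← Finset.sum_add_distrib]
    refine Finset.sum_le_sum fun x _ => ?_
    linarith [neg_abs_le ((st.excess A).cE x - (st.excess ∅).cE x)]
  have h3 := sum_sym2_le_sum_sum st.bad
    (q := fun x => |(st.excess A).cE x - (st.excess ∅).cE x|) fun _ => abs_nonneg _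
  have h4 : ∑ i ∈ st.bad, ∑ j ∈ st.bad, |(st.excess A).cE s(i, j) - (st.excess ∅).cE s(i, j)| ≤
      ∑ i, ∑ j, |(st.excess A).cE s(i, j) - (st.excess ∅).cE s(i, j)| :=
    (Finset.sum_le_sum fun i _ => Finset.sum_le_sum_of_subset_of_nonneg (Finset.subset_univ _)
      fun _ _ _ => abs_nonneg _).trans (Finset.sum_le_sum_of_subset_of_nonneg
        (Finset.subset_univ _) fun _ _ _ => Finset.sum_nonneg fun _ _ => abs_nonneg _)
  have h5 := sum_abs_excess_sub_le hR hs A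
  have h6 : P.wmin ≤ 1 := by
    have h7 := hR.n_mul_wmin
    have h8 : (1 : ℝ) ≤ P.n := by
      have hf : (3 : ℝ) < P.f := by exact_mod_cast hR.three_lt
      rw [hR.n_eq]
      nlinarith [hR.ε_pos]
    nlinarith [P.wmin_nonneg]
  linarith

/-- After an epoch without corruptions and without agreement, a bad process of positive weight
loses all of it, or the bad processes together lose a lot of weight. -/
lemma exists_kill_or_drop (hR : Regime P U a) (hs : st.Inv) (hty : st.Typical U a)
    (hb : st.Balanced) {e : ℕ} (he : e < P.Kmax) (hend : st.CleanEnd e)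
    (A : Fin P.n → Finset (Fin P.n)) :
    (∃ i ∈ st.bad, st.weight i ≠ 0 ∧ st.nextWeight A i = 0) ∨
      ∑ i ∈ st.bad, st.nextWeight A i ≤ ∑ i ∈ st.bad, st.weight i - 3 := by
  obtain ⟨hf, hbot⟩ := excess_spec hR.ε_pos.le hs.weight_nonneg (∅ : Finset (Fin P.n))
  have hload : ∀ i, st.trueLoad i = CapGraph.load (st.excess ∅).risingTide i := fun _ => rfl
  set μ := (st.excess ∅).risingTide with hμ
  by_cases hk : ∃ i ∈ st.bad, st.weight i ≠ 0 ∧ st.trueLoad i = st.weight i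
  · obtain ⟨i, hi, hw, hl⟩ := hk
    exact Or.inl ⟨i, hi, hw, nextWeight_eq_zero hR hs A hl⟩
  · right
    push Not at hk
    -- No bad process of positive weight is saturated. So an edge blocked by a bad vertex is blocked
    -- by one of weight 0, all of whose edges have capacity 0.
    have hsat : ∀ x ∈ st.bad.sym2, μ x = (st.excess ∅).cE x := by
      intro x hx
      rcases hbot x with h | ⟨i, hi, hl, -⟩
      · exact h
      · have hib : i ∈ st.bad := Finset.mem_sym2_iff.1 hx i hi
        have hw : st.weight i = 0 := by
          by_contra hne
          exact hk i hib hne hl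
        obtain ⟨j, rfl⟩ := hi
        have hzero : (st.excess ∅).cE s(i, j) = 0 := by
          by_cases hij : i = j
          · subst hij
            rw [excess_diag, dev_eq]
            simp [corr, hw]
          · rw [excess_off st ∅ hij]
            simp [corr, hw]
        have := hf.1 s(i, j)
        rw [hzero] at this ⊢
        exact le_antisymm this.2 this.1
    have h1 : ∑ x ∈ st.bad.sym2, (st.excess ∅).cE x ≤ ∑ i ∈ st.bad, st.trueLoad i := by
      rw [← Finset.sum_congr rfl hsat]
      refine (sum_sym2_le_sum_sum st.bad fun x => (hf.1 x).1).trans ?_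
      exact Finset.sum_le_sum fun i _ => Finset.sum_le_sum_of_subset_of_nonneg
        (Finset.subset_univ _) fun _ _ _ => (hf.1 _).1
    have h2 := four_le_sum_excess hR hs hty hb he hend
    have h3 : ∑ i ∈ st.bad, st.nextWeight A i ≤
        ∑ i ∈ st.bad, (st.weight i - st.trueLoad i + P.wmin) :=
      Finset.sum_le_sum fun i _ => (nextWeight_bounds hR hs A i).2
    rw [Finset.sum_add_distrib, Finset.sum_sub_distrib, Finset.sum_const, nsmul_eq_mul] at h3
    -- Of the load of at least 4, the views can give back at most `wmin` per process, hence at most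
    -- 1 in all.
    have h4 : (st.bad.card : ℝ) * P.wmin ≤ 1 := by
      refine le_trans (mul_le_mul_of_nonneg_right ?_ P.wmin_nonneg) hR.n_mul_wmin
      have := Finset.card_le_univ st.bad
      rw [Fintype.card_fin] at this
      exact_mod_cast this
    linarith

/-- The number of corruptions that may have spoiled a completed epoch. -/
def spoiled (st : State P) : ℕ :=
  if st.dir = none ∧ P.T ∣ st.t then st.bad.card else st.startBad.card

/-- The bad processes of weight `0`. -/
def killed (st : State P) : Finset (Fin P.n) := st.bad.filter fun i => st.weight i = 0

/-- A bound on the number of completed epochs. -/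
def Counted (st : State P) : Prop :=
  3 * ((st.t / P.T : ℕ) : ℝ) ≤ 3 * st.spoiled + 3 * st.killed.card +
    ∑ i ∈ st.bad, (1 - st.weight i)

lemma cleanEnd_of_not_agreed {A : Fin P.n → Finset (Fin P.n)} {ω : Coins P}
    (hl : st.Legal (.complete A)) {e : ℕ} (hte : st.t + 1 = (e + 1) * P.T)
    (hclean : st.startBad = st.bad) (hna : ¬ (st.apply ω (.complete A)).agreed) :
    st.CleanEnd e := by
  have hna' : ¬ (st.agreed ∨ ∀ p, p ∉ st.bad → st.dir = some (!(st.coinFlip (A p)))) := hna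
  exact ⟨hte, fun h => hna' (Or.inl h), hclean, A, hl, fun h => hna' (Or.inr h)⟩

/-- A completed epoch adds 3 on the left. If it saw a corruption, `spoiled` rises by switching from
`startBad` to `bad`; otherwise `exists_kill_or_drop` supplies a new killed process or a weight loss
of 3. -/
lemma counted_complete (hR : Regime P U a) (hs : st.Inv) (ht : st.t < P.iterations)
    (hty : st.Typical U a) (hb : st.Balanced) (hcount : st.Counted) {ω : Coins P}
    {A : Fin P.n → Finset (Fin P.n)} (hl : st.Legal (.complete A))
    (hna : ¬ (st.apply ω (.complete A)).agreed) : (st.apply ω (.complete A)).Counted := by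
  set s' := st.apply ω (.complete A) with hs'
  have ht' : s'.t = st.t + 1 := rfl
  have hbad' : s'.bad = st.bad := rfl
  have hstart' : s'.startBad = st.startBad := rfl
  have hdir' : s'.dir = none := rfl
  have hsp : st.spoiled = st.startBad.card := by
    unfold spoiled; rw [if_neg fun h => hl.1 h.1]
  unfold Counted at hcount ⊢
  rw [hsp] at hcount
  by_cases hd : P.T ∣ st.t + 1
  · have hw' : s'.weight = st.nextWeight A := by simp only [hs', apply, if_pos hd]
    have hsp' : s'.spoiled = st.bad.card := by
      unfold spoiled; rw [if_pos ⟨hdir', by rw [ht']; exact hd⟩, hbad']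
    have hdiv : s'.t / P.T = st.t / P.T + 1 := by rw [ht']; exact Nat.succ_div_of_dvd hd
    have hkill : st.killed ⊆ s'.killed := by
      intro i hi
      obtain ⟨h1, h2⟩ := Finset.mem_filter.1 hi
      refine Finset.mem_filter.2 ⟨h1, ?_⟩
      rw [hw']
      exact nextWeight_of_weight_eq_zero hR.ε_pos.le hs A h2
    have hkc : (st.killed.card : ℝ) ≤ s'.killed.card := by
      exact_mod_cast Finset.card_le_card hkill
    have hsum : ∑ i ∈ st.bad, (1 - st.weight i) ≤ ∑ i ∈ st.bad, (1 - s'.weight i) :=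
      Finset.sum_le_sum fun i _ => by
        rw [hw']; linarith [nextWeight_le hR.ε_pos.le hs.weight_nonneg A i]
    have hsc : (st.startBad.card : ℝ) ≤ st.bad.card := by
      exact_mod_cast Finset.card_le_card hs.startBad_subset
    rw [hsp', hbad', hdiv]
    push_cast
    by_cases hclean : st.startBad = st.bad
    · obtain ⟨q, hq⟩ := hd
      have hq0 : q ≠ 0 := by rintro rfl; omega
      obtain ⟨e, rfl⟩ := Nat.exists_eq_succ_of_ne_zero hq0
      have hte : st.t + 1 = (e + 1) * P.T := by rw [hq, mul_comm]
      have hend := cleanEnd_of_not_agreed hl hte hclean hna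
      rcases exists_kill_or_drop hR hs hty hb (epoch_lt hR.T_pos ht hte) hend A with
        ⟨i, hi, h1, h2⟩ | h
      · have hlt : st.killed.card < s'.killed.card := by
          refine Finset.card_lt_card ⟨hkill, fun hsub => h1 ?_⟩
          refine (Finset.mem_filter.1 (hsub (Finset.mem_filter.2 ⟨hi, ?_⟩))).2
          rw [hw']; exact h2
        have hlt' : (st.killed.card : ℝ) + 1 ≤ s'.killed.card := by exact_mod_cast hlt
        linarith
      · have h3 : ∑ i ∈ st.bad, (1 - st.weight i) + 3 ≤ ∑ i ∈ st.bad, (1 - s'.weight i) := by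
          rw [hw', Finset.sum_sub_distrib, Finset.sum_sub_distrib]
          linarith
        linarith
    · have hlt : st.startBad.card < st.bad.card :=
        Finset.card_lt_card (lt_of_le_of_ne hs.startBad_subset hclean)
      have hlt' : (st.startBad.card : ℝ) + 1 ≤ st.bad.card := by exact_mod_cast hlt
      linarith
  · have hw' : s'.weight = st.weight := by simp only [hs', apply, if_neg hd]
    have hsp' : s'.spoiled = st.startBad.card := by
      unfold spoiled; rw [if_neg fun h => hd (by rw [← ht']; exact h.2), hstart']
    have hdiv : s'.t / P.T = st.t / P.T := by rw [ht']; exact Nat.succ_div_of_not_dvd hd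
    have hk' : s'.killed = st.killed := by unfold killed; rw [hw', hbad']
    rw [hsp', hdiv, hk', hbad', hw']
    exact hcount

/-- The first start of an epoch resets `startBad` to `bad`, just as `spoiled` switches back to
`startBad`; corruptions only raise the right-hand side. -/
lemma counted_step (hR : Regime P U a) (𝒜 : Adversary P) (ω : Coins P) (hs : st.Inv)
    (hty : st.Typical U a) (hb : st.Balanced) (hcount : st.Counted)
    (hna : ¬ (step 𝒜 ω st).agreed) : (step 𝒜 ω st).Counted := by
  unfold step at hna ⊢
  by_cases ht : st.t = P.iterations
  · rwa [if_pos ht]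
  · rw [if_neg ht] at hna ⊢
    have hl := 𝒜.legal st
    cases hmv : 𝒜.move st with
    | corrupt i =>
      rw [hmv] at hl
      set s' := st.apply ω (.corrupt i) with hs'
      have hbad' : s'.bad = insert i st.bad := rfl
      have hsp : (st.spoiled : ℝ) ≤ s'.spoiled := by
        have : st.spoiled ≤ s'.spoiled := by
          unfold spoiled
          by_cases h : st.dir = none ∧ P.T ∣ st.t
          · rw [if_pos h, if_pos (show s'.dir = none ∧ P.T ∣ s'.t from h), hbad']
            exact Finset.card_le_card (Finset.subset_insert _ _)
          · rw [if_neg h, if_neg (show ¬ (s'.dir = none ∧ P.T ∣ s'.t) from h)]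
            exact le_rfl
        exact_mod_cast this
      have hk : (st.killed.card : ℝ) ≤ s'.killed.card := by
        have : st.killed.card ≤ s'.killed.card := by
          refine Finset.card_le_card fun j hj => ?_
          obtain ⟨h1, h2⟩ := Finset.mem_filter.1 hj
          exact Finset.mem_filter.2 ⟨Finset.mem_insert_of_mem h1, h2⟩
        exact_mod_cast this
      have hsum : ∑ j ∈ st.bad, (1 - st.weight j) ≤ ∑ j ∈ s'.bad, (1 - s'.weight j) := by
        rw [hbad', show s'.weight = st.weight from rfl, Finset.sum_insert hl.1]
        linarith [hs.weight_le i]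
      unfold Counted at hcount ⊢
      rw [show s'.t = st.t from rfl]
      linarith
    | start σ =>
      rw [hmv] at hl
      set s' := st.apply ω (.start σ) with hs'
      have hd : st.dir = none := hl
      have hsp : s'.spoiled = st.spoiled := by
        have hd' : s'.dir ≠ none := by simp [hs', apply]
        unfold spoiled
        rw [if_neg fun h => hd' h.1]
        by_cases h : P.T ∣ st.t
        · rw [if_pos ⟨hd, h⟩]; simp only [hs', apply, if_pos h]
        · rw [if_neg fun h' => h h'.2]; simp only [hs', apply, if_neg h]
      unfold Counted at hcount ⊢
      rw [hsp]
      exact hcount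
    | write i v => exact hcount
    | complete A =>
      rw [hmv] at hl hna
      exact counted_complete hR hs (lt_of_le_of_ne hs.t_le ht) hty hb hcount hl hna

lemma agreed_step {𝒜 : Adversary P} {ω : Coins P} (h : st.agreed) : (step 𝒜 ω st).agreed := by
  unfold step
  split_ifs
  · exact h
  · cases 𝒜.move st with
    | complete A => exact Or.inl h
    | _ => exact h

end State

open State

section Play

variable {U : Tuning} {a : ℝ} {𝒜 : Adversary P} {ω : Coins P}

lemma play_balanced (hR : Regime P U a) (hty : ∀ k, (play 𝒜 ω k).Typical U a) (k : ℕ) :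
    (play 𝒜 ω k).Balanced := by
  induction k with
  | zero => simp [play, State.Balanced, State.init]
  | succ k ih =>
    rw [play_succ]
    exact balanced_step hR 𝒜 ω (play_inv hR.ε_pos.le 𝒜 ω k) (hty k) ih

lemma play_counted (hR : Regime P U a) (hty : ∀ k, (play 𝒜 ω k).Typical U a) (k : ℕ)
    (hna : ¬ (play 𝒜 ω k).agreed) : (play 𝒜 ω k).Counted := by
  induction k with
  | zero => simp [play, Counted, State.init, killed]
  | succ k ih =>
    rw [play_succ] at hna ⊢
    exact counted_step hR 𝒜 ω (play_inv hR.ε_pos.le 𝒜 ω k) (hty k) (play_balanced hR hty k)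
      (ih fun h => hna (agreed_step h)) hna

/-- The epochs suffice for reaching agreement. -/
lemma agreed_of_typical (hR : Regime P U a) (hty : ∀ k, (play 𝒜 ω k).Typical U a) {k : ℕ}
    (ht : (play 𝒜 ω k).t = P.iterations) : (play 𝒜 ω k).agreed := by
  by_contra hna
  have hcount := play_counted hR hty k hna
  have hs := play_inv hR.ε_pos.le 𝒜 ω k
  set st := play 𝒜 ω k
  unfold Counted at hcount
  rw [ht, Params.iterations, Nat.mul_div_cancel _ hR.T_pos] at hcount
  have hf := hs.card_le
  have h1 : st.spoiled ≤ P.f := by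
    unfold spoiled
    split_ifs
    · exact hf
    · exact (Finset.card_le_card hs.startBad_subset).trans hf
  have h2 : st.killed.card ≤ P.f := (Finset.card_le_card (Finset.filter_subset _ _)).trans hf
  have h3 : ∑ i ∈ st.bad, (1 - st.weight i) ≤ P.f := by
    refine (Finset.sum_le_sum fun i _ => (by linarith [hs.weight_nonneg i] :
      1 - st.weight i ≤ 1)).trans ?_
    simp only [Finset.sum_const, nsmul_eq_mul, mul_one]
    exact_mod_cast hf
  have h4 : 3 * P.Kmax ≤ 7 * P.f := by
    have h1' : (st.spoiled : ℝ) ≤ P.f := by exact_mod_cast h1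
    have h2' : (st.killed.card : ℝ) ≤ P.f := by exact_mod_cast h2
    have : (3 * P.Kmax : ℝ) ≤ 7 * P.f := by linarith
    exact_mod_cast this
  -- `3 ⌊5f / 2⌋ ≥ (15f - 3) / 2`, which exceeds `7f` once `f > 3`.
  have := hR.three_lt
  unfold Params.Kmax at h4
  omega

lemma badCapacity_of_typical (hR : Regime P U a) (hty : ∀ k, (play 𝒜 ω k).Typical U a) :
    BadCapacityAtLeastOne 𝒜 ω := by
  rintro k ⟨ht, hdvd, hclean, hna⟩ A -
  have hs := play_inv hR.ε_pos.le 𝒜 ω k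
  have hb := play_balanced hR hty k
  have hty' := hty k
  rw [play_succ] at ht hna
  set st := play 𝒜 ω k
  have hne : st.t ≠ P.iterations := by
    intro h
    rw [step, if_pos h] at ht
    omega
  rw [step, if_neg hne] at ht hna
  have hl := 𝒜.legal st
  obtain ⟨q, hq⟩ := hdvd
  have hq0 : q ≠ 0 := by rintro rfl; omega
  obtain ⟨e, rfl⟩ := Nat.exists_eq_succ_of_ne_zero hq0
  have hte : st.t + 1 = (e + 1) * P.T := by rw [hq, mul_comm]
  have he := epoch_lt hR.T_pos (lt_of_le_of_ne hs.t_le hne) hte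
  cases hmv : 𝒜.move st with
  | complete B =>
    rw [hmv] at hl hna
    exact one_le_sum_excess hR hs hty' hb he (cleanEnd_of_not_agreed hl hte hclean hna) A
  | _ => rw [hmv] at ht; simp [State.apply] at ht

/-- Vacuous: a typical play reaches agreement before the epochs run out. -/
lemma badWeightsVanish_of_typical (hR : Regime P U a) (hty : ∀ k, (play 𝒜 ω k).Typical U a) :
    BadWeightsVanish 𝒜 ω :=
  fun _ ht hna => absurd (agreed_of_typical hR hty ht) hna

end Play

end Accounting

end

noncomputable section

open scoped Classical
open MeasureTheory

/-! ### Numerical estimates for the parameters. -/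

section Parameters

variable {P : Params}

/-- The parameters are in the range of the theorem, and `n` is large. -/
structure Scaled (P : Params) : Prop where
  n_large : 100 ≤ P.n
  c_large : 1000 ≤ P.c
  ε_pos : 0 < P.ε
  ε_le : P.ε ≤ 1 / 2
  n_eq : (P.n : ℝ) = (4 + P.ε) * P.f
  m_ge : 100000 * P.c * (P.n / P.ε ^ 2) ≤ P.m
  m_le : P.m ≤ P.n * (P.n / P.ε ^ 2)
  T_ge : 1000000 * P.c ^ 3 * (P.n ^ 2 * Real.log P.n ^ 3 / P.ε ^ 2) ≤ P.T
  T_le : P.T ≤ P.n * (P.n ^ 2 * Real.log P.n ^ 3 / P.ε ^ 2)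

namespace Scaled

lemma n_ge (h : Scaled P) : (100 : ℝ) ≤ P.n := by exact_mod_cast h.n_large

lemma one_le_log (h : Scaled P) : 1 ≤ Real.log P.n := by
  rw [Real.le_log_iff_exp_le (by linarith [h.n_ge])]
  linarith [Real.exp_one_lt_d9, h.n_ge]

lemma log_le (h : Scaled P) : Real.log P.n ≤ P.n :=
  (Real.log_le_sub_one_of_pos (by linarith [h.n_ge])).trans (by linarith)

lemma f_pos (h : Scaled P) : (0 : ℝ) < P.f := by
  have h1 := h.n_eq
  have h2 := h.n_ge
  by_contra hcon
  have : (P.f : ℝ) = 0 := le_antisymm (not_lt.1 hcon) (Nat.cast_nonneg _)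
  rw [this] at h1
  linarith

lemma four_mul_f_le (h : Scaled P) : (4 : ℝ) * P.f ≤ P.n := by
  rw [h.n_eq]; nlinarith [h.f_pos, h.ε_pos]

lemma n_le (h : Scaled P) : (P.n : ℝ) ≤ 9 / 2 * P.f := by
  rw [h.n_eq]; nlinarith [h.f_pos, h.ε_le]

lemma three_lt_f (h : Scaled P) : 3 < P.f := by
  have : (3 : ℝ) < P.f := by linarith [h.n_le, h.n_ge]
  exact_mod_cast this

/-- Integrality: `εf = n - 4f` is a positive integer. Hence `1 / ε` is polynomially bounded in `n`.
-/
lemma one_le_ε_mul_f (h : Scaled P) : 1 ≤ P.ε * P.f := by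
  have h1 : (4 * P.f : ℝ) < P.n := by rw [h.n_eq]; nlinarith [h.f_pos, h.ε_pos]
  have h2 : 4 * P.f + 1 ≤ P.n := by exact_mod_cast h1
  have h3 : (4 * P.f + 1 : ℝ) ≤ P.n := by exact_mod_cast h2
  rw [h.n_eq] at h3
  linarith

lemma inv_ε_sq_le (h : Scaled P) : 1 / P.ε ^ 2 ≤ (P.n : ℝ) ^ 2 := by
  have hε := h.ε_pos
  rw [div_le_iff₀ (by positivity)]
  have h1 : P.ε * P.f ≤ P.ε * P.n :=
    mul_le_mul_of_nonneg_left (by linarith [h.four_mul_f_le, h.f_pos]) hε.le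
  have h2 := h.one_le_ε_mul_f
  have : 1 ≤ P.ε * P.n := by linarith
  nlinarith

lemma ε_sq_mul_m (h : Scaled P) : 100000 * P.c * P.n ≤ P.ε ^ 2 * P.m := by
  have hε := h.ε_pos
  have := mul_le_mul_of_nonneg_left h.m_ge (by positivity : 0 ≤ P.ε ^ 2)
  refine le_trans (le_of_eq ?_) this
  field_simp

lemma ε_sq_mul_T (h : Scaled P) :
    1000000 * P.c ^ 3 * (P.n ^ 2 * Real.log P.n ^ 3) ≤ P.ε ^ 2 * P.T := by
  have hε := h.ε_pos
  have := mul_le_mul_of_nonneg_left h.T_ge (by positivity : 0 ≤ P.ε ^ 2)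
  refine le_trans (le_of_eq ?_) this
  field_simp

lemma m_pos (h : Scaled P) : (0 : ℝ) < P.m := by
  have h1 := h.ε_sq_mul_m
  have h2 := h.n_ge
  have h3 := h.c_large
  have h4 : 0 < 100000 * P.c * P.n := by positivity
  have h5 := h.ε_pos
  exact pos_of_mul_pos_right (h4.trans_le h1) (by positivity)

lemma T_pos (h : Scaled P) : (0 : ℝ) < P.T := by
  have h1 := h.ε_sq_mul_T
  have h2 := h.n_ge
  have h3 := h.c_large
  have h6 := h.one_le_log
  have h4 : 0 < 1000000 * P.c ^ 3 * (P.n ^ 2 * Real.log P.n ^ 3) := by positivity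
  have h5 := h.ε_pos
  exact pos_of_mul_pos_right (h4.trans_le h1) (by positivity)

lemma ε_sq_mul_le {x : ℝ} (h : Scaled P) (hx : 0 ≤ x) : P.ε ^ 2 * x ≤ x := by
  have : P.ε ^ 2 ≤ 1 := pow_le_one₀ h.ε_pos.le (by linarith [h.ε_le])
  nlinarith

/-- The quantity `c * log n`, which governs all tail bounds, is large. -/
lemma L_ge (h : Scaled P) : 1000 ≤ P.c * Real.log P.n := by
  nlinarith [h.c_large, h.one_le_log]

lemma L_cube_le (h : Scaled P) : 10000 * (P.c * Real.log P.n) ^ 3 ≤ P.T := by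
  have h1 := h.ε_sq_mul_T
  have h2 := h.ε_sq_mul_le h.T_pos.le
  have h3 : 0 ≤ (P.c * Real.log P.n) ^ 3 := by have := h.L_ge; positivity
  have h4 : (1 : ℝ) ≤ P.n ^ 2 := by nlinarith [h.n_ge]
  have h5 : 1000000 * P.c ^ 3 * (P.n ^ 2 * Real.log P.n ^ 3) =
    1000000 * (P.n ^ 2 * (P.c * Real.log P.n) ^ 3) := by ring
  rw [h5] at h1
  nlinarith

/-- The tuning of the potential. -/
def tuning (h : Scaled P) : Tuning where
  -- Measured against `Y = εfm`: `s` makes the walk error at most `0.05 Y`, `lam` makes `lam (nm)²`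
  -- equal to `0.02 Y`, and `δ` costs at most `0.02 Y`; `η` makes the rounding loss `n η² = 1 / n`.
  η := 1 / P.n
  s := 1080 / P.ε
  lam := 2 / 100 * (P.ε * P.f) / (P.n ^ 2 * P.m)
  δ := P.ε / 50
  η_pos := by have := h.n_ge; positivity
  s_pos := by have := h.ε_pos; positivity
  lam_nonneg := by have := h.ε_pos; positivity
  δ_pos := by have := h.ε_pos; positivity
  δ_le := by linarith [h.ε_le]

/-- The exponent of the probability that fraud is not detected. -/
def tail (P : Params) : ℝ :=
  2 / 100 * (P.ε * P.f) / (P.n ^ 2 * P.m) * (P.T * P.m * (1 / 100 * (P.ε * P.f)))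

/-- As `α ≥ mT`, a factor `1 / T` cancels. After squaring, the claim becomes `4096 c n³ ≤ ε² f² m`,
which uses that `m` is at least of order `n / ε²`. -/
lemma view (h : Scaled P) :
    (P.n : ℝ) ^ 2 * (16 / (P.ε * P.f * P.α) * (4 * P.Xmax)) ≤ P.wmin := by
  have hε := h.ε_pos
  have hf := h.f_pos
  have hm := h.m_pos
  have hT := h.T_pos
  have hn := h.n_ge
  have hc := h.c_large
  have hlog := h.one_le_log
  have hα : P.m * P.T ≤ P.α := by
    unfold Params.α
    have : 0 ≤ √(P.T * (P.c * Real.log P.n) ^ 3) := Real.sqrt_nonneg _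
    nlinarith
  have hX : P.Xmax ^ 2 = P.c * P.m * Real.log P.n := Real.sq_sqrt (by positivity)
  have hY : √(P.n * Real.log P.n) ^ 2 = P.n * Real.log P.n := Real.sq_sqrt (by positivity)
  have hX0 := P.Xmax_nonneg
  unfold Params.wmin
  set X := P.Xmax
  set Y := √(P.n * Real.log P.n)
  have hY0 : 0 ≤ Y := Real.sqrt_nonneg _
  have key : 64 * (P.n : ℝ) ^ 2 * X ≤ Y * (P.ε * P.f * P.m) := by
    refine le_of_sq_le_sq ?_ (by positivity)
    rw [mul_pow, mul_pow, mul_pow, hX, hY]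
    have h1 := h.ε_sq_mul_m
    have h2 : (P.n : ℝ) ^ 2 ≤ (9 / 2 * P.f) ^ 2 :=
      pow_le_pow_left₀ (by positivity) h.n_le 2
    have h3 : 4096 * (P.n : ℝ) ^ 3 * P.c ≤ P.ε ^ 2 * P.f ^ 2 * P.m := by
      have h4 := mul_le_mul_of_nonneg_left h1 (by positivity : (0 : ℝ) ≤ P.f ^ 2)
      have h5 := mul_le_mul_of_nonneg_left h2 (by positivity : (0 : ℝ) ≤ 4096 * P.n * P.c)
      have h6 : (0 : ℝ) ≤ P.n * P.c * P.f ^ 2 := by positivity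
      nlinarith
    have h7 := mul_le_mul_of_nonneg_left h3
      (by positivity : (0 : ℝ) ≤ P.n * Real.log P.n * P.m)
    nlinarith
  rw [le_div_iff₀ hT]
  calc _ = 64 * (P.n : ℝ) ^ 2 * X * P.T / (P.ε * P.f * P.α) := by ring
    _ ≤ 64 * (P.n : ℝ) ^ 2 * X * P.T / (P.ε * P.f * (P.m * P.T)) := by gcongr
    _ = 64 * (P.n : ℝ) ^ 2 * X / (P.ε * P.f * P.m) := by field_simp
    _ ≤ Y := by rw [div_le_iff₀ (by positivity)]; exact key

lemma n_sq_le (h : Scaled P) : 750 * (P.n : ℝ) ^ 2 ≤ P.ε * P.T := by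
  have hε := h.ε_pos
  have h1 := h.ε_sq_mul_T
  have h2 : (1 : ℝ) ≤ Real.log P.n ^ 3 := one_le_pow₀ h.one_le_log
  have h3 : (1 : ℝ) ≤ P.c ^ 3 := one_le_pow₀ (by linarith [h.c_large])
  have h4 : P.ε ^ 2 * P.T ≤ P.ε * P.T :=
    mul_le_mul_of_nonneg_right (by nlinarith [h.ε_le]) h.T_pos.le
  have h5 : (0 : ℝ) ≤ P.n ^ 2 := by positivity
  have h6 : (1 : ℝ) ≤ P.c ^ 3 * Real.log P.n ^ 3 := by nlinarith
  nlinarith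

lemma wmin_mul_T_le (h : Scaled P) : P.wmin * P.T ≤ P.n := by
  unfold Params.wmin
  rw [div_mul_cancel₀ _ h.T_pos.ne']
  have := h.n_ge
  refine Real.sqrt_le_iff.2 ⟨by positivity, ?_⟩
  nlinarith [h.log_le]

lemma loss (h : Scaled P) : 3 * P.n * P.wmin * P.Kmax ≤ P.ε * P.f / 100 := by
  have hK : (P.Kmax : ℝ) ≤ 5 / 2 * P.f := by
    have : 2 * P.Kmax ≤ 5 * P.f := by unfold Params.Kmax; omega
    have : (2 * P.Kmax : ℝ) ≤ 5 * P.f := by exact_mod_cast this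
    linarith
  have hT := h.T_pos
  have hw := P.wmin_nonneg
  have hn := h.n_ge
  have hf := h.f_pos
  have h1 := h.wmin_mul_T_le
  have h2 := h.n_sq_le
  have h3 : 750 * (P.n * P.wmin) ≤ P.ε := by
    refine le_of_mul_le_mul_right ?_ hT
    nlinarith
  calc _ ≤ 3 * P.n * P.wmin * (5 / 2 * P.f) := mul_le_mul_of_nonneg_left hK (by positivity)
    _ ≤ _ := by nlinarith

lemma n_mul_wmin (h : Scaled P) : P.n * P.wmin ≤ 1 := by
  have hT := h.T_pos
  have h1 := h.wmin_mul_T_le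
  have h2 := h.n_sq_le
  have hn := h.n_ge
  have h3 : P.ε * P.T ≤ P.T := by nlinarith [h.ε_le]
  refine le_of_mul_le_mul_right ?_ hT
  nlinarith

lemma sqrt_le (h : Scaled P) : √(P.T * (P.c * Real.log P.n) ^ 3) ≤ 1 / 100 * P.T := by
  refine Real.sqrt_le_iff.2 ⟨by have := h.T_pos; positivity, ?_⟩
  nlinarith [h.L_cube_le, h.T_pos]

lemma beta (h : Scaled P) : P.β ≤ 1 / 100 * (P.m * P.T) := by
  unfold Params.β
  have := mul_le_mul_of_nonneg_left h.sqrt_le h.m_pos.le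
  linarith

/-- After squaring, the `β` charge of all bad pairs is small if `T` is a large multiple of `f² (c
log n)³ / ε²`; this is where the order of `T` is needed. -/
lemma beta_mul (h : Scaled P) :
    P.β * P.f ^ 2 ≤ 2 / 100 * (P.ε * P.f) * (P.m * P.T) := by
  have hT := h.T_pos
  have hf := h.f_pos
  have hε := h.ε_pos
  have hL : 0 ≤ (P.c * Real.log P.n) ^ 3 := by have := h.L_ge; positivity
  have hsq : √(P.T * (P.c * Real.log P.n) ^ 3) ^ 2 = P.T * (P.c * Real.log P.n) ^ 3 :=
    Real.sq_sqrt (by positivity)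
  have key : √(P.T * (P.c * Real.log P.n) ^ 3) * P.f ≤ 2 / 100 * P.ε * P.T := by
    refine le_of_sq_le_sq ?_ (by positivity)
    rw [mul_pow, hsq]
    have h1 := h.ε_sq_mul_T
    have h2 : (4 * P.f : ℝ) ^ 2 ≤ P.n ^ 2 := pow_le_pow_left₀ (by positivity) h.four_mul_f_le 2
    have h3 := mul_le_mul_of_nonneg_right h2 hL
    have h4 : (P.c * Real.log P.n) ^ 3 * P.f ^ 2 ≤ 4 / 10000 * (P.ε ^ 2 * P.T) := by
      have h5 : 0 ≤ (P.c * Real.log P.n) ^ 3 * P.f ^ 2 := by positivity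
      have h6 : 1000000 * P.c ^ 3 * (P.n ^ 2 * Real.log P.n ^ 3) =
        1000000 * (P.n ^ 2 * (P.c * Real.log P.n) ^ 3) := by ring
      rw [h6] at h1
      nlinarith
    nlinarith
  unfold Params.β
  have := mul_le_mul_of_nonneg_left key (mul_pos h.m_pos hf).le
  nlinarith

lemma ε_mul_f_mul_m (h : Scaled P) : 100000 * (P.f * P.n) ≤ P.ε * (P.ε * P.f * P.m) := by
  have h1 := mul_le_mul_of_nonneg_left h.ε_sq_mul_m h.f_pos.le
  have h2 : (0 : ℝ) ≤ P.f * P.n := by positivity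
  have h3 := h.c_large
  nlinarith

/-- The budget with `Y = εfm`, `q = m ∑ w²` and `V = (nm)²`: half the variance is `q + 0.445 Y`; the
smoothing and walk errors leave `0.385`, the factor `1 - δ` leaves `0.36`, and the quartic term
`0.03` and the view cost `0.02` leave more than `0.30`. -/
lemma main_term_le {q Y Z s D G V δ lam : ℝ} (hlam : 0 ≤ lam) (hδ0 : 0 ≤ δ) (hδ1 : δ ≤ 1 / 100)
    (hδ : δ * q ≤ 2 / 100 * Y) (hY : 1 ≤ 1 / 100 * Y) (hZ : 2 * q + 9 / 10 * Y - 1 ≤ Z)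
    (hs : s / 4 ≤ 1 / 100 * Y) (hD : D ≤ 5 / 100 * Y) (hG : G ≤ 2 / 100 * Y)
    (hV : lam * V = 2 / 100 * Y) :
    lam * (q + 3 / 10 * Y) ≤
      lam * (1 - δ) * (Z / 2 - s / 4 - D) - 3 / 2 * (lam * (1 - δ)) ^ 2 * V - lam * G := by
  have h1 : q + 385 / 1000 * Y ≤ Z / 2 - s / 4 - D := by linarith
  have h2 := mul_le_mul_of_nonneg_left h1 (by linarith : 0 ≤ 1 - δ)
  have h3 : δ * Y ≤ 1 / 100 * Y := mul_le_mul_of_nonneg_right hδ1 (by linarith)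
  have h4 : q + 36 / 100 * Y ≤ (1 - δ) * (Z / 2 - s / 4 - D) := by linarith
  have h5 : (1 - δ) ^ 2 ≤ 1 := pow_le_one₀ (by linarith) (by linarith)
  have h6 : (1 - δ) ^ 2 * (3 / 100 * Y) ≤ 3 / 100 * Y := by
    have := mul_le_mul_of_nonneg_right h5 (by linarith : 0 ≤ 3 / 100 * Y)
    linarith
  have h7 : q + 3 / 10 * Y ≤
      (1 - δ) * (Z / 2 - s / 4 - D) - (1 - δ) ^ 2 * (3 / 100 * Y) - G := by linarith
  refine (mul_le_mul_of_nonneg_left h7 hlam).trans (le_of_eq ?_)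
  have h8 : 3 / 100 * Y = 3 / 2 * (lam * V) := by rw [hV]; ring
  rw [h8]; ring

lemma one_le_f (h : Scaled P) : (1 : ℝ) ≤ P.f := by
  have := h.three_lt_f
  exact_mod_cast (by omega : 1 ≤ P.f)

lemma s_le (h : Scaled P) : 1080 / P.ε / 4 ≤ 1 / 100 * (P.ε * P.f * P.m) := by
  have hε := h.ε_pos
  have hbig := h.ε_mul_f_mul_m
  rw [div_div, div_le_iff₀ (by positivity)]
  have h4 : (100 : ℝ) ≤ P.f * P.n := by nlinarith [h.one_le_f, h.n_ge]
  linarith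

lemma walk_le (h : Scaled P) :
    12 / (1080 / P.ε) * (P.n * P.m) ≤ 5 / 100 * (P.ε * P.f * P.m) := by
  have hε := h.ε_pos
  have hm := h.m_pos
  rw [div_div_eq_mul_div]
  have h5 : P.ε * P.m * P.n ≤ P.ε * P.m * (9 / 2 * P.f) :=
    mul_le_mul_of_nonneg_left h.n_le (by positivity)
  linarith

lemma gap_le (h : Scaled P) : (P.f : ℝ) ^ 2 / (P.ε / 50) ≤ 2 / 100 * (P.ε * P.f * P.m) := by
  have hε := h.ε_pos
  have hbig := h.ε_mul_f_mul_m
  rw [div_div_eq_mul_div, div_le_iff₀ hε]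
  have h1 : (P.f : ℝ) * (4 * P.f) ≤ P.f * P.n :=
    mul_le_mul_of_nonneg_left h.four_mul_f_le h.f_pos.le
  have h2 : (0 : ℝ) ≤ P.f * P.n := by positivity
  linarith

lemma rho (h : Scaled P) (st : State P) (hs : st.Inv) :
    h.tuning.lam * (P.m * (∑ i ∈ st.bad, st.weight i ^ 2 + 3 / 10 * (P.ε * P.f))) ≤
      st.rho h.tuning := by
  have hε := h.ε_pos
  have hm := h.m_pos
  have hn := h.n_ge
  have hQf : ∑ i ∈ st.bad, st.weight i ^ 2 ≤ P.f := by
    refine (Finset.sum_le_sum fun i _ =>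
      (pow_le_one₀ (hs.weight_nonneg i) (hs.weight_le i) : st.weight i ^ 2 ≤ 1)).trans ?_
    simp only [Finset.sum_const, nsmul_eq_mul, mul_one]
    exact_mod_cast hs.card_le
  have hη2 : h.tuning.η ^ 2 ≤ 1 :=
    pow_le_one₀ h.tuning.η_pos.le (by
      change 1 / (P.n : ℝ) ≤ 1
      rw [div_le_one (by positivity)]; linarith)
  have hK : 2 * P.m * (∑ i ∈ st.bad, st.weight i ^ 2 + 9 / 20 * (P.ε * P.f)) - 1 ≤
      st.stepCount h.tuning * h.tuning.η ^ 2 := by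
    have h1 : 2 * P.m * (∑ i ∈ st.bad, st.weight i ^ 2 + 9 / 20 * (P.ε * P.f)) /
        h.tuning.η ^ 2 < st.stepCount h.tuning + 1 := Nat.lt_floor_add_one _
    have h0 := pow_pos h.tuning.η_pos 2
    rw [div_lt_iff₀ h0] at h1
    linarith
  have hY : 1 ≤ 1 / 100 * (P.ε * P.f * P.m) := by
    have h1 := h.ε_mul_f_mul_m
    have h2 : P.ε * (P.ε * P.f * P.m) ≤ 1 * (P.ε * P.f * P.m) :=
      mul_le_mul_of_nonneg_right (by linarith [h.ε_le]) (by positivity)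
    have h3 : (100 : ℝ) ≤ P.f * P.n := by nlinarith [h.one_le_f]
    linarith
  have hδ : P.ε / 50 * (P.m * ∑ i ∈ st.bad, st.weight i ^ 2) ≤
      2 / 100 * (P.ε * P.f * P.m) := by
    have h1 := mul_le_mul_of_nonneg_left hQf (by positivity : 0 ≤ P.ε / 50 * P.m)
    linarith
  have hV : h.tuning.lam * (P.n * P.m) ^ 2 = 2 / 100 * (P.ε * P.f * P.m) := by
    change 2 / 100 * (P.ε * P.f) / (P.n ^ 2 * P.m) * ((P.n : ℝ) * P.m) ^ 2 = _
    field_simp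
  have key := main_term_le (Z := st.stepCount h.tuning * h.tuning.η ^ 2) h.tuning.lam_nonneg
    (by positivity) (by linarith [h.ε_le]) hδ hY (by linarith) h.s_le h.walk_le h.gap_le hV
  refine le_trans (le_of_eq ?_) key
  ring

lemma regime (h : Scaled P) : Regime P h.tuning (tail P) where
  ε_pos := h.ε_pos
  n_eq := h.n_eq
  three_lt := h.three_lt_f
  m_pos := by exact_mod_cast h.m_pos
  T_pos := by exact_mod_cast h.T_pos
  view := h.view
  loss := h.loss
  n_mul_wmin := h.n_mul_wmin
  step := by
    have hn := h.n_ge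
    have : P.n * h.tuning.η ^ 2 = 1 / P.n := by simp only [tuning]; field_simp
    rw [this, div_le_iff₀ (by positivity)]
    nlinarith [h.one_le_ε_mul_f]
  beta_mul := h.beta_mul
  beta := h.beta
  lam_pos := by
    have := h.ε_pos
    have := h.f_pos
    have := h.m_pos
    have := h.n_ge
    simp only [tuning]; positivity
  rho := h.rho
  a_le := le_of_eq rfl

lemma L_le_tail (h : Scaled P) : P.c * Real.log P.n ≤ tail P := by
  have hn := h.n_ge
  have hm := h.m_pos
  have hf := h.f_pos
  have hT := h.T_pos
  have hε := h.ε_pos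
  have hL := h.L_ge
  have e : tail P = 2 / 10000 * (P.ε ^ 2 * P.T) * P.f ^ 2 / P.n ^ 2 := by
    unfold tail; field_simp; ring
  rw [e, le_div_iff₀ (by positivity)]
  have h1 := h.ε_sq_mul_T
  have h6 : 1000000 * P.c ^ 3 * (P.n ^ 2 * Real.log P.n ^ 3) =
    1000000 * (P.n ^ 2 * (P.c * Real.log P.n) ^ 3) := by ring
  rw [h6] at h1
  set L := P.c * Real.log P.n
  have h2 : L ≤ L ^ 3 := by nlinarith [sq_nonneg L]
  have h3 := mul_le_mul_of_nonneg_right h1 (by positivity : (0 : ℝ) ≤ 2 / 10000 * P.f ^ 2)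
  have h4 : (1 : ℝ) ≤ P.f ^ 2 := one_le_pow₀ h.one_le_f
  have h5 : L * P.n ^ 2 ≤ L ^ 3 * P.n ^ 2 * P.f ^ 2 := by
    have h7 : 0 ≤ L ^ 3 * P.n ^ 2 := by positivity
    have h8 := mul_le_mul_of_nonneg_right h2 (by positivity : (0 : ℝ) ≤ P.n ^ 2)
    nlinarith
  have h9 : 0 ≤ L ^ 3 * P.n ^ 2 * P.f ^ 2 := by positivity
  nlinarith

end Scaled

end Parameters

end

noncomputable section

open scoped Classical
open MeasureTheory

/-! ### Union bound over all atypical events. -/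

section Probability

variable {P : Params}

namespace Scaled

lemma c_pos (h : Scaled P) : 0 < P.c := by linarith [h.c_large]

lemma sq_sqrt (h : Scaled P) :
    √(P.T * (P.c * Real.log P.n) ^ 3) ^ 2 = P.T * (P.c * Real.log P.n) ^ 3 :=
  Real.sq_sqrt (by have := h.L_ge; positivity)

lemma L_le_cube (h : Scaled P) : P.c * Real.log P.n ≤ 1 / 1000 * (P.c * Real.log P.n) ^ 3 := by
  have hL := h.L_ge
  set L := P.c * Real.log P.n
  have : 1000 ≤ L ^ 2 := by nlinarith
  nlinarith

lemma measure_clip_le (h : Scaled P) (𝒜 : Adversary P) (k τ : ℕ) (i : Fin P.n) :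
    (coinMeasure P).real {ω | i ∉ (play 𝒜 ω k).bad ∧
      P.Xmax ^ 2 ≤ ∑ τ' ∈ {τ}, colSum ((play 𝒜 ω k).board τ' i) ^ 2} ≤
        Real.exp (-(P.c * Real.log P.n) / 16) := by
  have hm := h.m_pos
  have hL := h.L_ge
  refine (measure_dev_le h.ε_pos.le 𝒜 k {τ} i (lam := 1 / (8 * P.m)) (by positivity)
    (le_of_eq (by field_simp)) _).trans (Real.exp_le_exp.2 ?_)
  have hX : P.Xmax ^ 2 = P.c * P.m * Real.log P.n :=
    Real.sq_sqrt (by have := h.one_le_log; have := h.c_pos; positivity)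
  rw [hX]
  have e1 : 1 / (8 * P.m : ℝ) * P.m = 1 / 8 := by field_simp
  have e2 : 1 / (8 * P.m : ℝ) * (P.c * P.m * Real.log P.n) = P.c * Real.log P.n / 8 := by
    field_simp
  rw [e1, e2]
  simp only [Finset.card_singleton, Nat.cast_one]
  linarith

lemma card_epoch (P : Params) (e : ℕ) :
    (Finset.Ico (e * P.T) ((e + 1) * P.T)).card = P.T := by
  rw [Nat.card_Ico, Nat.add_mul, one_mul, Nat.add_sub_cancel_left]

/-- This `lam` minimizes the exponent, which becomes `-(c log n)³ / 32`. -/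
lemma measure_dev_epoch_le (h : Scaled P) (𝒜 : Adversary P) (k e : ℕ) (i : Fin P.n) :
    (coinMeasure P).real {ω | i ∉ (play 𝒜 ω k).bad ∧
      P.α ≤ ∑ τ ∈ Finset.Ico (e * P.T) ((e + 1) * P.T), colSum ((play 𝒜 ω k).board τ i) ^ 2} ≤
        Real.exp (-(P.c * Real.log P.n) / 16) := by
  have hm := h.m_pos
  have hT := h.T_pos
  have hL := h.L_ge
  have hL3 := h.L_le_cube
  have hsq := h.sq_sqrt
  have hle := h.sqrt_le
  have hα : P.α = P.m * (P.T + √(P.T * (P.c * Real.log P.n) ^ 3)) := rfl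
  have hS0 : 0 ≤ √(P.T * (P.c * Real.log P.n) ^ 3) := Real.sqrt_nonneg _
  set S := √(P.T * (P.c * Real.log P.n) ^ 3)
  have e1 : S / (16 * P.m * P.T) * P.m = S / (16 * P.T) := by field_simp
  refine (measure_dev_le h.ε_pos.le 𝒜 k _ i (lam := S / (16 * P.m * P.T)) (by positivity)
    (by rw [mul_assoc, e1, ← mul_div_assoc, div_le_one (by positivity)]; linarith) _).trans
    (Real.exp_le_exp.2 ?_)
  rw [card_epoch, hα, ← mul_assoc, e1]
  have e2 : P.T * (S / (16 * P.T) + 8 * (S / (16 * P.T)) ^ 2) - S / (16 * P.T) * (P.T + S) =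
      -(S ^ 2 / P.T) / 32 := by field_simp; ring
  have e3 : S ^ 2 / P.T = (P.c * Real.log P.n) ^ 3 := by rw [hsq]; field_simp
  rw [e2, e3]
  linarith

lemma measure_corr_epoch_le (h : Scaled P) (𝒜 : Adversary P) (k e : ℕ) {i j : Fin P.n}
    (hij : i ≠ j) :
    (coinMeasure P).real {ω | (i ∉ (play 𝒜 ω k).bad ∧ j ∉ (play 𝒜 ω k).bad) ∧
      P.β ≤ ∑ τ ∈ Finset.Ico (e * P.T) ((e + 1) * P.T),
        colSum ((play 𝒜 ω k).board τ i) * colSum ((play 𝒜 ω k).board τ j)} ≤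
      Real.exp (-(P.c * Real.log P.n) / 16) := by
  have hm := h.m_pos
  have hT := h.T_pos
  have hL := h.L_ge
  have hL3 := h.L_le_cube
  have hsq := h.sq_sqrt
  have hle := h.sqrt_le
  have hβ : P.β = P.m * √(P.T * (P.c * Real.log P.n) ^ 3) := rfl
  have hS0 : 0 ≤ √(P.T * (P.c * Real.log P.n) ^ 3) := Real.sqrt_nonneg _
  set S := √(P.T * (P.c * Real.log P.n) ^ 3)
  have e1 : S / (8 * P.m * P.T) * P.m = S / (8 * P.T) := by field_simp
  refine (measure_corr_le h.ε_pos.le 𝒜 k _ hij (lam := S / (8 * P.m * P.T)) (by positivity)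
    (by rw [mul_assoc, e1, ← mul_div_assoc, div_le_one (by positivity)]; linarith) _).trans
    (Real.exp_le_exp.2 ?_)
  rw [card_epoch, hβ, ← mul_assoc (S / _), e1]
  have e2 : P.T * (4 * (S / (8 * P.T)) ^ 2) - S / (8 * P.T) * S = -(S ^ 2 / P.T) / 16 := by
    field_simp; ring
  have e3 : S ^ 2 / P.T = (P.c * Real.log P.n) ^ 3 := by rw [hsq]; field_simp
  rw [e2, e3]
  linarith

lemma measure_biUnion_le {ι Ω : Type*} [MeasurableSpace Ω] (μ : Measure Ω) (s : Finset ι)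
    (A : ι → Set Ω) {p : ℝ} (hA : ∀ x ∈ s, μ.real (A x) ≤ p) :
    μ.real (⋃ x ∈ s, A x) ≤ s.card * p := by
  refine (measureReal_biUnion_finset_le s A).trans ((Finset.sum_le_sum hA).trans ?_)
  rw [Finset.sum_const, nsmul_eq_mul]

/-- The number of events whose union contains the event that the coin flips are not typical. -/
def eventCount (P : Params) : ℕ :=
  (P.iterations + 1) * P.n + P.Kmax * P.n + P.Kmax * (P.n * P.n) + P.Kmax

lemma measure_not_typical_le (h : Scaled P) (𝒜 : Adversary P) (k : ℕ) :
    (coinMeasure P).real {ω | ¬ (play 𝒜 ω k).Typical h.tuning (tail P)} ≤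
      eventCount P * Real.exp (-(P.c * Real.log P.n) / 16) := by
  have hL := h.L_ge
  set p := Real.exp (-(P.c * Real.log P.n) / 16) with hp
  set A : ℕ × Fin P.n → Set (Coins P) := fun x => {ω | x.2 ∉ (play 𝒜 ω k).bad ∧
    P.Xmax ^ 2 ≤ ∑ τ' ∈ {x.1}, colSum ((play 𝒜 ω k).board τ' x.2) ^ 2} with hA
  set B : ℕ × Fin P.n → Set (Coins P) := fun x => {ω | x.2 ∉ (play 𝒜 ω k).bad ∧
    P.α ≤ ∑ τ ∈ Finset.Ico (x.1 * P.T) ((x.1 + 1) * P.T),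
      colSum ((play 𝒜 ω k).board τ x.2) ^ 2} with hB
  set C : ℕ × Fin P.n × Fin P.n → Set (Coins P) := fun x => {ω | x.2.1 ≠ x.2.2 ∧
    (x.2.1 ∉ (play 𝒜 ω k).bad ∧ x.2.2 ∉ (play 𝒜 ω k).bad) ∧
    P.β ≤ ∑ τ ∈ Finset.Ico (x.1 * P.T) ((x.1 + 1) * P.T),
      colSum ((play 𝒜 ω k).board τ x.2.1) * colSum ((play 𝒜 ω k).board τ x.2.2)} with hC
  set D : ℕ → Set (Coins P) := fun e => {ω | (play 𝒜 ω k).CleanEnd e ∧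
    (play 𝒜 ω k).Heavy h.tuning ∧ (∀ τ, (play 𝒜 ω k).Clipless τ) ∧
    tail P ≤ ∑ τ ∈ Finset.Ico (e * P.T) ((e + 1) * P.T),
      ((play 𝒜 ω k).rho h.tuning - h.tuning.lam * (play 𝒜 ω k).badSum τ ^ 2)} with hD
  set IA := Finset.range (P.iterations + 1) ×ˢ (Finset.univ : Finset (Fin P.n))
  set IB := Finset.range P.Kmax ×ˢ (Finset.univ : Finset (Fin P.n))
  set IC := Finset.range P.Kmax ×ˢ (Finset.univ : Finset (Fin P.n × Fin P.n))
  set ID := Finset.range P.Kmax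
  have hsub : {ω | ¬ (play 𝒜 ω k).Typical h.tuning (tail P)} ⊆
      (((⋃ x ∈ IA, A x) ∪ ⋃ x ∈ IB, B x) ∪ ⋃ x ∈ IC, C x) ∪ ⋃ x ∈ ID, D x := by
    intro ω hω
    by_contra hcon
    simp only [Set.mem_union, Set.mem_iUnion, not_or, not_exists] at hcon
    obtain ⟨⟨⟨h1, h2⟩, h3⟩, h4⟩ := hcon
    have hclip : ∀ τ, (play 𝒜 ω k).Clipless τ := by
      intro τ i hi
      by_cases hτ : τ < P.iterations + 1
      · have := h1 (τ, i) (by simp [IA, hτ])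
        by_contra hlt
        refine this ⟨hi, ?_⟩
        rw [Finset.sum_singleton, ← sq_abs (colSum _)]
        exact pow_le_pow_left₀ P.Xmax_nonneg (not_le.1 hlt).le 2
      -- Boards beyond the last iteration are empty, so only finitely many `τ` need an event.
      · have hs := play_inv h.ε_pos.le 𝒜 ω k
        rw [hs.empty τ (by have := hs.t_le; omega) i]
        simpa using P.Xmax_nonneg
    refine hω ⟨hclip, ?_, ?_, ?_⟩
    · intro e he i hi
      have := h2 (e, i) (by simp [IB, he])
      by_contra hlt
      exact this ⟨hi, (not_le.1 hlt).le⟩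
    · intro e he i j hij hi hj
      have := h3 (e, i, j) (by simp [IC, he])
      by_contra hlt
      exact this ⟨hij, ⟨hi, hj⟩, (not_le.1 hlt).le⟩
    · intro e he hce hh
      have := h4 e (by simp [ID, he])
      by_contra hlt
      exact this ⟨hce, hh, hclip, (not_le.1 hlt).le⟩
  have hA' := measure_biUnion_le (coinMeasure P) IA A (p := p) fun x _ =>
    h.measure_clip_le 𝒜 k x.1 x.2
  have hB' := measure_biUnion_le (coinMeasure P) IB B (p := p) fun x _ =>
    h.measure_dev_epoch_le 𝒜 k x.1 x.2
  have hC' := measure_biUnion_le (coinMeasure P) IC C (p := p) fun x _ => by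
    by_cases hx : x.2.1 = x.2.2
    · have : C x = ∅ := by ext ω; simp [hC, hx]
      rw [this, measureReal_empty]
      exact (Real.exp_pos _).le
    · exact (measureReal_mono fun ω hω => hω.2).trans (h.measure_corr_epoch_le 𝒜 k x.1 hx)
  have hD' := measure_biUnion_le (coinMeasure P) ID D (p := p) fun e _ =>
    (State.measure_fraud_le h.ε_pos.le (by exact_mod_cast h.T_pos) 𝒜 k h.tuning e _).trans
      (Real.exp_le_exp.2 (by linarith [h.L_le_tail]))
  refine (measureReal_mono hsub).trans ((measureReal_union_le _ _).trans ?_)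
  have u1 := measureReal_union_le (μ := coinMeasure P)
    ((⋃ x ∈ IA, A x) ∪ ⋃ x ∈ IB, B x) (⋃ x ∈ IC, C x)
  have u2 := measureReal_union_le (μ := coinMeasure P) (⋃ x ∈ IA, A x) (⋃ x ∈ IB, B x)
  have cA : IA.card = (P.iterations + 1) * P.n := by simp [IA]
  have cB : IB.card = P.Kmax * P.n := by simp [IB]
  have cC : IC.card = P.Kmax * (P.n * P.n) := by simp [IC]
  have cD : ID.card = P.Kmax := by simp [ID]
  rw [cA] at hA'
  rw [cB] at hB'
  rw [cC] at hC'
  rw [cD] at hD'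
  unfold eventCount
  push_cast at hA' hB' hC' hD' ⊢
  linarith

lemma Kmax_le (h : Scaled P) : P.Kmax ≤ P.n := by
  have h1 : 4 * P.f ≤ P.n := by exact_mod_cast h.four_mul_f_le
  unfold Params.Kmax
  omega

lemma m_le_pow (h : Scaled P) : P.m ≤ P.n ^ 4 := by
  have h1 : (P.m : ℝ) ≤ P.n ^ 4 := by
    refine h.m_le.trans ?_
    have := mul_le_mul_of_nonneg_left h.inv_ε_sq_le (by positivity : (0 : ℝ) ≤ P.n * P.n)
    calc _ = (P.n : ℝ) * P.n * (1 / P.ε ^ 2) := by ring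
      _ ≤ _ := this
      _ = _ := by ring
  exact_mod_cast h1

lemma T_le_pow (h : Scaled P) : P.T ≤ P.n ^ 8 := by
  have h1 : (P.T : ℝ) ≤ P.n ^ 8 := by
    refine h.T_le.trans ?_
    have hlog := h.one_le_log
    have h2 := pow_le_pow_left₀ (by linarith) h.log_le 3
    calc _ = (P.n : ℝ) ^ 3 * Real.log P.n ^ 3 * (1 / P.ε ^ 2) := by ring
      _ ≤ (P.n : ℝ) ^ 3 * P.n ^ 3 * P.n ^ 2 :=
        mul_le_mul (mul_le_mul_of_nonneg_left h2 (by positivity)) h.inv_ε_sq_le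
          (by have := h.ε_pos; positivity) (by positivity)
      _ = _ := by ring
  exact_mod_cast h1

lemma iterations_le (h : Scaled P) : P.iterations ≤ P.n ^ 9 :=
  calc P.Kmax * P.T ≤ P.n * P.n ^ 8 := Nat.mul_le_mul h.Kmax_le h.T_le_pow
    _ = P.n ^ 9 := by ring

lemma f_le (h : Scaled P) : P.f ≤ P.n := by
  have h1 : 4 * P.f ≤ P.n := by exact_mod_cast h.four_mul_f_le
  omega

lemma moveBound_le (h : Scaled P) : P.moveBound + 2 ≤ P.n ^ 15 := by
  have hn : 100 ≤ P.n := h.n_large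
  have h0 : 1 ≤ P.n := by omega
  have h1 : P.n ≤ P.n ^ 14 := Nat.le_self_pow (by norm_num) _
  have h2 : P.n ^ 9 ≤ P.n ^ 14 := Nat.pow_le_pow_right h0 (by norm_num)
  have h3 : P.iterations * (P.n * P.m) ≤ P.n ^ 14 :=
    calc _ ≤ P.n ^ 9 * (P.n * P.n ^ 4) :=
        Nat.mul_le_mul h.iterations_le (Nat.mul_le_mul_left _ h.m_le_pow)
      _ = _ := by ring
  have h4 : 100 * P.n ^ 14 ≤ P.n ^ 15 := by
    rw [pow_succ P.n 14, mul_comm]; exact Nat.mul_le_mul_left _ hn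
  have h5 := h.iterations_le
  have h6 := h.f_le
  unfold Params.moveBound
  omega

lemma eventCount_le (h : Scaled P) : eventCount P ≤ P.n ^ 11 := by
  have hn : 100 ≤ P.n := h.n_large
  have h0 : 1 ≤ P.n := by omega
  have h1 : P.n ≤ P.n ^ 10 := Nat.le_self_pow (by norm_num) _
  have h2 : (P.iterations + 1) * P.n ≤ P.n ^ 10 + P.n :=
    calc _ ≤ (P.n ^ 9 + 1) * P.n := Nat.mul_le_mul_right _ (by have := h.iterations_le; omega)
      _ = _ := by ring
  have h3 : P.Kmax * P.n ≤ P.n ^ 10 :=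
    calc _ ≤ P.n * P.n := Nat.mul_le_mul_right _ h.Kmax_le
      _ = P.n ^ 2 := by ring
      _ ≤ _ := Nat.pow_le_pow_right h0 (by norm_num)
  have h4 : P.Kmax * (P.n * P.n) ≤ P.n ^ 10 :=
    calc _ ≤ P.n * (P.n * P.n) := Nat.mul_le_mul_right _ h.Kmax_le
      _ = P.n ^ 3 := by ring
      _ ≤ _ := Nat.pow_le_pow_right h0 (by norm_num)
  have h5 : 100 * P.n ^ 10 ≤ P.n ^ 11 := by
    rw [pow_succ P.n 10, mul_comm]; exact Nat.mul_le_mul_left _ hn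
  have h6 := h.Kmax_le
  unfold eventCount
  omega

lemma measure_exists_not_typical_le (h : Scaled P) (𝒜 : Adversary P) :
    (coinMeasure P).real {ω | ∃ k, ¬ (play 𝒜 ω k).Typical h.tuning (tail P)} ≤
      (P.n : ℝ) ^ (-(1 / 32 * P.c)) := by
  have hn := h.n_ge
  have hlog := h.one_le_log
  refine (measure_exists_le h.ε_pos.le 𝒜 (fun st => ¬ st.Typical h.tuning (tail P))
    (h.measure_not_typical_le 𝒜)).trans ?_
  have h1 : ((P.moveBound : ℝ) + 2) ≤ P.n ^ 15 := by exact_mod_cast h.moveBound_le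
  have h2 : (eventCount P : ℝ) ≤ P.n ^ 11 := by exact_mod_cast h.eventCount_le
  have e : (P.n : ℝ) ^ 26 = Real.exp (26 * Real.log P.n) := by
    rw [show (26 : ℝ) = ((26 : ℕ) : ℝ) by norm_num, Real.exp_nat_mul,
      Real.exp_log (by linarith)]
  calc ((P.moveBound : ℝ) + 2) * (eventCount P * Real.exp (-(P.c * Real.log P.n) / 16))
      ≤ P.n ^ 15 * (P.n ^ 11 * Real.exp (-(P.c * Real.log P.n) / 16)) := by gcongr
    _ = P.n ^ 26 * Real.exp (-(P.c * Real.log P.n) / 16) := by ring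
    _ = Real.exp (26 * Real.log P.n + -(P.c * Real.log P.n) / 16) := by rw [e, Real.exp_add]
    -- Half of the exponent `c / 16` pays for the union bound: `26 ≤ c / 32` as `c ≥ 1000`.
    _ ≤ Real.exp (Real.log P.n * (-(1 / 32 * P.c))) := by
      refine Real.exp_le_exp.2 ?_
      have := mul_le_mul_of_nonneg_right h.c_large (by linarith : 0 ≤ Real.log P.n)
      linarith
    _ = _ := (Real.rpow_def_of_pos (by linarith) _).symm

end Scaled

end Probability

end

theorem mainTheorem6 :
    ∃ κ : ℝ, 0 < κ ∧ ∃ c₀ : ℝ, 0 < c₀ ∧ ∀ c : ℝ, c₀ ≤ c →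
    ∃ am : ℝ, 0 < am ∧ ∃ aT : ℝ, 0 < aT ∧ ∀ bm bT : ℝ, am ≤ bm → aT ≤ bT →
    ∃ N : ℕ, ∀ P : Params, N ≤ P.n → P.c = c →
      0 < P.ε → P.ε ≤ 1 / 2 → (P.n : ℝ) = (4 + P.ε) * P.f →
      am * (P.n / P.ε ^ 2) ≤ P.m → P.m ≤ bm * (P.n / P.ε ^ 2) →
      aT * (P.n ^ 2 * Real.log P.n ^ 3 / P.ε ^ 2) ≤ P.T →
      P.T ≤ bT * (P.n ^ 2 * Real.log P.n ^ 3 / P.ε ^ 2) →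
      ∀ 𝒜 : Adversary P,
        (coinMeasure P).real {ω | ¬ (BadCapacityAtLeastOne 𝒜 ω ∧ BadWeightsVanish 𝒜 ω)} ≤
          (P.n : ℝ) ^ (-(κ * c)) := by
  -- The upper constants enter only through `N`: once `n ≥ bm` and `n ≥ bT`, both `m` and `T` are
  -- bounded by fixed powers of `n`, as the union bound requires.
  refine ⟨1 / 32, by norm_num, 1000, by norm_num, fun c hc => ⟨100000 * c, by linarith,
    1000000 * c ^ 3, by have : 0 < c := by linarith
                        positivity, fun bm bT _ _ => ⟨max 100 (max ⌈bm⌉₊ ⌈bT⌉₊), ?_⟩⟩⟩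
  intro P hN hPc hε hε' hn hm hm' hT hT' 𝒜
  obtain ⟨h100, hN⟩ := max_le_iff.1 hN
  obtain ⟨hbm, hbT⟩ := max_le_iff.1 hN
  subst hPc
  have hlog : 0 ≤ Real.log P.n := Real.log_natCast_nonneg _
  have h : Scaled P :=
    { n_large := h100
      c_large := hc
      ε_pos := hε
      ε_le := hε'
      n_eq := hn
      m_ge := hm
      m_le := hm'.trans (mul_le_mul_of_nonneg_right (Nat.ceil_le.1 hbm) (by positivity))
      T_ge := hT
      T_le := hT'.trans (mul_le_mul_of_nonneg_right (Nat.ceil_le.1 hbT) (by positivity)) }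
  refine le_trans (MeasureTheory.measureReal_mono fun ω hω => ?_) (h.measure_exists_not_typical_le 𝒜)
  by_contra hty
  have hty' : ∀ k, (play 𝒜 ω k).Typical h.tuning (Scaled.tail P) := fun k => by
    by_contra hk
    exact hty ⟨k, hk⟩
  exact hω ⟨badCapacity_of_typical h.regime hty',
    badWeightsVanish_of_typical h.regime hty'⟩
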